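/- Let $B(d_1,\dots,d_n)$ ($n\ge1$, $d_i\in\mathbb{Z}_{\ge0}$) be the rational numbers determined by $B(0)=\tfrac18$ and, for every $d\ge0$, $n\ge0$ and $\mathbf d=(d_1,\dots,d_n)\in(\mathbb{Z}_{\ge0})^n$ with $(n,d)\neq(0,0)$, $$B(d,\mathbf d)=\sum_{i=1}^n(2d_i+1)\,B(d_1,\dots,d_i+d,\dots,d_n)+\frac12\sum_{\substack{a,b\ge0\\a+b=d-1}}\Bigl(B(a,b,\mathbf d)+\sum_{I\sqcup J=\{1,\dots,n\}}B(a,\mathbf d_I)\,B(b,\mathbf d_J)\Bigr),$$ so that $\langle\tau_{d_1}\cdots\tau_{d_n}\rangle^{\Theta}_{g}=B(\mathbf d)/\prod_{j=1}^n(2d_j+1)!!$, with $g=g(\mathbf d)=d_1+\cdots+d_n+1$, are the Brézin–Gross–Witten numbers. Put $X(\mathbf d)=\sum_{j=1}^n(2d_j+1)$ and $$C(\mathbf d)=\frac{2^{2g(\mathbf d)-1}\prod_{j=1}^n(2d_j+1)!!}{(X(\mathbf d)-1)!}\,\langle\tau_{d_1}\cdots\tau_{d_n}\rangle^{\Theta}_{g(\mathbf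 d)},\qquad \gamma(X)=\frac{\Gamma(\frac X2+1)^2}{\pi\,\Gamma(\frac{X+1}2)\,\Gamma(\frac{X+3}2)},\qquad \widehat C(\mathbf d)=\frac{C(\mathbf d)}{\gamma(X(\mathbf d))}.$$ There are polynomials $\widehat c_k\in\mathbb{Q}[p_1,p_2,\dots]$ ($k\ge0$), in variables $p_b$ ($b\ge1$), such that: 1. for every $n\ge1$ and every fixed $\mathbf d'\in(\mathbb{Z}_{\ge1})^{n-1}$, writing $\mathbf d=(\mathbf d',d_n)$ and $p_b(\mathbf d')$ for the multiplicity of $b$ in $\mathbf d'$, $$\widehat C(\mathbf d)\sim\sum_{k=0}^\infty\frac{\widehat c_k(p_1(\mathbf d'),p_2(\mathbf d'),\dots)}{X(\mathbf d)^k}\qquad(d_n\to\infty),$$ that is, for every $L\ge0$ the difference of $\widehat C(\mathbf d)$ and the sum of the terms with $k<L$ is $O(X(\mathbf d)^{-L})$ as $d_n\to\infty$; 2. $\widehat c_0=1$, and for every $k\ge1$ the polynomial $\widehat c_k$ vanishes when all $p_b=0$; 3. if $p_d$ is given degree $2d+1$ for every $d\ge1$, then $\deg\widehat c_k\le k-1$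 for every $k\ge1$. -/

import Mathlib

open Filter Asymptotics
open scoped Nat

namespace BGW

/-- `X(𝐝) = ∑ (2 d_j + 1)`, for a tuple `𝐝` of natural numbers written as a list. -/
def X (l : List ℕ) : ℕ := (l.map fun d => 2 * d + 1).sum

/-- The genus `g(𝐝) = |𝐝| + 1`. -/
def genus (l : List ℕ) : ℕ := l.sum + 1

/-- `𝐝_I`: the entries of `𝐝` whose position lies in `I`, in their original order. -/
def restrict (l : List ℕ) (I : Finset (Fin l.length)) : List ℕ :=
  ((List.finRange l.length).filter (· ∈ I)).map l.get

theorem X_cons (d : ℕ) (l : List ℕ) : X (d :: l) = 2 * d + 1 + X l := by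
  simp [X]

theorem X_restrict_le (l : List ℕ) (I : Finset (Fin l.length)) : X (restrict l I) ≤ X l := by
  have h : ((List.finRange l.length).map l.get).map (fun d => 2 * d + 1)
      = l.map fun d => 2 * d + 1 := by simp
  unfold X
  rw [← h]
  refine List.Sublist.sum_le_sum ?_ (fun _ _ => Nat.zero_le _)
  exact ((List.filter_sublist).map _).map _

theorem X_set (l : List ℕ) (i : Fin l.length) (d : ℕ) :
    X (l.set i (l.get i + d)) = X l + 2 * d := by
  induction l with
  | nil => exact i.elim0
  | cons a l ih =>
    refine Fin.cases ?_ (fun j => ?_) i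
    · simp [X_cons]; ring
    · have := ih j
      simp only [List.get_eq_getElem] at this
      simp [X_cons, this]; ring

/-- `B(d_1, …, d_n) = ⟨τ_{d_1} ⋯ τ_{d_n}⟩^Θ ∏ (2 d_j + 1)!!`, determined by the initial value
`B(0) = 1/8` and the recursion (equivalent to the Virasoro constraints)
`B(d, 𝐝) = ∑ᵢ (2 dᵢ + 1) B(d₁, …, dᵢ + d, …, dₙ)
  + (1/2) ∑_{a + b = d - 1} (B(a, b, 𝐝) + ∑_{I ⊔ J = {1, …, n}} B(a, 𝐝_I) B(b, 𝐝_J))`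
for all other arguments. The value at the empty list is a dummy, used nowhere. -/
def B : List ℕ → ℚ
  | [] => 0
  | d :: l =>
    if d = 0 ∧ l = [] then 1 / 8
    else
      ∑ i : Fin l.length, (2 * (l.get i : ℚ) + 1) * B (l.set i (l.get i + d))
      + 1 / 2 * ∑ a : Fin d,
          (B (a :: (d - 1 - a) :: l)
            + ∑ I : Finset (Fin l.length),
                B (a :: restrict l I) * B ((d - 1 - a) :: restrict l Iᶜ))
termination_by l => X l
decreasing_by
  · rw [X_set, X_cons]; omega
  · simp only [X_cons]; omega
  · have := X_restrict_le l I
    simp only [X_cons]; omega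
  · have := X_restrict_le l Iᶜ
    simp only [X_cons]; omega

/-- The Brézin–Gross–Witten number `⟨τ_{d_1} ⋯ τ_{d_n}⟩^Θ_{g(𝐝)}`. -/
def bgw (l : List ℕ) : ℚ := B l / ((l.map fun d => (2 * d + 1)‼).prod : ℕ)

/-- The normalized BGW number `C(𝐝)`. -/
def C (l : List ℕ) : ℚ :=
  2 ^ (2 * genus l - 1) * ((l.map fun d => (2 * d + 1)‼).prod : ℕ) / ((X l - 1)! : ℕ) * bgw l

/-- `γ(X) = Γ(X/2 + 1)² / (π Γ((X+1)/2) Γ((X+3)/2))`. -/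
noncomputable def gam (x : ℝ) : ℝ :=
  Real.Gamma (x / 2 + 1) ^ 2 / (Real.pi * Real.Gamma ((x + 1) / 2) * Real.Gamma ((x + 3) / 2))

/-- The renormalized BGW number `Ĉ(𝐝) = C(𝐝) / γ(X(𝐝))`. -/
noncomputable def Chat (l : List ℕ) : ℝ := (C l : ℝ) / gam (X l)

/-- The multiplicity `p_r(𝐝)`, for `r = 1, 2, …`. -/
def mult (l : List ℕ) (r : ℕ+) : ℚ := (l.count (r : ℕ) : ℚ)

end BGW

/-! Functions on lists play the role of generating series in times t_0, t_1, …: prepending `d` is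
∂/∂t_d, the shuffle product is multiplication, and `Nop d` is the derivation ∑ (2a+1) t_a ∂_{a+d}.
In this language the quadratic recursion for `B` becomes a linear one (Virasoro constraints) for `Z
= exp B` (`Z_cons`). The commutators of these constraints make `Z` symmetric (`sym_Z`).

The asymptotics is first found formally. Let Φ_k(x) = 1/((x-1)⋯(x-k)), and write a series ∑ g_k
Φ_k(x) as ∑ g_k w^k. Shifting the times of `Z` by -2(2w)^(2a+1)/(2a+1) and summing over sublists of
insertions, each with weight 4^|𝐝| w^X(𝐝), gives a power series `amp l`. The shifted Virasoro
constraints become a recursion for `amp` (`amp_cons`). Under the dictionary w ↔ 1/(x-1), 1 + w² d/dw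
↔ re-expansion from x-1 to x, it is the recursion satisfied by the normalized numbers Z(l, m) with x
= X(l, m) (`nZ_cons`). Hence `amp l` is the expansion of π times these numbers as m → ∞
(`invFactExp_nZ`), once this is known for empty `l`. There the one-point numbers are γ(2m+1) exactly
(`Z_singleton_rec`, `nZ_nil`), and the expansion of πγ is identified because γ obeys a two-step
recursion whose formal counterpart is the three-term recurrence `shiftZ_nil_rec`.

Passing back to `B` means multiplying by `Z⁻¹`, so πC expands as the sum over sublists I of `conn I`
(`invFactExp_C`). The empty sublist gives πγ itself. For nonempty I the weight contributes w^X(I),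
and the remaining factor has constant term (Z · Z⁻¹)(I) = 0, so `conn I` is divisible by w^(X(I)+1)
(`X_pow_dvd_conn`). After conversion to powers of 1/X and division by πγ, the coefficient of X^(-k)
for k ≥ 1 is a sum of a fixed symmetric function over sublists with X(I) ≤ k-1. Counting sublists by
multiplicities turns it into a combination of products of binomials in the p_b, of weighted degree
at most k-1 (`exists_polynomial_subsum`). -/

namespace BGW

/-! ### The shuffle algebra of functions on lists -/

section Shuffle

variable {K : Type*} [CommRing K]

/-- The left derivative `f ↦ f(d, ·)`. -/
def der {M : Type*} (d : ℕ) (f : List ℕ → M) : List ℕ → M := fun l => f (d :: l)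

/-- The right derivative `f ↦ f(·, m)`. -/
def rder {M : Type*} (m : ℕ) (f : List ℕ → M) : List ℕ → M := fun l => f (l ++ [m])

/-- Values of the shuffle product. -/
def shufAux : List ℕ → (List ℕ → K) → (List ℕ → K) → K
  | [], f, g => f [] * g []
  | d :: l, f, g => shufAux l (der d f) g + shufAux l f (der d g)

/-- The shuffle product `(f * g)(𝐝) = ∑_{I ⊔ J} f(𝐝_I) g(𝐝_J)`. -/
def shuf (f g : List ℕ → K) : List ℕ → K := fun l => shufAux l f g

/-- The unit of the shuffle product. -/
def unit : List ℕ → K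
  | [] => 1
  | _ :: _ => 0

@[simp] theorem shuf_nil (f g : List ℕ → K) : shuf f g [] = f [] * g [] := rfl

theorem shuf_cons (f g : List ℕ → K) (d : ℕ) (l : List ℕ) :
    shuf f g (d :: l) = shuf (der d f) g l + shuf f (der d g) l := rfl

theorem der_shuf (f g : List ℕ → K) (d : ℕ) :
    der d (shuf f g) = shuf (der d f) g + shuf f (der d g) := rfl

theorem der_add (f g : List ℕ → K) (d : ℕ) : der d (f + g) = der d f + der d g := rfl

theorem der_smul (c : K) (f : List ℕ → K) (d : ℕ) : der d (c • f) = c • der d f := rfl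

theorem der_unit (d : ℕ) : der d (unit : List ℕ → K) = 0 := rfl

theorem ext_der {M : Type*} {f g : List ℕ → M} (h0 : f [] = g [])
    (h : ∀ d, der d f = der d g) : f = g := by
  funext l
  cases l with
  | nil => exact h0
  | cons d l => exact congrFun (h d) l

theorem shuf_add (f g h : List ℕ → K) : shuf f (g + h) = shuf f g + shuf f h := by
  funext l
  induction l generalizing f g h with
  | nil => simp [mul_add]
  | cons d l ih =>
    simp only [shuf_cons, Pi.add_apply, der_add, ih]
    ring

theorem shuf_comm (f g : List ℕ → K) : shuf f g = shuf g f := by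
  funext l
  induction l generalizing f g with
  | nil => simp [mul_comm]
  | cons d l ih => rw [shuf_cons, shuf_cons, ih, ih f, add_comm]

theorem add_shuf (f g h : List ℕ → K) : shuf (f + g) h = shuf f h + shuf g h := by
  rw [shuf_comm, shuf_add, shuf_comm h, shuf_comm h]

theorem shuf_smul (c : K) (f g : List ℕ → K) : shuf f (c • g) = c • shuf f g := by
  funext l
  induction l generalizing f g with
  | nil => simp; ring
  | cons d l ih =>
    simp only [shuf_cons, Pi.smul_apply, der_smul, ih, smul_add]

theorem smul_shuf (c : K) (f g : List ℕ → K) : shuf (c • f) g = c • shuf f g := by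
  rw [shuf_comm, shuf_smul, shuf_comm]

theorem shuf_assoc (f g h : List ℕ → K) : shuf (shuf f g) h = shuf f (shuf g h) := by
  funext l
  induction l generalizing f g h with
  | nil => simp [mul_assoc]
  | cons d l ih =>
    simp only [shuf_cons, der_shuf, add_shuf, shuf_add, Pi.add_apply, ih]
    ring

theorem shuf_zero (f : List ℕ → K) : shuf f 0 = 0 := by
  have := shuf_smul (0 : K) f 0
  simpa using this

theorem zero_shuf (f : List ℕ → K) : shuf 0 f = 0 := by
  rw [shuf_comm, shuf_zero]

theorem shuf_unit (f : List ℕ → K) : shuf f unit = f := by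
  funext l
  induction l generalizing f with
  | nil => simp [unit]
  | cons d l ih => rw [shuf_cons, der_unit, shuf_zero, ih]; simp [der]

theorem unit_shuf (f : List ℕ → K) : shuf unit f = f := by
  rw [shuf_comm, shuf_unit]

theorem shuf_sum {ι : Type*} (s : Finset ι) (f : List ℕ → K) (g : ι → List ℕ → K) :
    shuf f (∑ i ∈ s, g i) = ∑ i ∈ s, shuf f (g i) := by
  classical
  induction s using Finset.induction_on with
  | empty => simp [shuf_zero]
  | insert a s ha ih => rw [Finset.sum_insert ha, Finset.sum_insert ha, shuf_add, ih]

theorem shuf_neg (f g : List ℕ → K) : shuf f (-g) = -shuf f g := by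
  have := shuf_smul (-1 : K) f g
  simpa using this

theorem shuf_sub (f g h : List ℕ → K) : shuf f (g - h) = shuf f g - shuf f h := by
  rw [sub_eq_add_neg, shuf_add, shuf_neg, sub_eq_add_neg]

theorem shuf_congr_right {n : ℕ} {f g g' : List ℕ → K}
    (h : ∀ l : List ℕ, l.length ≤ n → g l = g' l) {l : List ℕ} (hl : l.length ≤ n) :
    shuf f g l = shuf f g' l := by
  induction l generalizing f g g' n with
  | nil => simp [h [] (by simp)]
  | cons d l ih =>
    rw [List.length_cons] at hl
    rw [shuf_cons, shuf_cons, ih (n := n) h (by omega),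
      ih (n := n - 1) (g := der d g) (g' := der d g')
        (fun l' hl' => h (d :: l') (by rw [List.length_cons]; omega)) (by omega)]

theorem shuf_of_vanish_left {f g : List ℕ → K} (hg : g [] = 1) {l : List ℕ}
    (h : ∀ l' : List ℕ, l'.length < l.length → f l' = 0) : shuf f g l = f l := by
  induction l generalizing f with
  | nil => simp [hg]
  | cons d l ih =>
    rw [shuf_cons, ih (f := der d f) fun l' hl' => h (d :: l') (by simpa using hl')]
    have : shuf f (der d g) l = 0 := by
      rw [shuf_comm, shuf_congr_right (n := l.length) (g' := 0) _ le_rfl, shuf_zero]; rfl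
      intro l' hl'
      exact h l' (by rw [List.length_cons]; omega)
    rw [this, add_zero]; rfl

theorem rder_shuf (f g : List ℕ → K) (m : ℕ) :
    rder m (shuf f g) = shuf (rder m f) g + shuf f (rder m g) := by
  funext l
  induction l generalizing f g with
  | nil => simp [rder, shuf_cons, der]
  | cons d l ih =>
    have h1 : shuf (der d f) g (l ++ [m]) = _ := ih (der d f) g
    have h2 : shuf f (der d g) (l ++ [m]) = _ := ih f (der d g)
    have e1 : rder m (der d f) = der d (rder m f) := rfl
    have e2 : rder m (der d g) = der d (rder m g) := rfl
    rw [e1] at h1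
    rw [e2] at h2
    simp only [rder, List.cons_append, shuf_cons, Pi.add_apply] at h1 h2 ⊢
    rw [h1, h2]
    ring

/-! ### Exponentials -/

/-- `expAux f l h` is the value of `h * exp f` at `l`. -/
def expAux (f : List ℕ → K) : List ℕ → (List ℕ → K) → K
  | [], h => h []
  | d :: l, h => expAux f l (der d h + shuf h (der d f))

/-- The exponential of `f` for the shuffle product (the value `f []` is ignored). -/
def expo (f : List ℕ → K) : List ℕ → K := fun l => expAux f l unit

@[simp] theorem expo_nil (f : List ℕ → K) : expo f [] = 1 := rfl

/-- The recursion in `expAux` is ∂(h exp f) = (∂h + h ∂f) exp f. The rule ∂ exp f = ∂f · exp f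
needed in the step is itself the case h = ∂f of the claim on shorter lists, hence the strong
induction on length with `h` free. -/
theorem expAux_eq_shuf (f : List ℕ → K) (l : List ℕ) :
    ∀ h, expAux f l h = shuf h (expo f) l := by
  induction hn : l.length using Nat.strong_induction_on generalizing l with
  | _ n IH =>
    intro h
    cases l with
    | nil => simp [expAux]
    | cons d l =>
      rw [expAux, IH l.length (by rw [← hn]; simp) l rfl, shuf_cons, add_shuf, Pi.add_apply,
        shuf_assoc]
      congr 1
      refine shuf_congr_right (n := l.length) (fun l' hl' => ?_) le_rfl
      rw [← IH l'.length (by rw [← hn, List.length_cons]; omega) l' rfl]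
      simp only [der, expo]
      rw [expAux, unit_shuf, der_unit, zero_add]

theorem der_expo (f : List ℕ → K) (d : ℕ) : der d (expo f) = shuf (der d f) (expo f) := by
  funext l
  rw [← expAux_eq_shuf]
  simp only [der, expo]
  rw [expAux, unit_shuf, der_unit, zero_add]

/-- Uniqueness for the linear system `∂_e u = ∂_e f * u + r_e`. -/
theorem linear_system_unique {f u u' : List ℕ → K} {r : ℕ → List ℕ → K} (h0 : u [] = u' [])
    (hu : ∀ e, der e u = shuf (der e f) u + r e)
    (hu' : ∀ e, der e u' = shuf (der e f) u' + r e) : u = u' := by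
  funext l
  induction hn : l.length using Nat.strong_induction_on generalizing l with
  | _ n IH =>
    cases l with
    | nil => exact h0
    | cons e l =>
      have h1 := congrFun (hu e) l
      have h2 := congrFun (hu' e) l
      simp only [der, Pi.add_apply] at h1 h2
      rw [h1, h2]
      congr 1
      refine shuf_congr_right (n := l.length) (fun l' hl' => ?_) le_rfl
      exact IH l'.length (by rw [← hn, List.length_cons]; omega) l' rfl

theorem expo_shuf_expo_neg (f : List ℕ → K) : shuf (expo f) (expo (-f)) = unit := by
  refine ext_der (by simp [unit]) fun d => ?_
  have : der d (-f) = -der d f := rfl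
  rw [der_shuf, der_expo, der_expo, this, der_unit, ← shuf_assoc (expo f), shuf_neg,
    shuf_comm (expo f)]
  have h2 : shuf (-shuf (der d f) (expo f)) (expo (-f))
      = -shuf (shuf (der d f) (expo f)) (expo (-f)) := by
    rw [shuf_comm, shuf_neg, shuf_comm]
  rw [h2, add_neg_cancel]

/-- No symmetry of `f` is needed: appending at the end commutes with prepending, so both sides solve
the same linear system in the left derivatives. -/
theorem rder_expo (f : List ℕ → K) (m : ℕ) : rder m (expo f) = shuf (rder m f) (expo f) := by
  refine linear_system_unique (f := f) (r := fun e => shuf (rder m (der e f)) (expo f)) ?_ ?_ ?_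
  · have := congrFun (der_expo f m) []
    simpa [der, rder] using this
  · intro e
    have : der e (rder m (expo f)) = rder m (der e (expo f)) := rfl
    rw [this, der_expo, rder_shuf, add_comm]
  · intro e
    have : der e (rder m f) = rder m (der e f) := rfl
    rw [der_shuf, der_expo, this, ← shuf_assoc, ← shuf_assoc, shuf_comm (rder m f), add_comm]

/-! ### The raising operators -/

/-- `(N_d f)(𝐝) = ∑ᵢ (2 dᵢ + 1) f(d₁, …, dᵢ + d, …, dₙ)`. -/
def raise {M : Type*} [AddCommMonoid M] (d : ℕ) : List ℕ → (List ℕ → M) → M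
  | [], _ => 0
  | e :: l, f => (2 * e + 1) • f ((e + d) :: l) + raise d l (der e f)

/-- The operator `N_d`. -/
def Nop {M : Type*} [AddCommMonoid M] (d : ℕ) (f : List ℕ → M) : List ℕ → M :=
  fun l => raise d l f

section Nop

variable {M : Type*} [AddCommMonoid M]

@[simp] theorem Nop_nil (d : ℕ) (f : List ℕ → M) : Nop d f [] = 0 := rfl

theorem Nop_cons (d : ℕ) (f : List ℕ → M) (e : ℕ) (l : List ℕ) :
    Nop d f (e :: l) = (2 * e + 1) • f ((e + d) :: l) + Nop d (der e f) l := rfl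

theorem der_Nop (d e : ℕ) (f : List ℕ → M) :
    der e (Nop d f) = (2 * e + 1) • der (e + d) f + Nop d (der e f) := rfl

theorem Nop_add (d : ℕ) (f g : List ℕ → M) : Nop d (f + g) = Nop d f + Nop d g := by
  funext l
  induction l generalizing f g with
  | nil => simp
  | cons e l ih =>
    have : der e (f + g) = der e f + der e g := rfl
    simp only [Nop_cons, Pi.add_apply, this, ih, smul_add]
    abel

theorem Nop_map {M' : Type*} [AddCommMonoid M'] (F : M →+ M') (d : ℕ) (f : List ℕ → M)
    (l : List ℕ) : Nop d (fun l => F (f l)) l = F (Nop d f l) := by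
  induction l generalizing f with
  | nil => simp
  | cons e l ih =>
    have := ih (der e f)
    simp only [Nop_cons, map_add, map_nsmul, ← this]
    rfl

theorem Nop_zero (d : ℕ) : Nop d (0 : List ℕ → M) = 0 := by
  funext l
  exact Nop_map (0 : M →+ M) d 0 l

theorem Nop_sum {ι : Type*} (s : Finset ι) (d : ℕ) (f : ι → List ℕ → M) :
    Nop d (∑ i ∈ s, f i) = ∑ i ∈ s, Nop d (f i) := by
  classical
  induction s using Finset.induction_on with
  | empty => simp [Nop_zero]
  | insert a s ha ih => rw [Finset.sum_insert ha, Finset.sum_insert ha, Nop_add, ih]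

theorem Nop_congr {d : ℕ} {f g : List ℕ → M} {l : List ℕ}
    (h : ∀ l', X l' = X l + 2 * d → l'.length = l.length → f l' = g l') :
    Nop d f l = Nop d g l := by
  induction l generalizing f g with
  | nil => rfl
  | cons e l ih =>
    rw [Nop_cons, Nop_cons, h _ (by simp only [X_cons]; ring) (by simp)]
    congr 1
    refine ih fun l' hl' hlen => h (e :: l') ?_ (by simp [hlen])
    simp only [X_cons, hl']; ring

theorem Nop_append_singleton (d : ℕ) (f : List ℕ → M) (l : List ℕ) (m : ℕ) :
    Nop d f (l ++ [m]) = Nop d (rder m f) l + (2 * m + 1) • rder (m + d) f l := by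
  induction l generalizing f with
  | nil => simp [Nop_cons, rder]
  | cons e l ih =>
    rw [List.cons_append, Nop_cons, Nop_cons, ih]
    simp only [rder, der, List.cons_append, add_assoc]
    rfl

theorem Nop_eq_sum (d : ℕ) (f : List ℕ → K) (l : List ℕ) :
    Nop d f l = ∑ i : Fin l.length, (2 * (l.get i : K) + 1) * f (l.set i (l.get i + d)) := by
  induction l generalizing f with
  | nil => simp
  | cons e l ih =>
    rw [Nop_cons, ih]
    simp only [List.length_cons, Fin.sum_univ_succ]
    simp [der, nsmul_eq_mul]

end Nop

theorem Nop_smul (c : K) (d : ℕ) (f : List ℕ → K) : Nop d (c • f) = c • Nop d f := by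
  funext l
  exact Nop_map (AddMonoidHom.mulLeft c) d f l

theorem Nop_shuf (d : ℕ) (f g : List ℕ → K) :
    Nop d (shuf f g) = shuf (Nop d f) g + shuf f (Nop d g) := by
  funext l
  induction l generalizing f g with
  | nil => simp
  | cons e l ih =>
    have h1 := ih (der e f) g
    have h2 := ih f (der e g)
    have e1 : (2 * e + 1) • der (e + d) f = ((2 * e + 1 : ℕ) : K) • der (e + d) f := by
      rw [Nat.cast_smul_eq_nsmul]
    have e2 : (2 * e + 1) • der (e + d) g = ((2 * e + 1 : ℕ) : K) • der (e + d) g := by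
      rw [Nat.cast_smul_eq_nsmul]
    rw [Nop_cons, der_shuf, Nop_add, Pi.add_apply, h1, h2]
    simp only [Pi.add_apply, shuf_cons, der_Nop, e1, e2]
    simp only [add_shuf, shuf_add, smul_shuf, shuf_smul, Pi.add_apply, Pi.smul_apply,
      nsmul_eq_mul, smul_eq_mul]
    ring

theorem Nop_expo (d : ℕ) (f : List ℕ → K) : Nop d (expo f) = shuf (Nop d f) (expo f) := by
  refine linear_system_unique (f := f)
    (r := fun e => shuf ((2 * e + 1) • der (e + d) f + Nop d (der e f)) (expo f)) ?_ ?_ ?_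
  · simp
  · intro e
    rw [der_Nop, der_expo, der_expo, Nop_shuf, add_shuf]
    have e1 : (2 * e + 1) • der (e + d) f = ((2 * e + 1 : ℕ) : K) • der (e + d) f := by
      rw [Nat.cast_smul_eq_nsmul]
    rw [e1, smul_shuf, Nat.cast_smul_eq_nsmul]
    abel
  · intro e
    rw [der_shuf, der_expo, der_Nop, ← shuf_assoc, ← shuf_assoc, shuf_comm (Nop d f), add_comm]

/-- `[N_d, N_e] = 2 (d - e) N_{d+e}`. -/
theorem Nop_comm (d e : ℕ) (f : List ℕ → K) (l : List ℕ) :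
    Nop d (Nop e f) l - Nop e (Nop d f) l = 2 * ((d : K) - e) * Nop (d + e) f l := by
  induction l generalizing f with
  | nil => simp
  | cons a l ih =>
    have h := ih (der a f)
    have hsm : ∀ (n : ℕ) (c : ℕ) (g : List ℕ → K), Nop n (c • g) = c • Nop n g := by
      intro n c g
      rw [← Nat.cast_smul_eq_nsmul K c g, Nop_smul, Nat.cast_smul_eq_nsmul]
    simp only [Nop_cons, der_Nop, Nop_add, Pi.add_apply, hsm, Pi.smul_apply]
    have e1 : a + d + e = a + (d + e) := by ring
    have e2 : a + e + d = a + (d + e) := by ring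
    simp only [e1, e2, nsmul_eq_mul] at h ⊢
    push_cast at h ⊢
    linear_combination h

/-! ### Symmetric functions -/

/-- Invariance under permutations of the arguments. -/
def Sym {M : Type*} (f : List ℕ → M) : Prop := ∀ l l' : List ℕ, l.Perm l' → f l = f l'

theorem Sym.der {M : Type*} {f : List ℕ → M} (h : Sym f) (d : ℕ) : Sym (der d f) :=
  fun _ _ hp => h _ _ (hp.cons d)

theorem Sym.der_comm {M : Type*} {f : List ℕ → M} (h : Sym f) (d e : ℕ) :
    BGW.der d (BGW.der e f) = BGW.der e (BGW.der d f) := by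
  funext l
  exact h _ _ (List.Perm.swap d e l)

theorem Sym.shuf {f g : List ℕ → K} (hf : Sym f) (hg : Sym g) : Sym (shuf f g) := by
  intro l l' hp
  induction hp generalizing f g with
  | nil => rfl
  | cons d _ ih => rw [shuf_cons, shuf_cons, ih (hf.der d) hg, ih hf (hg.der d)]
  | swap d e l =>
    simp only [shuf_cons]
    rw [hf.der_comm d e, hg.der_comm d e]
    ring
  | trans _ _ ih1 ih2 => rw [ih1 hf hg, ih2 hf hg]

theorem Sym.Nop {M : Type*} [AddCommMonoid M] {f : List ℕ → M} (hf : Sym f) (d : ℕ) :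
    Sym (Nop d f) := by
  intro l l' hp
  induction hp generalizing f with
  | nil => rfl
  | @cons e l l' h ih =>
    rw [Nop_cons, Nop_cons, ih (hf.der e), hf _ _ (h.cons (e + d))]
  | swap a b l =>
    simp only [Nop_cons]
    rw [hf.der_comm a b]
    simp only [BGW.der]
    rw [hf _ _ (List.Perm.swap a (b + d) l), hf _ _ (List.Perm.swap (a + d) b l)]
    abel
  | trans _ _ ih1 ih2 => rw [ih1 hf, ih2 hf]

theorem sym_unit : Sym (unit : List ℕ → K) := by
  intro l l' hp
  cases l with
  | nil => rw [List.nil_perm.mp hp]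
  | cons d l =>
    cases l' with
    | nil => exact absurd hp (by simp)
    | cons d' l' => rfl

/-- A factor of a symmetric function by a normalized symmetric function is symmetric. -/
theorem Sym.of_shuf {f g : List ℕ → K} (hg : Sym g) (hg1 : g [] = 1)
    (h : Sym (BGW.shuf f g)) : Sym f := by
  intro l l' hp
  induction hn : l.length using Nat.strong_induction_on generalizing l l' with
  | _ n IH =>
    classical
    set f' : List ℕ → K := fun l => if l.length < n then f l else 0 with hf'
    have hs : Sym f' := by
      intro a b hab
      simp only [hf']
      rw [hab.length_eq]
      split_ifs with hb
      · exact IH a.length (by rw [hab.length_eq]; exact hb) a b hab rfl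
      · rfl
    -- `f - f'` vanishes below length `n` and `g [] = 1`, so shuffling it with `g` does nothing at
    -- length `n`. This expresses `f` there through two symmetric functions.
    have key : ∀ a : List ℕ, a.length = n → f a = BGW.shuf f g a - BGW.shuf f' g a := by
      intro a ha
      have h1 : BGW.shuf (f - f') g a = (f - f') a := by
        refine shuf_of_vanish_left hg1 fun a' ha' => ?_
        simp only [Pi.sub_apply, hf']
        rw [if_pos (by omega), sub_self]
      have h2 : (f - f') a = f a := by
        simp only [Pi.sub_apply, hf']
        rw [if_neg (by omega), sub_zero]
      rw [← h2, ← h1, shuf_comm, shuf_sub, Pi.sub_apply, shuf_comm g, shuf_comm g]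
    rw [key l hn, key l' (by rw [← hp.length_eq, hn]), h _ _ hp, (hs.shuf hg) _ _ hp]

end Shuffle

end BGW

namespace BGW

/-! ### The recursion in terms of the shuffle product -/

theorem restrict_cons (a : ℕ) (l : List ℕ) (I : Finset (Fin (l.length + 1)))
    (J : Finset (Fin l.length)) (h : ∀ i, i.succ ∈ I ↔ i ∈ J) :
    restrict (a :: l) I = if 0 ∈ I then a :: restrict l J else restrict l J := by
  have key : List.filter (fun x => decide (x ∈ I)) (List.map Fin.succ (List.finRange l.length))
      = List.map Fin.succ (List.filter (fun x => decide (x ∈ J)) (List.finRange l.length)) := by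
    rw [List.filter_map]
    congr 1
    refine List.filter_congr fun x _ => ?_
    simp [h x]
  unfold restrict
  simp only [List.length_cons, List.finRange_succ, List.filter_cons]
  rw [key]
  split_ifs with h0 h1 h1
  · simp [Function.comp_def]
  · simp at h0; exact absurd h0 h1
  · simp at h0; exact absurd h1 h0
  · simp [Function.comp_def]

theorem sum_finset_fin_succ {M : Type*} [AddCommMonoid M] (n : ℕ)
    (h : Finset (Fin (n + 1)) → M) :
    ∑ I, h I = ∑ J : Finset (Fin n), h (insert 0 (J.map (Fin.succEmb n)))
      + ∑ J : Finset (Fin n), h (J.map (Fin.succEmb n)) := by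
  classical
  rw [← Finset.sum_filter_add_sum_filter_not Finset.univ (fun I : Finset (Fin (n + 1)) => 0 ∈ I)]
  congr 1
  · refine Finset.sum_nbij' (fun I => Finset.univ.filter fun i : Fin n => i.succ ∈ I)
      (fun J => insert 0 (J.map (Fin.succEmb n))) ?_ ?_ ?_ ?_ ?_
    · simp
    · simp
    · intro I hI
      ext i
      refine Fin.cases ?_ (fun j => ?_) i
      · simpa using hI
      · simp
    · intro J _
      ext i
      simp
    · intro I hI
      congr 1
      ext i
      refine Fin.cases ?_ (fun j => ?_) i
      · simpa using hI
      · simp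
  · refine Finset.sum_nbij' (fun I => Finset.univ.filter fun i : Fin n => i.succ ∈ I)
      (fun J => J.map (Fin.succEmb n)) ?_ ?_ ?_ ?_ ?_
    · simp
    · simp
    · intro I hI
      ext i
      refine Fin.cases ?_ (fun j => ?_) i
      · simpa using hI
      · simp
    · intro J _
      ext i
      simp
    · intro I hI
      congr 1
      ext i
      refine Fin.cases ?_ (fun j => ?_) i
      · simpa using hI
      · simp

theorem sum_restrict_mul {K : Type*} [CommRing K] (f g : List ℕ → K) (l : List ℕ) :
    ∑ I : Finset (Fin l.length), f (restrict l I) * g (restrict l Iᶜ) = shuf f g l := by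
  induction l generalizing f g with
  | nil =>
    refine (Fintype.sum_eq_single (∅ : Finset (Fin 0))
      (fun x hx => absurd (Subsingleton.elim x _) hx)).trans ?_
    rfl
  | cons a l ih =>
    rw [shuf_cons, ← ih, ← ih]
    refine (sum_finset_fin_succ l.length _).trans ?_
    congr 1
    · refine Finset.sum_congr rfl fun J _ => ?_
      rw [restrict_cons a l _ J (by simp), restrict_cons a l _ Jᶜ (by simp)]
      simp [der]
    · refine Finset.sum_congr rfl fun J _ => ?_
      rw [restrict_cons a l _ J (by simp), restrict_cons a l _ Jᶜ (by simp)]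
      simp [der]

/-- `½ ∑_{a + b = d - 1} f(a, b, ·)`, without the factor `½`. -/
def pairSum {M : Type*} [AddCommMonoid M] (d : ℕ) (f : List ℕ → M) : List ℕ → M :=
  fun l => ∑ a ∈ Finset.range d, f (a :: (d - 1 - a) :: l)

/-- The initial value 1/8 becomes an inhomogeneous term: at `d = 0`, `l = []` everything else on the
right vanishes. -/
theorem B_cons (d : ℕ) (l : List ℕ) :
    B (d :: l) = Nop d B l + 1 / 2 * (pairSum d B l
      + ∑ a ∈ Finset.range d, shuf (der a B) (der (d - 1 - a) B) l)
      + (if d = 0 then 1 / 8 else 0) * unit l := by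
  rw [B]
  split_ifs with h h' h'
  · obtain ⟨rfl, rfl⟩ := h
    simp [pairSum, unit]
  · exact absurd h.1 h'
  · subst h'
    cases l with
    | nil => simp at h
    | cons a l =>
      simp only [Nop_eq_sum, pairSum, unit]
      simp
  · rw [Nop_eq_sum, pairSum, Finset.sum_range, Finset.sum_range, ← Finset.sum_add_distrib]
    simp only [zero_mul, add_zero]
    congr 2
    refine Finset.sum_congr rfl fun a _ => ?_
    rw [← sum_restrict_mul]
    rfl

/-- The disconnected numbers: the exponential of `B`. -/
def Z : List ℕ → ℚ := expo B

/-- The inverse of `Z` for the shuffle product. -/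
def Zinv : List ℕ → ℚ := expo (-B)

@[simp] theorem Z_nil : Z [] = 1 := rfl

/-- Exponentiation linearizes the recursion: ∂_a∂_b B + ∂_a B · ∂_b B is ∂_a∂_b Z divided by Z, and
`Nop d` is a derivation. -/
theorem Z_cons (d : ℕ) (l : List ℕ) :
    Z (d :: l) = Nop d Z l + 1 / 2 * pairSum d Z l + (if d = 0 then 1 / 8 else 0) * Z l := by
  have hB : der d B = Nop d B + (1 / 2 : ℚ) • (∑ a ∈ Finset.range d, (der (d - 1 - a) (der a B)
      + shuf (der a B) (der (d - 1 - a) B))) + (if d = 0 then (1 / 8 : ℚ) else 0) • unit := by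
    funext l
    refine (B_cons d l).trans ?_
    simp only [Pi.add_apply, Pi.smul_apply, smul_eq_mul, Finset.sum_apply,
      Finset.sum_add_distrib]
    rfl
  have hZ : ∀ a b, der b (der a Z) = shuf (der b (der a B) + shuf (der a B) (der b B)) Z := by
    intro a b
    rw [Z, der_expo, der_shuf, der_expo, add_shuf, shuf_assoc]
  have h1 := congrFun (der_expo B d) l
  change Z (d :: l) = shuf (der d B) Z l at h1
  rw [h1, hB, add_shuf, add_shuf, smul_shuf, smul_shuf, unit_shuf, shuf_comm _ Z, shuf_comm _ Z,
    shuf_sum, shuf_comm Z]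
  have h2 : shuf (Nop d B) Z = Nop d Z := (Nop_expo d B).symm
  rw [h2]
  simp only [Pi.add_apply, Pi.smul_apply, smul_eq_mul, Finset.sum_apply]
  congr 3
  refine Finset.sum_congr rfl fun a _ => ?_
  rw [shuf_comm, ← hZ]
  rfl

/-- The connected numbers are recovered as a logarithmic derivative in the last argument, the one
that tends to infinity. -/
theorem rder_B (m : ℕ) : rder m B = shuf (rder m Z) Zinv := by
  rw [Z, rder_expo, shuf_assoc, Zinv, expo_shuf_expo_neg, shuf_unit]

/-! ### Symmetry of the disconnected numbers -/

/-- The combinatorial identity behind the commutation of two Virasoro operators. -/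
theorem sum_reflect_identity (h : ℕ → ℕ → ℚ) (d e : ℕ)
    (hs : ∀ a b, a + b + 1 = d + e → h a b = h b a) :
    ((e : ℚ) - d) * ∑ c ∈ Finset.range (d + e), h c (d + e - 1 - c)
      + ∑ a ∈ Finset.range d, (2 * (a : ℚ) + 1) * h (a + e) (d - 1 - a)
      - ∑ a ∈ Finset.range e, (2 * (a : ℚ) + 1) * h (a + d) (e - 1 - a) = 0 := by
  set H : ℕ → ℚ := fun c => h c (d + e - 1 - c) with hH
  -- The weight is odd and `H` is even under c ↦ d+e-1-c.
  have hr : ∑ c ∈ Finset.range (d + e), (2 * (c : ℚ) - (d + e - 1)) * H c = 0 := by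
    have := Finset.sum_range_reflect (fun c : ℕ => (2 * (c : ℚ) - (d + e - 1)) * H c) (d + e)
    have h2 : ∑ c ∈ Finset.range (d + e),
        (2 * ((d + e - 1 - c : ℕ) : ℚ) - (d + e - 1)) * H (d + e - 1 - c)
        = -∑ c ∈ Finset.range (d + e), (2 * (c : ℚ) - (d + e - 1)) * H c := by
      rw [← Finset.sum_neg_distrib]
      refine Finset.sum_congr rfl fun c hc => ?_
      rw [Finset.mem_range] at hc
      have e1 : ((d + e - 1 - c : ℕ) : ℚ) = d + e - 1 - c := by
        rw [Nat.cast_sub (by omega), Nat.cast_sub (by omega)]; push_cast; ring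
      have e2 : H (d + e - 1 - c) = H c := by
        simp only [hH]
        rw [hs _ _ (by omega), show d + e - 1 - (d + e - 1 - c) = c by omega]
      rw [e1, e2]; ring
    linarith
  have s1 : ∑ a ∈ Finset.range d, (2 * (a : ℚ) + 1) * h (a + e) (d - 1 - a)
      = ∑ a ∈ Finset.range d, (2 * ((e + a : ℕ) : ℚ) - 2 * e + 1) * H (e + a) := by
    refine Finset.sum_congr rfl fun a ha => ?_
    rw [Finset.mem_range] at ha
    simp only [hH]
    rw [show d + e - 1 - (e + a) = d - 1 - a by omega, add_comm a e]
    push_cast; ring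
  have s2 : ∑ a ∈ Finset.range e, (2 * (a : ℚ) + 1) * h (a + d) (e - 1 - a)
      = -∑ c ∈ Finset.range e, (2 * (c : ℚ) - 2 * e + 1) * H c := by
    rw [← Finset.sum_range_reflect, ← Finset.sum_neg_distrib]
    refine Finset.sum_congr rfl fun c hc => ?_
    rw [Finset.mem_range] at hc
    simp only [hH]
    rw [hs _ _ (by omega), show e - 1 - c + d = d + e - 1 - c by omega,
      show e - 1 - (e - 1 - c) = c by omega, Nat.cast_sub (by omega), Nat.cast_sub (by omega)]
    push_cast; ring
  rw [s1, s2]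
  have h3 := Finset.sum_range_add (fun c : ℕ => (2 * (c : ℚ) - 2 * e + 1) * H c) e d
  rw [add_comm e d] at h3
  have h4 : ∑ c ∈ Finset.range (d + e), (2 * (c : ℚ) - 2 * e + 1) * H c
      = ∑ c ∈ Finset.range (d + e), (2 * (c : ℚ) - (d + e - 1)) * H c
        + ((d : ℚ) - e) * ∑ c ∈ Finset.range (d + e), H c := by
    rw [Finset.mul_sum, ← Finset.sum_add_distrib]
    refine Finset.sum_congr rfl fun c _ => ?_
    ring
  linear_combination -h3 + h4 + hr

theorem X_perm {l l' : List ℕ} (h : l.Perm l') : X l = X l' :=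
  (h.map _).sum_eq

/-- Two consecutive applications of the recursion, once the second argument may be moved to the
front of the shorter correlators. -/
theorem Z_cons_cons (d e : ℕ) (l : List ℕ)
    (hs : ∀ a ∈ Finset.range d, Z (a :: (d - 1 - a) :: e :: l) = Z (e :: a :: (d - 1 - a) :: l)) :
    Z (d :: e :: l) = (2 * (e : ℚ) + 1) * Z ((d + e) :: l) + Nop d (Nop e Z) l
      + 1 / 2 * Nop d (pairSum e Z) l + 1 / 2 * Nop e (pairSum d Z) l
      + (if e = 0 then 1 / 8 else 0) * (Nop d Z l + 1 / 2 * pairSum d Z l)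
      + (if d = 0 then 1 / 8 else 0) * (Nop e Z l + 1 / 2 * pairSum e Z l)
      + (if d = 0 then 1 / 8 else 0) * (if e = 0 then 1 / 8 else 0) * Z l
      + 1 / 2 * ∑ a ∈ Finset.range d, ((2 * (a : ℚ) + 1) * Z ((a + e) :: (d - 1 - a) :: l)
          + (2 * ((d - 1 - a : ℕ) : ℚ) + 1) * Z (a :: (d - 1 - a + e) :: l))
      + 1 / 4 * ∑ a ∈ Finset.range d, ∑ a' ∈ Finset.range e,
          Z (a' :: (e - 1 - a') :: a :: (d - 1 - a) :: l) := by
  have hde : der e Z = Nop e Z + (1 / 2 : ℚ) • pairSum e Z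
      + (if e = 0 then (1 / 8 : ℚ) else 0) • Z := by
    funext l
    exact Z_cons e l
  have h1 : Nop d (der e Z) l = Nop d (Nop e Z) l + 1 / 2 * Nop d (pairSum e Z) l
      + (if e = 0 then (1 / 8 : ℚ) else 0) * Nop d Z l := by
    rw [hde, Nop_add, Nop_add, Nop_smul, Nop_smul]; rfl
  have h2 : pairSum d Z (e :: l) = Nop e (pairSum d Z) l
      + (if e = 0 then 1 / 8 else 0) * pairSum d Z l
      + ∑ a ∈ Finset.range d, ((2 * (a : ℚ) + 1) * Z ((a + e) :: (d - 1 - a) :: l)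
          + (2 * ((d - 1 - a : ℕ) : ℚ) + 1) * Z (a :: (d - 1 - a + e) :: l))
      + 1 / 2 * ∑ a ∈ Finset.range d, ∑ a' ∈ Finset.range e,
          Z (a' :: (e - 1 - a') :: a :: (d - 1 - a) :: l) := by
    have h3 : pairSum d Z = ∑ a ∈ Finset.range d, der (d - 1 - a) (der a Z) := by
      funext l
      simp only [pairSum, Finset.sum_apply]
      rfl
    have h4 : Nop e (pairSum d Z) l
        = ∑ a ∈ Finset.range d, Nop e (der (d - 1 - a) (der a Z)) l := by
      rw [h3, Nop_sum, Finset.sum_apply]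
    rw [h4, pairSum, Finset.sum_congr rfl hs, pairSum, Finset.mul_sum, Finset.mul_sum,
      ← Finset.sum_add_distrib, ← Finset.sum_add_distrib,
      ← Finset.sum_add_distrib]
    refine Finset.sum_congr rfl fun a _ => ?_
    rw [Z_cons, Nop_cons, Nop_cons]
    simp only [der, pairSum, nsmul_eq_mul]
    push_cast
    ring
  rw [Z_cons, Nop_cons, h1, h2, Z_cons e l, nsmul_eq_mul, add_comm e d]
  push_cast
  ring

/-- Induction on `X`. For the exchange of the first two arguments the recursion is applied twice in
both orders. The difference consists of [N_d, N_e] = 2(d-e) N_{d+e}, of 2(e-d) Z(d+e, ·) and of sums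
of pairs; it cancels by one more use of the recursion and `sum_reflect_identity`. The constant terms
cancel because d = e when d+e = 0. -/
theorem sym_Z : Sym Z := by
  intro l l' hp
  induction hn : X l using Nat.strong_induction_on generalizing l l' with
  | _ n IH =>
    replace IH : ∀ {l l' : List ℕ}, l.Perm l' → X l < n → Z l = Z l' :=
      fun h hlt => IH _ hlt _ _ h rfl
    -- Cutting `Z` off at `X < n` produces a function that is symmetric on all lists, to which
    -- `Sym.Nop` applies.
    set Zt : List ℕ → ℚ := fun l => if X l < n then Z l else 0 with hZt
    have hs : Sym Zt := by
      intro a b hab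
      simp only [hZt]
      rw [X_perm hab]
      split_ifs with hb
      · exact IH hab (by rw [X_perm hab]; exact hb)
      · rfl
    have hZ : ∀ a, X a < n → Z a = Zt a := fun a ha => by simp only [hZt]; rw [if_pos ha]
    induction hp with
    | nil => rfl
    | @cons d a b hab _ =>
      rw [X_cons] at hn
      have hX := X_perm hab
      have e1 : Nop d Z a = Nop d Z b := by
        rw [Nop_congr (g := Zt) fun l' hl' _ => hZ l' (by omega), (hs.Nop d) a b hab,
          Nop_congr (f := Zt) (g := Z) fun l' hl' _ => (hZ l' (by omega)).symm]
      have e2 : pairSum d Z a = pairSum d Z b := by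
        refine Finset.sum_congr rfl fun c hc => ?_
        rw [Finset.mem_range] at hc
        exact IH ((hab.cons _).cons _) (by simp only [X_cons]; omega)
      have e3 : Z a = Z b := IH hab (by omega)
      rw [Z_cons, Z_cons, e1, e2, e3]
    | swap d e l =>
      simp only [X_cons] at hn
      have hd := Z_cons_cons d e l fun a ha => by
        rw [Finset.mem_range] at ha
        refine IH ?_ (by simp only [X_cons]; omega)
        exact ((List.Perm.swap e _ l).cons a).trans (List.Perm.swap e a _)
      have he := Z_cons_cons e d l fun a ha => by
        rw [Finset.mem_range] at ha
        refine IH ?_ (by simp only [X_cons]; omega)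
        exact ((List.Perm.swap d _ l).cons a).trans (List.Perm.swap d a _)
      have hq : ∑ a ∈ Finset.range d, ∑ a' ∈ Finset.range e,
            Z (a' :: (e - 1 - a') :: a :: (d - 1 - a) :: l)
          = ∑ a ∈ Finset.range e, ∑ a' ∈ Finset.range d,
            Z (a' :: (d - 1 - a') :: a :: (e - 1 - a) :: l) := by
        rw [Finset.sum_comm]
        refine Finset.sum_congr rfl fun a ha => Finset.sum_congr rfl fun b hb => ?_
        rw [Finset.mem_range] at ha hb
        refine IH ?_ (by simp only [X_cons]; omega)
        exact List.perm_append_comm (l₁ := [a, e - 1 - a]) (l₂ := [b, d - 1 - b])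
          |>.append_right l
      have hsym2 : ∀ d e : ℕ, X l + 2 * d + 2 * e < n →
          ∑ a ∈ Finset.range d, ((2 * (a : ℚ) + 1) * Z ((a + e) :: (d - 1 - a) :: l)
          + (2 * ((d - 1 - a : ℕ) : ℚ) + 1) * Z (a :: (d - 1 - a + e) :: l))
          = 2 * ∑ a ∈ Finset.range d, (2 * (a : ℚ) + 1) * Z ((a + e) :: (d - 1 - a) :: l) := by
        intro d e hlt
        rw [Finset.sum_add_distrib, two_mul]
        congr 1
        rw [← Finset.sum_range_reflect]
        refine Finset.sum_congr rfl fun a ha => ?_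
        rw [Finset.mem_range] at ha
        rw [show d - 1 - (d - 1 - a) = a by omega]
        congr 1
        exact IH (List.Perm.swap _ _ l) (by simp only [X_cons]; omega)
      have hid := sum_reflect_identity (fun a b => Z (a :: b :: l)) d e fun a b hab =>
        IH (List.Perm.swap _ _ l) (by simp only [X_cons]; omega)
      have hc := Nop_comm d e Z l
      have hde := Z_cons (d + e) l
      have hδ : ((d : ℚ) - e) * (if d + e = 0 then 1 / 8 else 0) = 0 := by
        split_ifs with h
        · have h1 : d = 0 := by omega
          have h2 : e = 0 := by omega
          simp [h1, h2]
        · simp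
      rw [hsym2 d e (by omega)] at hd
      rw [hsym2 e d (by omega)] at he
      rw [add_comm e d] at he
      rw [hd, he, hq]
      simp only [pairSum] at hde hid ⊢
      linear_combination (-1 : ℚ) * hc - hid + 2 * ((d : ℚ) - e) * hde + 2 * Z l * hδ
    | trans h1 _ ih1 ih2 => exact (ih1 hn).trans (ih2 ((X_perm h1).symm.trans hn))

theorem sym_Zinv : Sym Zinv := by
  refine Sym.of_shuf sym_Z Z_nil ?_
  rw [shuf_comm, Z, Zinv, expo_shuf_expo_neg]
  exact sym_unit

end BGW

namespace BGW

/-! ### The one-point numbers -/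

theorem sum_box_ite {M : Type*} [AddCommMonoid M] (n d : ℕ) (hd : d ≤ n) (f : ℕ → ℕ → M) :
    ∑ a ∈ Finset.range n, ∑ b ∈ Finset.range n, (if a + b + 1 = d then f a b else 0)
      = ∑ a ∈ Finset.range d, f a (d - 1 - a) := by
  have h1 : ∀ a ∈ Finset.range n, ∑ b ∈ Finset.range n, (if a + b + 1 = d then f a b else 0)
      = if a < d then f a (d - 1 - a) else 0 := by
    intro a _
    split_ifs with ha
    · rw [Finset.sum_eq_single (d - 1 - a), if_pos (by omega)]
      · intro b _ hb
        rw [if_neg (by omega)]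
      · intro hb
        exact absurd (Finset.mem_range.mpr (by omega)) hb
    · exact Finset.sum_eq_zero fun b _ => by rw [if_neg (by omega)]
  rw [Finset.sum_congr rfl h1, ← Finset.sum_filter]
  refine Finset.sum_congr ?_ fun _ _ => rfl
  ext a
  simp only [Finset.mem_filter, Finset.mem_range]
  omega

/-- Averaging over permutations of (a, b, c) replaces 3c - N by a+b+c-N = 0. -/
theorem sum_triple_weight (f : ℕ → ℕ → ℕ → ℚ) (n N : ℕ)
    (h12 : ∀ a b c, f a b c = f b a c) (h23 : ∀ a b c, f a b c = f a c b) :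
    ∑ c ∈ Finset.range n, ∑ a ∈ Finset.range n, ∑ b ∈ Finset.range n,
      (if a + b + c = N then (3 * (c : ℚ) - N) * f a b c else 0) = 0 := by
  set g : ℕ → ℕ → ℕ → ℚ := fun a b c => if a + b + c = N then f a b c else 0 with hg
  have g12 : ∀ a b c, g a b c = g b a c := fun a b c => by
    simp only [hg]; rw [h12, add_comm a b]
  have g23 : ∀ a b c, g a b c = g a c b := fun a b c => by
    simp only [hg]; rw [h23, add_right_comm]
  set s := Finset.range n
  have e1 : ∑ c ∈ s, ∑ a ∈ s, ∑ b ∈ s, (a : ℚ) * g a b c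
      = ∑ c ∈ s, ∑ a ∈ s, ∑ b ∈ s, (c : ℚ) * g a b c := by
    rw [Finset.sum_comm]
    refine Finset.sum_congr rfl fun a _ => Finset.sum_congr rfl fun c _ =>
      Finset.sum_congr rfl fun b _ => ?_
    rw [g12 a b c, g23 b a c, g12 b c a]
  have e2 : ∑ c ∈ s, ∑ a ∈ s, ∑ b ∈ s, (b : ℚ) * g a b c
      = ∑ c ∈ s, ∑ a ∈ s, ∑ b ∈ s, (a : ℚ) * g a b c := by
    refine Finset.sum_congr rfl fun c _ => ?_
    rw [Finset.sum_comm]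
    refine Finset.sum_congr rfl fun b _ => Finset.sum_congr rfl fun a _ => ?_
    rw [g12 a b c]
  have e3 : ∑ c ∈ s, ∑ a ∈ s, ∑ b ∈ s,
      (if a + b + c = N then (3 * (c : ℚ) - N) * f a b c else 0)
      = 2 * ∑ c ∈ s, ∑ a ∈ s, ∑ b ∈ s, (c : ℚ) * g a b c
        - ∑ c ∈ s, ∑ a ∈ s, ∑ b ∈ s, (a : ℚ) * g a b c
        - ∑ c ∈ s, ∑ a ∈ s, ∑ b ∈ s, (b : ℚ) * g a b c := by
    simp only [Finset.mul_sum, ← Finset.sum_sub_distrib]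
    refine Finset.sum_congr rfl fun c _ => Finset.sum_congr rfl fun a _ =>
      Finset.sum_congr rfl fun b _ => ?_
    simp only [hg]
    split_ifs with h
    · rw [← h]; push_cast; ring
    · ring
  rw [e3, e2, e1]
  ring

/-- With m = N+1, the weighted three-point sum over a+b+c = N vanishes by symmetry. Read backwards,
the recursion contracts the pair a, b, turning this into a weighted sum of two-point numbers
Z(N+1-c, c), c ≤ N. Adding the term c = N+1, which is Z(0, N+1), the weight splits as 3c-N =
(3/2)(2c-N-1) + (N+3)/2: the first part is odd under reflection, and the second sums to Z(N+2) by
the recursion. -/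
theorem Z_singleton_rec (m : ℕ) :
    8 * ((m : ℚ) + 2) * Z [m + 1] = (2 * m + 1) * (2 * m + 3) ^ 2 * Z [m] := by
  have hZ0 : ∀ c, Z [0, c] = (2 * (c : ℚ) + 1 + 1 / 8) * Z [c] := by
    intro c
    rw [Z_cons, Nop_cons]
    simp [pairSum]
    ring
  cases m with
  | zero =>
    have h1 : Z [0 + 1] = 1 / 2 * Z [0, 0] := by
      rw [Z_cons]; simp [pairSum]
    rw [h1, hZ0]
    simp; ring
  | succ N =>
    have hs : ∀ a b, Z [a, b] = Z [b, a] := fun a b => sym_Z _ _ (List.Perm.swap _ _ _)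
    have ht := sum_triple_weight (fun a b c => Z [a, b, c]) (N + 1) N
      (fun a b c => sym_Z _ _ (List.Perm.swap _ _ _))
      (fun a b c => sym_Z _ _ ((List.Perm.swap _ _ _).cons a))
    have ht' : ∀ c ∈ Finset.range (N + 1),
        ∑ a ∈ Finset.range (N + 1), ∑ b ∈ Finset.range (N + 1),
          (if a + b + c = N then (3 * (c : ℚ) - N) * Z [a, b, c] else 0)
        = 2 * ((3 * (c : ℚ) - N) * Z [N + 1 - c, c]
          - (3 * (c : ℚ) - N) * (2 * c + 1) * Z [N + 1]) := by
      intro c hc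
      rw [Finset.mem_range] at hc
      have e1 : Z [N + 1 - c, c] = (2 * (c : ℚ) + 1) * Z [N + 1]
          + 1 / 2 * pairSum (N + 1 - c) Z [c] := by
        rw [Z_cons, Nop_cons, if_neg (by omega), show c + (N + 1 - c) = N + 1 by omega]
        simp
      have e2 := sum_box_ite (N + 1) (N + 1 - c) (by omega)
        (fun a b => (3 * (c : ℚ) - N) * Z [a, b, c])
      have e3 : ∀ a b, (a + b + 1 = N + 1 - c) = (a + b + c = N) := by
        intro a b
        apply propext
        omega
      simp only [e3] at e2
      rw [e2, ← Finset.mul_sum, e1, pairSum]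
      ring
    rw [Finset.sum_congr rfl ht', ← Finset.mul_sum, Finset.sum_sub_distrib,
      ← Finset.sum_mul] at ht
    have hp : ∑ c ∈ Finset.range (N + 1), (3 * (c : ℚ) - N) * (2 * c + 1)
        = N * (N + 1) * (2 * N + 3) / 2 := by
      have : ∀ n : ℕ, ∀ x : ℚ, ∑ c ∈ Finset.range n, (3 * (c : ℚ) - x) * (2 * c + 1)
          = n * (n - 1) * (4 * n + 1) / 2 - x * n ^ 2 := by
        intro n x
        induction n with
        | zero => simp
        | succ n ih => rw [Finset.sum_range_succ, ih]; push_cast; ring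
      rw [this]; push_cast; ring
    have hsum : ∑ c ∈ Finset.range (N + 2), Z [N + 1 - c, c] = 2 * Z [N + 2] := by
      rw [Z_cons]
      simp only [Nop_nil, pairSum]
      rw [if_neg (by omega)]
      rw [Finset.sum_congr rfl fun c _ => hs (N + 1 - c) c]
      rw [show N + 2 - 1 = N + 1 by omega]
      ring
    have hrefl : ∑ c ∈ Finset.range (N + 2), (2 * (c : ℚ) - (N + 1)) * Z [N + 1 - c, c] = 0 := by
      have h1 := Finset.sum_range_reflect
        (fun c : ℕ => (2 * (c : ℚ) - (N + 1)) * Z [N + 1 - c, c]) (N + 2)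
      have h2 : ∑ c ∈ Finset.range (N + 2), (2 * ((N + 2 - 1 - c : ℕ) : ℚ) - (N + 1))
            * Z [N + 1 - (N + 2 - 1 - c), N + 2 - 1 - c]
          = -∑ c ∈ Finset.range (N + 2), (2 * (c : ℚ) - (N + 1)) * Z [N + 1 - c, c] := by
        rw [← Finset.sum_neg_distrib]
        refine Finset.sum_congr rfl fun c hc => ?_
        rw [Finset.mem_range] at hc
        rw [show N + 2 - 1 - c = N + 1 - c by omega, show N + 1 - (N + 1 - c) = c by omega, hs,
          Nat.cast_sub (by omega)]
        push_cast; ring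
      linarith
    have hlast : ∑ c ∈ Finset.range (N + 2), (3 * (c : ℚ) - N) * Z [N + 1 - c, c]
        = ∑ c ∈ Finset.range (N + 1), (3 * (c : ℚ) - N) * Z [N + 1 - c, c]
          + (2 * N + 3) * (2 * N + 3 + 1 / 8) * Z [N + 1] := by
      rw [Finset.sum_range_succ, Nat.sub_self, hZ0]; push_cast; ring
    have hcomb : ∑ c ∈ Finset.range (N + 2), (3 * (c : ℚ) - N) * Z [N + 1 - c, c]
        = 3 / 2 * ∑ c ∈ Finset.range (N + 2), (2 * (c : ℚ) - (N + 1)) * Z [N + 1 - c, c]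
          + ((N : ℚ) + 3) / 2 * ∑ c ∈ Finset.range (N + 2), Z [N + 1 - c, c] := by
      rw [Finset.mul_sum, Finset.mul_sum, ← Finset.sum_add_distrib]
      refine Finset.sum_congr rfl fun c _ => ?_
      ring
    rw [hrefl, hsum] at hcomb
    rw [hp] at ht
    push_cast
    linear_combination 4 * ht + 8 * hlast - 8 * hcomb

end BGW

namespace BGW

/-! ### The shifted disconnected numbers

`shiftZ N l` is the coefficient of `w ^ N` of the disconnected generating function with insertions
`l`, after the shift of the times by `-2 (2 w) ^ (2 a + 1) / (2 a + 1)`. -/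

/-- Coefficients of the shifted disconnected function. -/
def shiftZ : ℕ → List ℕ → ℚ
  | 0, l => Z l
  | N + 1, l => -4 / (N + 1) * ∑ a : Fin (N / 2 + 1), 4 ^ (a : ℕ) * shiftZ (N - 2 * a) (a :: l)
termination_by N => N
decreasing_by omega

theorem shiftZ_zero (l : List ℕ) : shiftZ 0 l = Z l := by rw [shiftZ]

theorem shiftZ_succ (N : ℕ) (l : List ℕ) :
    shiftZ (N + 1) l
      = -4 / (N + 1) * ∑ a ∈ Finset.range (N / 2 + 1), 4 ^ a * shiftZ (N - 2 * a) (a :: l) := by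
  rw [shiftZ, Finset.sum_range]

/-- `delayZ N k l` is the coefficient of `w ^ N` in `w ^ k` times the shifted function. -/
def delayZ (N k : ℕ) (l : List ℕ) : ℚ := if k ≤ N then shiftZ (N - k) l else 0

theorem delayZ_of_lt {N k : ℕ} (h : N < k) : delayZ N k = 0 := by
  funext l
  simp only [delayZ, Pi.zero_apply]
  rw [if_neg (by omega)]

/-- This is w d/dw acting through the time shift: the shift of t_a is -4·4^a w^(2a+1)/(2a+1), and w
d/dw removes the denominator. The bound `M` is free because terms with delay beyond `N` are zero. -/
theorem delayZ_euler {N M : ℕ} (hM : N ≤ M) (k : ℕ) (l : List ℕ) :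
    ((N : ℚ) - k) * delayZ N k l
      = -4 * ∑ a ∈ Finset.range M, 4 ^ a * delayZ N (k + 2 * a + 1) (a :: l) := by
  rcases lt_trichotomy k N with h | h | h
  · obtain ⟨n, rfl⟩ : ∃ n, N = k + n + 1 := ⟨N - k - 1, by omega⟩
    have h1 : ∑ a ∈ Finset.range M, 4 ^ a * delayZ (k + n + 1) (k + 2 * a + 1) (a :: l)
        = ∑ a ∈ Finset.range (n / 2 + 1), 4 ^ a * shiftZ (n - 2 * a) (a :: l) := by
      symm
      refine (Finset.sum_congr rfl fun a ha => ?_).trans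
        (Finset.sum_subset (Finset.range_subset_range.mpr (by omega)) fun a _ ha => ?_)
      · rw [Finset.mem_range] at ha
        rw [delayZ, if_pos (by omega), show k + n + 1 - (k + 2 * a + 1) = n - 2 * a by omega]
      · rw [Finset.mem_range] at ha
        rw [delayZ_of_lt (by omega), Pi.zero_apply, mul_zero]
    rw [h1, delayZ, if_pos (by omega), show k + n + 1 - k = n + 1 by omega, shiftZ_succ]
    have : (n : ℚ) + 1 ≠ 0 := by positivity
    push_cast
    field_simp
    ring
  · subst h
    rw [sub_self, zero_mul, Finset.sum_eq_zero, mul_zero]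
    intro a _
    rw [delayZ_of_lt (by omega), Pi.zero_apply, mul_zero]
  · rw [delayZ_of_lt h, Pi.zero_apply, mul_zero, Finset.sum_eq_zero, mul_zero]
    intro a _
    rw [delayZ_of_lt (by omega), Pi.zero_apply, mul_zero]

theorem sym_shiftZ (N : ℕ) : Sym (shiftZ N) := by
  induction N using Nat.strong_induction_on with
  | _ N IH =>
    intro l l' hp
    cases N with
    | zero => rw [shiftZ_zero, shiftZ_zero, sym_Z _ _ hp]
    | succ N =>
      rw [shiftZ_succ, shiftZ_succ]
      congr 1
      refine Finset.sum_congr rfl fun a _ => ?_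
      rw [IH (N - 2 * a) (by omega) _ _ (hp.cons a)]

theorem sym_delayZ (N k : ℕ) : Sym (delayZ N k) := by
  intro l l' hp
  simp only [delayZ]
  rw [sym_shiftZ _ _ _ hp]

/-- Virasoro constraints after the shift: replacing t_c by its shifted value in ∑ (2c+1) t_c ∂_{c+d}
produces the extra sum. The proof is an induction on the remaining order N-k. At k = N it is
`Z_cons`; for k < N one multiplies by N-k and removes this factor from each term by `delayZ_euler`.
-/
theorem delayZ_cons {N M : ℕ} (hM : N ≤ M) (k d : ℕ) (l : List ℕ) :
    delayZ N k (d :: l) = Nop d (delayZ N k) l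
      - 4 * ∑ c ∈ Finset.range M, 4 ^ c * delayZ N (k + 2 * c + 1) ((c + d) :: l)
      + 1 / 2 * pairSum d (delayZ N k) l + (if d = 0 then 1 / 8 else 0) * delayZ N k l := by
  induction hn : N + 1 - k using Nat.strong_induction_on generalizing k l with
  | _ n IH =>
    rcases lt_trichotomy k N with h | h | h
    · have hne : (N : ℚ) - k ≠ 0 := by
        have : (k : ℚ) < N := by exact_mod_cast h
        linarith
      refine mul_left_cancel₀ hne ?_
      have hF : ((N : ℚ) - k) • delayZ N k
          = (-4 : ℚ) • ∑ a ∈ Finset.range M, (4 : ℚ) ^ a • der a (delayZ N (k + 2 * a + 1)) := by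
        funext l
        simp only [Pi.smul_apply, Finset.sum_apply, smul_eq_mul]
        exact delayZ_euler hM k l
      have t1 : ((N : ℚ) - k) * Nop d (delayZ N k) l
          = -4 * ∑ a ∈ Finset.range M, 4 ^ a * Nop d (der a (delayZ N (k + 2 * a + 1))) l := by
        have : ((N : ℚ) - k) * Nop d (delayZ N k) l = Nop d (((N : ℚ) - k) • delayZ N k) l := by
          rw [Nop_smul]; rfl
        rw [this, hF, Nop_smul, Nop_sum]
        simp only [Nop_smul, Pi.smul_apply, Finset.sum_apply, smul_eq_mul]
      -- The excess 2c+1 of the delay in this term supplies the factor 2a+1 that arises when the new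
      -- insertion `a` is raised by `N_d`.
      have t2 : ((N : ℚ) - k) * ∑ c ∈ Finset.range M,
            4 ^ c * delayZ N (k + 2 * c + 1) ((c + d) :: l)
          = ∑ a ∈ Finset.range M, 4 ^ a * ((2 * (a : ℚ) + 1)
              * delayZ N (k + 2 * a + 1) ((a + d) :: l)
              - 4 * ∑ c ∈ Finset.range M,
                4 ^ c * delayZ N (k + 2 * a + 1 + 2 * c + 1) ((c + d) :: a :: l)) := by
        have h1 : ∀ c ∈ Finset.range M, ((N : ℚ) - k)
              * (4 ^ c * delayZ N (k + 2 * c + 1) ((c + d) :: l))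
            = 4 ^ c * ((2 * (c : ℚ) + 1) * delayZ N (k + 2 * c + 1) ((c + d) :: l))
              - 4 * ∑ a ∈ Finset.range M, 4 ^ c * (4 ^ a
                * delayZ N (k + 2 * a + 1 + 2 * c + 1) ((c + d) :: a :: l)) := by
          intro c _
          have h2 := delayZ_euler hM (k + 2 * c + 1) ((c + d) :: l)
          have h3 : ∀ a, delayZ N (k + 2 * c + 1 + 2 * a + 1) (a :: (c + d) :: l)
              = delayZ N (k + 2 * a + 1 + 2 * c + 1) ((c + d) :: a :: l) := by
            intro a
            rw [sym_delayZ _ _ _ _ (List.Perm.swap (c + d) a l),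
              show k + 2 * c + 1 + 2 * a + 1 = k + 2 * a + 1 + 2 * c + 1 by ring]
          simp only [h3] at h2
          rw [← Finset.mul_sum]
          push_cast at h2
          linear_combination 4 ^ c * h2
        rw [Finset.mul_sum, Finset.sum_congr rfl h1, Finset.sum_sub_distrib, ← Finset.mul_sum,
          Finset.sum_comm]
        simp only [mul_sub, Finset.sum_sub_distrib, Finset.mul_sum]
        congr 1
        refine Finset.sum_congr rfl fun a _ => Finset.sum_congr rfl fun c _ => ?_
        ring
      have t3 : ((N : ℚ) - k) * pairSum d (delayZ N k) l
          = -4 * ∑ a ∈ Finset.range M, 4 ^ a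
            * pairSum d (delayZ N (k + 2 * a + 1)) (a :: l) := by
        simp only [pairSum, Finset.mul_sum]
        rw [Finset.sum_comm]
        refine Finset.sum_congr rfl fun b _ => ?_
        rw [delayZ_euler hM, Finset.mul_sum]
        refine Finset.sum_congr rfl fun a _ => ?_
        congr 2
        refine sym_delayZ _ _ _ _ ?_
        exact (List.Perm.swap b a _).trans ((List.Perm.swap _ a l).cons b)
      have t4 := delayZ_euler hM k l
      have t0 : ((N : ℚ) - k) * delayZ N k (d :: l) = -4 * ∑ a ∈ Finset.range M, 4 ^ a *
          ((2 * (a : ℚ) + 1) * delayZ N (k + 2 * a + 1) ((a + d) :: l)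
            + Nop d (der a (delayZ N (k + 2 * a + 1))) l
            - 4 * ∑ c ∈ Finset.range M,
                4 ^ c * delayZ N (k + 2 * a + 1 + 2 * c + 1) ((c + d) :: a :: l)
            + 1 / 2 * pairSum d (delayZ N (k + 2 * a + 1)) (a :: l)
            + (if d = 0 then 1 / 8 else 0) * delayZ N (k + 2 * a + 1) (a :: l)) := by
        rw [delayZ_euler hM]
        congr 1
        refine Finset.sum_congr rfl fun a _ => ?_
        rw [sym_delayZ _ _ _ _ (List.Perm.swap d a l),
          IH (N + 1 - (k + 2 * a + 1)) (by omega) (k + 2 * a + 1) (a :: l) rfl, Nop_cons,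
          nsmul_eq_mul]
        push_cast
        ring
      rw [t0]
      have t5 : ∑ a ∈ Finset.range M, (4 : ℚ) ^ a *
          ((2 * (a : ℚ) + 1) * delayZ N (k + 2 * a + 1) ((a + d) :: l)
            + Nop d (der a (delayZ N (k + 2 * a + 1))) l
            - 4 * ∑ c ∈ Finset.range M,
                4 ^ c * delayZ N (k + 2 * a + 1 + 2 * c + 1) ((c + d) :: a :: l)
            + 1 / 2 * pairSum d (delayZ N (k + 2 * a + 1)) (a :: l)
            + (if d = 0 then 1 / 8 else 0) * delayZ N (k + 2 * a + 1) (a :: l))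
          = ∑ a ∈ Finset.range M, 4 ^ a * ((2 * (a : ℚ) + 1)
              * delayZ N (k + 2 * a + 1) ((a + d) :: l)
              - 4 * ∑ c ∈ Finset.range M,
                4 ^ c * delayZ N (k + 2 * a + 1 + 2 * c + 1) ((c + d) :: a :: l))
            + ∑ a ∈ Finset.range M, 4 ^ a * Nop d (der a (delayZ N (k + 2 * a + 1))) l
            + 1 / 2 * ∑ a ∈ Finset.range M, 4 ^ a
              * pairSum d (delayZ N (k + 2 * a + 1)) (a :: l)
            + (if d = 0 then 1 / 8 else 0)
              * ∑ a ∈ Finset.range M, 4 ^ a * delayZ N (k + 2 * a + 1) (a :: l) := by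
        rw [Finset.mul_sum _ _ (1 / 2 : ℚ), Finset.mul_sum _ _ (if d = 0 then (1 / 8 : ℚ) else 0),
          ← Finset.sum_add_distrib, ← Finset.sum_add_distrib, ← Finset.sum_add_distrib]
        refine Finset.sum_congr rfl fun a _ => ?_
        ring
      rw [t5]
      linear_combination (-1 : ℚ) * t1 + 4 * t2 - 1 / 2 * t3
        - (if d = 0 then (1 / 8 : ℚ) else 0) * t4
    · subst h
      have h0 : delayZ k k = Z := by
        funext l
        rw [delayZ, if_pos le_rfl, Nat.sub_self, shiftZ_zero]
      rw [h0, Z_cons, Finset.sum_eq_zero]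
      · ring
      · intro c _
        rw [delayZ_of_lt (by omega), Pi.zero_apply, mul_zero]
    · rw [delayZ_of_lt h, Nop_zero, Finset.sum_eq_zero]
      · simp [pairSum]
      · intro c _
        rw [delayZ_of_lt (by omega), Pi.zero_apply, mul_zero]

end BGW

namespace BGW

/-! ### The recurrence for the shifted function without insertions -/

theorem sum_range_conv (M : ℕ) (r G : ℕ → ℚ) (hG : ∀ e, M ≤ e → G e = 0) :
    ∑ d ∈ Finset.range M, ∑ c ∈ Finset.range M, r d * G (c + d)
      = ∑ e ∈ Finset.range M, (∑ d ∈ Finset.range (e + 1), r d) * G e := by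
  have h1 : ∀ d, ∑ c ∈ Finset.range M, r d * G (c + d)
      = ∑ e ∈ Finset.range M, if d ≤ e then r d * G e else 0 := by
    intro d
    have h2 : ∑ e ∈ Finset.range M, (if d ≤ e then r d * G e else 0)
        = ∑ e ∈ Finset.range (d + M), if d ≤ e then r d * G e else 0 := by
      refine Finset.sum_subset (Finset.range_subset_range.mpr (by omega)) fun e _ he => ?_
      rw [Finset.mem_range] at he
      rw [hG e (by omega), mul_zero, ite_self]
    have h3 : ∑ e ∈ Finset.range d, (if d ≤ e then r d * G e else 0) = 0 := by
      refine Finset.sum_eq_zero fun e he => ?_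
      rw [Finset.mem_range] at he
      rw [if_neg (by omega)]
    rw [h2, Finset.sum_range_add, h3, zero_add]
    refine Finset.sum_congr rfl fun c _ => ?_
    rw [if_pos (by omega), add_comm]
  rw [Finset.sum_congr rfl fun d _ => h1 d, Finset.sum_comm]
  refine Finset.sum_congr rfl fun e he => ?_
  rw [Finset.mem_range] at he
  rw [← Finset.sum_filter, Finset.sum_mul]
  refine Finset.sum_congr ?_ fun _ _ => rfl
  ext d
  simp only [Finset.mem_filter, Finset.mem_range]
  omega

theorem sum_range_pairs (M : ℕ) (F : ℕ → ℕ → ℕ → ℚ) (hF : ∀ d a b, M ≤ d → F d a b = 0) :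
    ∑ d ∈ Finset.range M, ∑ a ∈ Finset.range d, F d a (d - 1 - a)
      = ∑ a ∈ Finset.range M, ∑ b ∈ Finset.range M, F (a + b + 1) a b := by
  have h1 : ∀ d ∈ Finset.range M, ∑ a ∈ Finset.range d, F d a (d - 1 - a)
      = ∑ a ∈ Finset.range M, ∑ b ∈ Finset.range M, if a + b + 1 = d then F d a b else 0 := by
    intro d hd
    rw [Finset.mem_range] at hd
    rw [sum_box_ite M d hd.le]
  rw [Finset.sum_congr rfl h1, Finset.sum_comm]
  refine Finset.sum_congr rfl fun a _ => ?_
  rw [Finset.sum_comm]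
  refine Finset.sum_congr rfl fun b _ => ?_
  by_cases h : a + b + 1 < M
  · rw [Finset.sum_eq_single (a + b + 1), if_pos rfl]
    · intro d _ hd
      rw [if_neg (Ne.symm hd)]
    · intro hd
      exact absurd (Finset.mem_range.mpr h) hd
  · rw [hF (a + b + 1) a b (by omega)]
    refine Finset.sum_eq_zero fun d hd => ?_
    rw [Finset.mem_range] at hd
    rw [if_neg (by omega)]

/-- Weighted sums of one-point shifted numbers. -/
def oneSum (N : ℕ) (r : ℕ → ℚ) (k : ℕ) : ℚ :=
  ∑ a ∈ Finset.range (N + 1), r a * (4 ^ a * delayZ N (k + 2 * a + 1) [a])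

/-- Weighted sums of two-point shifted numbers. -/
def twoSum (N : ℕ) (r : ℕ → ℕ → ℚ) (k : ℕ) : ℚ :=
  ∑ a ∈ Finset.range (N + 1), ∑ b ∈ Finset.range (N + 1),
    r a b * (4 ^ (a + b) * delayZ N (k + 2 * a + 2 * b + 2) [a, b])

/-- The Euler identity at delay k+2a+1 carries the factor N-k-(2a+1); the 2a+1 is moved into the
weight. -/
theorem oneSum_mul (N : ℕ) (r : ℕ → ℚ) (k : ℕ) :
    ((N : ℚ) - k) * oneSum N r k
      = oneSum N (fun a => r a * (2 * a + 1)) k - 4 * twoSum N (fun a _ => r a) k := by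
  simp only [oneSum, twoSum]
  rw [Finset.mul_sum, Finset.mul_sum, ← Finset.sum_sub_distrib]
  refine Finset.sum_congr rfl fun a _ => ?_
  have h := delayZ_euler (Nat.le_succ N) (k + 2 * a + 1) [a]
  have h2 : ∑ b ∈ Finset.range (N + 1), r a * (4 ^ (a + b)
        * delayZ N (k + 2 * a + 2 * b + 2) [a, b])
      = r a * 4 ^ a * ∑ b ∈ Finset.range (N + 1),
        4 ^ b * delayZ N (k + 2 * a + 1 + 2 * b + 1) [b, a] := by
    rw [Finset.mul_sum]
    refine Finset.sum_congr rfl fun b _ => ?_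
    rw [sym_delayZ _ _ _ _ (List.Perm.swap b a []),
      show k + 2 * a + 2 * b + 2 = k + 2 * a + 1 + 2 * b + 1 by ring]
    ring
  rw [h2]
  push_cast at h
  linear_combination r a * 4 ^ a * h

/-- The shifted constraints are summed over d with weight r(d) 4^d. The shift term is a convolution,
which replaces `r` by its partial sums; in the pair term d = a+b+1, and (1/2)·4^d = 2·4^(a+b). -/
theorem oneSum_virasoro (N : ℕ) (r : ℕ → ℚ) (k : ℕ) :
    oneSum N r k = -4 * oneSum N (fun e => ∑ d ∈ Finset.range (e + 1), r d) (k + 1)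
      + 2 * twoSum N (fun a b => r (a + b + 1)) (k + 1)
      + r 0 / 8 * delayZ N (k + 1) [] := by
  have h1 : ∀ d ∈ Finset.range (N + 1), r d * (4 ^ d * delayZ N (k + 2 * d + 1) [d])
      = -4 * ∑ c ∈ Finset.range (N + 1),
          r d * (4 ^ (c + d) * delayZ N (k + 1 + 2 * (c + d) + 1) [c + d])
        + 2 * ∑ a ∈ Finset.range d,
          r d * (4 ^ (d - 1) * delayZ N (k + 1 + 2 * d) [a, d - 1 - a])
        + if d = 0 then r 0 / 8 * delayZ N (k + 1) [] else 0 := by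
    intro d _
    rw [delayZ_cons (Nat.le_succ N)]
    have e1 : ∀ c ∈ Finset.range (N + 1),
        r d * ((4 : ℚ) ^ (c + d) * delayZ N (k + 1 + 2 * (c + d) + 1) [c + d])
        = r d * 4 ^ d * (4 ^ c * delayZ N (k + 2 * d + 1 + 2 * c + 1) [c + d]) := by
      intro c _
      rw [show k + 1 + 2 * (c + d) + 1 = k + 2 * d + 1 + 2 * c + 1 by ring]
      ring
    rw [Finset.sum_congr rfl e1, ← Finset.mul_sum, ← Finset.mul_sum, ← Finset.mul_sum,
      show k + 2 * d + 1 = k + 1 + 2 * d by ring]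
    simp only [Nop_nil, pairSum]
    cases d with
    | zero => simp; ring
    | succ d =>
      rw [if_neg (by omega), if_neg (by omega)]
      simp only [Nat.add_sub_cancel]
      ring
  have hv : ∀ e, N + 1 ≤ e → (4 : ℚ) ^ e * delayZ N (k + 1 + 2 * e + 1) [e] = 0 := by
    intro e he
    rw [delayZ_of_lt (by omega), Pi.zero_apply, mul_zero]
  rw [oneSum, Finset.sum_congr rfl h1, Finset.sum_add_distrib, Finset.sum_add_distrib,
    ← Finset.mul_sum, ← Finset.mul_sum,
    sum_range_conv (N + 1) r (fun e => 4 ^ e * delayZ N (k + 1 + 2 * e + 1) [e]) hv,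
    sum_range_pairs (N + 1)
      (fun d a b => r d * (4 ^ (d - 1) * delayZ N (k + 1 + 2 * d) [a, b])) (fun d a b hd => by
        rw [delayZ_of_lt (by omega), Pi.zero_apply, mul_zero, mul_zero])]
  rw [Finset.sum_ite_eq' (Finset.range (N + 1)) 0, if_pos (by simp)]
  simp only [oneSum, twoSum]
  congr 2
  congr 1
  refine Finset.sum_congr rfl fun a _ => Finset.sum_congr rfl fun b _ => ?_
  rw [Nat.add_sub_cancel, show k + 1 + 2 * (a + b + 1) = k + 1 + 2 * a + 2 * b + 2 by ring]

theorem oneSum_congr {N : ℕ} {r r' : ℕ → ℚ} (h : ∀ a, r a = r' a) (k : ℕ) :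
    oneSum N r k = oneSum N r' k := by
  rw [funext h]

theorem oneSum_linear (N : ℕ) (x y : ℚ) (r r' : ℕ → ℚ) (k : ℕ) :
    oneSum N (fun a => x * r a + y * r' a) k = x * oneSum N r k + y * oneSum N r' k := by
  simp only [oneSum, Finset.mul_sum, ← Finset.sum_add_distrib]
  refine Finset.sum_congr rfl fun a _ => ?_
  ring

/-- Taking r = 1 and r(d) = d in `oneSum_virasoro` gives relations among the one-point moments with
weights 1, 2a+1, (2a+1)² and the two-point moments with weights 1, 2a+1. By symmetry the pair weight
a+b+1 may be replaced by 2a+1. The Euler identities eliminate the two-point and the quadratic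
moments, and the two resulting formulas for `P 1` give the recurrence. -/
theorem shiftZ_nil_rec (n : ℕ) :
    2 * ((n : ℚ) + 2) * shiftZ (n + 2) [] + (3 * ((n : ℚ) + 1) ^ 2 + 5 * (n + 1) + 1)
      * shiftZ (n + 1) [] + n * (n + 2) ^ 2 * shiftZ n [] = 0 := by
  set N := n + 2 with hN
  set al : ℕ → ℚ := oneSum N (fun _ => 1) with hal
  set P : ℕ → ℚ := oneSum N (fun a => 2 * a + 1) with hP
  set Q : ℕ → ℚ := oneSum N (fun a => (2 * a + 1) * (2 * a + 1)) with hQ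
  set T : ℕ → ℚ := twoSum N (fun _ _ => 1) with hT
  set U : ℕ → ℚ := twoSum N (fun a _ => 2 * a + 1) with hU
  have m0 : ∀ k, ((N : ℚ) - k) * delayZ N k [] = -4 * al k := by
    intro k
    rw [delayZ_euler (Nat.le_succ N)]
    simp only [hal, oneSum, one_mul]
  have m1 : ∀ k, ((N : ℚ) - k) * al k = P k - 4 * T k := by
    intro k
    have := oneSum_mul N (fun _ => 1) k
    simp only [one_mul] at this
    exact this
  have m2 : ∀ k, ((N : ℚ) - k) * P k = Q k - 4 * U k := fun k =>
    oneSum_mul N (fun a => 2 * a + 1) k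
  have e0 : ∀ k, al k = -2 * (P (k + 1) + al (k + 1)) + 2 * T (k + 1)
      + 1 / 8 * delayZ N (k + 1) [] := by
    intro k
    have h := oneSum_virasoro N (fun _ => 1) k
    have h2 : oneSum N (fun e => ∑ d ∈ Finset.range (e + 1), (1 : ℚ)) (k + 1)
        = 1 / 2 * P (k + 1) + 1 / 2 * al (k + 1) := by
      rw [hP, hal, ← oneSum_linear]
      refine oneSum_congr (fun a => ?_) _
      simp
      ring
    rw [h2] at h
    simp only [hal, hT] at h ⊢
    linear_combination h
  have e1 : ∀ k, 1 / 2 * (P k - al k) = -1 / 2 * (Q (k + 1) - al (k + 1)) + 2 * U (k + 1) := by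
    intro k
    have h := oneSum_virasoro N (fun d => d) k
    have h2 : oneSum N (fun e => ∑ d ∈ Finset.range (e + 1), (d : ℚ)) (k + 1)
        = 1 / 8 * Q (k + 1) + (-1 / 8) * al (k + 1) := by
      rw [hQ, hal, ← oneSum_linear]
      refine oneSum_congr (fun a => ?_) _
      induction a with
      | zero => norm_num
      | succ a ih => rw [Finset.sum_range_succ, ih]; push_cast; ring
    have h3 : oneSum N (fun d => (d : ℚ)) k = 1 / 2 * P k + (-1 / 2) * al k := by
      rw [hP, hal, ← oneSum_linear]
      refine oneSum_congr (fun a => ?_) _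
      ring
    have h4 : twoSum N (fun a b => ((a + b + 1 : ℕ) : ℚ)) (k + 1) = U (k + 1) := by
      have hsw : ∀ r : ℕ → ℕ → ℚ, twoSum N r (k + 1) = twoSum N (fun a b => r b a) (k + 1) := by
        intro r
        simp only [twoSum]
        rw [Finset.sum_comm]
        refine Finset.sum_congr rfl fun b _ => Finset.sum_congr rfl fun a _ => ?_
        rw [sym_delayZ _ _ _ _ (List.Perm.swap b a []), add_comm a b,
          show k + 1 + 2 * a + 2 * b + 2 = k + 1 + 2 * b + 2 * a + 2 by ring]
      have hadd : twoSum N (fun a b => ((a + b + 1 : ℕ) : ℚ)) (k + 1)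
          = 1 / 2 * twoSum N (fun a _ => 2 * a + 1) (k + 1)
            + 1 / 2 * twoSum N (fun _ b => 2 * b + 1) (k + 1) := by
        simp only [twoSum, Finset.mul_sum, ← Finset.sum_add_distrib]
        refine Finset.sum_congr rfl fun a _ => Finset.sum_congr rfl fun b _ => ?_
        push_cast
        ring
      rw [hadd, hsw (fun _ b => 2 * b + 1)]
      simp only [hU]
      ring
    rw [h2, h3, h4] at h
    simp only [Nat.cast_zero, zero_div, zero_mul, add_zero] at h
    linear_combination h
  have d0 : delayZ N 0 [] = shiftZ (n + 2) [] := by simp [delayZ, hN]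
  have d1 : delayZ N 1 [] = shiftZ (n + 1) [] := by simp [delayZ, hN]
  have d2 : delayZ N 2 [] = shiftZ n [] := by simp [delayZ, hN]
  have hNc : (N : ℚ) = n + 2 := by rw [hN]; push_cast; ring
  have a0 := m0 0
  have a1 := m0 1
  have a2 := m0 2
  have b1 := m1 1
  have b2 := m1 2
  have c2 := m2 2
  have f0 := e0 0
  have f1 := e0 1
  have f2 := e1 1
  simp only [d0, d1, d2, hNc, zero_add] at a0 a1 a2 b1 b2 c2 f0 f1 f2
  norm_num at a0 a1 a2 b1 b2 c2 f0 f1 f2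
  have p2 : P 2 = 2 / 3 * (-(2 + n / 2) * al 2 + shiftZ n [] / 8 - al 1) := by
    linear_combination (2 / 3 : ℚ) * f1 + 1 / 3 * b2
  have p1 : P 1 = al 1 - n * P 2 + al 2 := by
    linear_combination 2 * f2 + c2
  have p1' : P 1 = 2 / 3 * (-(2 + (n + 1) / 2) * al 1 + shiftZ (n + 1) [] / 8 - al 0) := by
    linear_combination (2 / 3 : ℚ) * f0 + 1 / 3 * b1
  have g2 : al 2 = -n * shiftZ n [] / 4 := by linear_combination (1 / 4 : ℚ) * a2
  have g1 : al 1 = -(n + 1) * shiftZ (n + 1) [] / 4 := by linear_combination (1 / 4 : ℚ) * a1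
  have g0 : al 0 = -(n + 2) * shiftZ (n + 2) [] / 4 := by linear_combination (1 / 4 : ℚ) * a0
  rw [p1', p2, g2, g1, g0] at p1
  linear_combination 12 * p1

theorem shiftZ_one_nil : shiftZ 1 [] = -1 / 2 := by
  have h : Z [0] = 1 / 8 := by
    rw [Z_cons]; simp [pairSum]
  have := shiftZ_succ 0 []
  simp [shiftZ_zero, h] at this
  rw [this]; norm_num

end BGW

namespace BGW

/-! ### The formal amplitudes -/

local notation "w" => (PowerSeries.X : PowerSeries ℚ)
local notation "D" => PowerSeries.derivative ℚ

/-- The shifted disconnected function as a power series. -/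
noncomputable def shiftSeries (l : List ℕ) : PowerSeries ℚ := PowerSeries.mk fun N => shiftZ N l

theorem coeff_pow_mul_shiftSeries (N k : ℕ) (l : List ℕ) :
    PowerSeries.coeff N (w ^ k * shiftSeries l) = delayZ N k l := by
  rw [PowerSeries.coeff_X_pow_mul', delayZ]
  simp [shiftSeries]

/-- The weight `4 ^ |𝐝| w ^ X(𝐝)`. -/
noncomputable def weight (l : List ℕ) : PowerSeries ℚ := PowerSeries.C (4 ^ l.sum) * w ^ X l

theorem weight_cons (d : ℕ) (l : List ℕ) : weight (d :: l) = weight [d] * weight l := by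
  simp only [weight, List.sum_cons, List.sum_nil, pow_add, map_mul, X]
  simp
  ring

theorem coeff_C_mul_X_pow_mul_Nop (N k d : ℕ) (l : List ℕ) :
    PowerSeries.coeff N (w ^ k * Nop d shiftSeries l) = Nop d (delayZ N k) l := by
  have h := Nop_map ((PowerSeries.coeff N).toAddMonoidHom.comp
    (AddMonoidHom.mulLeft (w ^ k))) d shiftSeries l
  rw [show delayZ N k = fun l => PowerSeries.coeff N (w ^ k * shiftSeries l) from
    funext fun l => (coeff_pow_mul_shiftSeries N k l).symm]
  exact h.symm

/-- After multiplication by 4^d w^(2d), the shift term of `delayZ_cons` is the tail a ≥ d of the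
Euler sum. It therefore equals w d/dw plus a correction from the finitely many a < d. -/
theorem shiftSeries_cons (d : ℕ) (l : List ℕ) :
    PowerSeries.C (4 ^ d) * (w ^ (2 * d) * shiftSeries (d :: l))
      = w * D (shiftSeries l) + PowerSeries.C (4 ^ d) * (w ^ (2 * d) * Nop d shiftSeries l)
        + ∑ a ∈ Finset.range d,
            PowerSeries.C (4 * 4 ^ a) * (w ^ (2 * a + 1) * shiftSeries (a :: l))
        + ∑ a ∈ Finset.range d, PowerSeries.C (1 / 2 * 4 ^ d)
            * (w ^ (2 * d) * shiftSeries (a :: (d - 1 - a) :: l))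
        + PowerSeries.C (if d = 0 then 1 / 8 else 0) * (w ^ 0 * shiftSeries l) := by
  ext N
  have hD : PowerSeries.coeff N (w * D (shiftSeries l)) = N * delayZ N 0 l := by
    cases N with
    | zero => simp
    | succ N =>
      rw [PowerSeries.coeff_succ_X_mul, PowerSeries.coeff_derivative, delayZ,
        if_pos (Nat.zero_le _)]
      simp [shiftSeries]
      ring
  simp only [map_add, map_sum, PowerSeries.coeff_C_mul, coeff_pow_mul_shiftSeries, hD,
    coeff_C_mul_X_pow_mul_Nop]
  have hv := delayZ_cons (le_refl N) (2 * d) d l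
  have he := delayZ_euler (show N ≤ d + N by omega) 0 l
  rw [Finset.sum_range_add] at he
  have h1 : ∑ x ∈ Finset.range N, (4 : ℚ) ^ (d + x) * delayZ N (0 + 2 * (d + x) + 1) ((d + x) :: l)
      = 4 ^ d * ∑ c ∈ Finset.range N, 4 ^ c * delayZ N (2 * d + 2 * c + 1) ((c + d) :: l) := by
    rw [Finset.mul_sum]
    refine Finset.sum_congr rfl fun c _ => ?_
    rw [show 0 + 2 * (d + c) + 1 = 2 * d + 2 * c + 1 by ring, add_comm d c, pow_add]
    ring
  have h2 : (if d = 0 then (1 / 8 : ℚ) else 0) * (4 ^ d * delayZ N (2 * d) l)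
      = (if d = 0 then 1 / 8 else 0) * delayZ N 0 l := by
    split_ifs with h
    · subst h; simp
    · simp
  have h3 : ∑ a ∈ Finset.range d, (4 : ℚ) * 4 ^ a * delayZ N (2 * a + 1) (a :: l)
      = 4 * ∑ a ∈ Finset.range d, 4 ^ a * delayZ N (0 + 2 * a + 1) (a :: l) := by
    rw [Finset.mul_sum]
    refine Finset.sum_congr rfl fun a _ => ?_
    rw [zero_add, mul_assoc]
  have h4 : ∑ a ∈ Finset.range d, (1 / 2 * 4 ^ d : ℚ) * delayZ N (2 * d) (a :: (d - 1 - a) :: l)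
      = 1 / 2 * 4 ^ d * pairSum d (delayZ N (2 * d)) l := by
    rw [pairSum, Finset.mul_sum]
  rw [h3, h4]
  rw [h1] at he
  push_cast at he
  linear_combination 4 ^ d * hv - he + h2

/-- The weighted shifted function. -/
noncomputable def wshift (l : List ℕ) : PowerSeries ℚ := weight l * shiftSeries l

theorem Nop_weight_mul (d : ℕ) (f : List ℕ → PowerSeries ℚ) (l : List ℕ) :
    Nop d (fun l => weight l * f l) l
      = weight l * (PowerSeries.C (4 ^ d) * w ^ (2 * d) * Nop d f l) := by
  induction l generalizing f with
  | nil => simp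
  | cons e l ih =>
    have h1 : der e (fun l => weight l * f l) = weight [e] • fun l => weight l * der e f l := by
      funext l
      simp only [der, Pi.smul_apply, smul_eq_mul]
      rw [weight_cons, mul_assoc]
    have h2 : weight ((e + d) :: l)
        = weight [e] * weight l * (PowerSeries.C (4 ^ d) * w ^ (2 * d)) := by
      simp only [weight, List.sum_cons, List.sum_nil, X, pow_add, map_mul]
      simp
      ring
    rw [Nop_cons, Nop_cons, h1, Nop_smul, Pi.smul_apply, ih, h2, weight_cons e l]
    simp only [smul_eq_mul, nsmul_eq_mul]
    ring

theorem X_mul_D_weight (l : List ℕ) : w * D (weight l) = (X l : PowerSeries ℚ) * weight l := by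
  simp only [weight, Derivation.leibniz, PowerSeries.derivative_C, Derivation.leibniz_pow,
    PowerSeries.derivative_X]
  cases h : X l with
  | zero => simp
  | succ n =>
    simp only [smul_eq_mul, nsmul_eq_mul, mul_one, mul_zero, add_zero, Nat.add_sub_cancel]
    push_cast
    ring

theorem wshift_cons (d : ℕ) (l : List ℕ) :
    wshift (d :: l) = w ^ 2 * D (wshift l) - w * ((X l : PowerSeries ℚ) * wshift l)
      + w * (Nop d wshift l + 4 * ∑ a ∈ Finset.range d, wshift (a :: l)
        + 2 * pairSum d wshift l
        + PowerSeries.C (if d = 0 then 1 / 8 else 0) * wshift l) := by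
  have h := shiftSeries_cons d l
  have hN : Nop d wshift l
      = weight l * (PowerSeries.C (4 ^ d) * w ^ (2 * d) * Nop d shiftSeries l) :=
    Nop_weight_mul d shiftSeries l
  have hW := X_mul_D_weight l
  have w1 : ∀ a, weight [a] = PowerSeries.C (4 ^ a) * w ^ (2 * a + 1) := by
    intro a
    simp [weight, X]
  have hD : D (wshift l) = weight l * D (shiftSeries l) + shiftSeries l * D (weight l) := by
    rw [wshift, Derivation.leibniz]; rfl
  have hs1 : 4 * ∑ a ∈ Finset.range d, wshift (a :: l) = weight l * ∑ a ∈ Finset.range d,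
      PowerSeries.C (4 * 4 ^ a) * (w ^ (2 * a + 1) * shiftSeries (a :: l)) := by
    rw [Finset.mul_sum, Finset.mul_sum]
    refine Finset.sum_congr rfl fun a _ => ?_
    rw [wshift, weight_cons, w1, map_mul, show (PowerSeries.C (4 : ℚ)) = 4 from rfl]
    ring
  have hs2 : 2 * pairSum d wshift l = weight l * ∑ a ∈ Finset.range d,
      PowerSeries.C (1 / 2 * 4 ^ d) * (w ^ (2 * d) * shiftSeries (a :: (d - 1 - a) :: l)) := by
    rw [pairSum, Finset.mul_sum, Finset.mul_sum]
    refine Finset.sum_congr rfl fun a ha => ?_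
    rw [Finset.mem_range] at ha
    rw [wshift, weight_cons, weight_cons _ l, w1, w1]
    obtain ⟨b, rfl⟩ : ∃ b, d = a + b + 1 := ⟨d - 1 - a, by omega⟩
    rw [show a + b + 1 - 1 - a = b by omega]
    have : (1 / 2 * 4 ^ (a + b + 1) : ℚ) = 2 * (4 ^ a * 4 ^ b) := by ring
    rw [this, map_mul, map_mul, show (PowerSeries.C (2 : ℚ)) = 2 from rfl]
    ring
  have hc : wshift (d :: l) = w * weight l
      * (PowerSeries.C (4 ^ d) * (w ^ (2 * d) * shiftSeries (d :: l))) := by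
    rw [wshift, weight_cons, w1]
    ring
  rw [hc, h, hN, hs1, hs2, hD]
  have hw : wshift l = weight l * shiftSeries l := rfl
  rw [hw]
  linear_combination -(w * shiftSeries l) * hW

/-- The constant function `1`. -/
noncomputable def one : List ℕ → PowerSeries ℚ := fun _ => 1

theorem der_one (d : ℕ) : der d one = one := rfl

/-- The full amplitude. -/
noncomputable def amp : List ℕ → PowerSeries ℚ := shuf one wshift

theorem D_shuf (f g : List ℕ → PowerSeries ℚ) (l : List ℕ) :
    D (shuf f g l) = shuf (fun l => D (f l)) g l + shuf f (fun l => D (g l)) l := by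
  induction l generalizing f g with
  | nil => simp; ring
  | cons d l ih =>
    have h : ∀ f : List ℕ → PowerSeries ℚ, der d (fun l => D (f l)) = fun l => D (der d f l) :=
      fun _ => rfl
    rw [shuf_cons, map_add, ih, ih, shuf_cons, shuf_cons, h, h]
    ring

theorem X_mul_shuf (f g : List ℕ → PowerSeries ℚ) (l : List ℕ) :
    (X l : PowerSeries ℚ) * shuf f g l
      = shuf (fun l => (X l : PowerSeries ℚ) * f l) g l
        + shuf f (fun l => (X l : PowerSeries ℚ) * g l) l := by
  induction l generalizing f g with
  | nil => simp [X]
  | cons d l ih =>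
    have hd : ∀ f : List ℕ → PowerSeries ℚ, der d (fun l => (X l : PowerSeries ℚ) * f l)
        = (2 * d + 1 : PowerSeries ℚ) • der d f + fun l => (X l : PowerSeries ℚ) * der d f l := by
      intro f
      funext l
      simp only [der, Pi.add_apply, Pi.smul_apply, smul_eq_mul, X_cons]
      push_cast
      ring
    rw [shuf_cons, shuf_cons, shuf_cons, hd, hd, add_shuf, shuf_add, smul_shuf, shuf_smul]
    have h1 := ih (der d f) g
    have h2 := ih f (der d g)
    simp only [Pi.add_apply, Pi.smul_apply, smul_eq_mul, X_cons]
    push_cast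
    linear_combination h1 + h2

theorem Nop_one (d : ℕ) (l : List ℕ) : Nop d one l = (X l : PowerSeries ℚ) := by
  induction l with
  | nil => simp [X]
  | cons e l ih =>
    rw [Nop_cons, der_one, ih, X_cons]
    simp [one]

/-- Summing over sublists absorbs the single sums of `wshift_cons` into the pair term, at the price
of the constant 2d. The result is formally the recursion `nZ_cons`: 1 + w² D re-expands from x-1 to
x, and w stands for 1/(x-1). -/
theorem amp_cons (d : ℕ) (l : List ℕ) :
    amp (d :: l) = amp l + w ^ 2 * D (amp l)
      + w * (Nop d amp l + 2 * pairSum d amp l + PowerSeries.C (if d = 0 then 1 / 8 else 0) * amp l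
        - ((X l : PowerSeries ℚ) + 2 * (d : PowerSeries ℚ)) * amp l) := by
  have hz : der d wshift = w ^ 2 • (fun l => D (wshift l))
      - w • (fun l => (X l : PowerSeries ℚ) * wshift l)
      + w • (Nop d wshift + (4 : PowerSeries ℚ) • ∑ a ∈ Finset.range d, der a wshift
        + (2 : PowerSeries ℚ) • pairSum d wshift
        + PowerSeries.C (if d = 0 then (1 / 8 : ℚ) else 0) • wshift) := by
    funext l
    refine (wshift_cons d l).trans ?_
    simp only [Pi.add_apply, Pi.sub_apply, Pi.smul_apply, smul_eq_mul, Finset.sum_apply]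
    rfl
  have hc : amp (d :: l) = amp l + shuf one (der d wshift) l := by
    rw [amp, shuf_cons, der_one]
  have hD : D (amp l) = shuf one (fun l => D (wshift l)) l := by
    have h0 : (fun l => D (one l)) = 0 := by
      funext l
      simp [one]
    rw [amp, D_shuf, h0, zero_shuf, Pi.zero_apply, zero_add]
  have hX := X_mul_shuf one wshift l
  have hN : Nop d amp l = shuf (fun l => (X l : PowerSeries ℚ) * one l) wshift l
      + shuf one (Nop d wshift) l := by
    rw [amp, Nop_shuf, Pi.add_apply]
    congr 2
    funext l
    rw [Nop_one]; simp [one]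
  have hP : pairSum d amp l = d * amp l + 2 * ∑ a ∈ Finset.range d, shuf one (der a wshift) l
      + shuf one (pairSum d wshift) l := by
    have h1 : ∀ a, amp (a :: (d - 1 - a) :: l) = amp l + shuf one (der a wshift) l
        + shuf one (der (d - 1 - a) wshift) l
        + shuf one (der (d - 1 - a) (der a wshift)) l := by
      intro a
      rw [amp, shuf_cons, shuf_cons, shuf_cons, der_one, der_one]
      ring
    have h2 : pairSum d wshift = ∑ a ∈ Finset.range d, der (d - 1 - a) (der a wshift) := by
      funext l
      simp only [pairSum, Finset.sum_apply]
      rfl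
    rw [pairSum, Finset.sum_congr rfl fun a _ => h1 a, h2, shuf_sum, Finset.sum_apply]
    simp only [Finset.sum_add_distrib]
    rw [Finset.sum_range_reflect (fun a => shuf one (der a wshift) l) d]
    simp
    ring
  rw [hc, hz, hD, hN, hP]
  simp only [shuf_add, shuf_sub, shuf_smul, shuf_sum, Pi.add_apply, Pi.sub_apply, Pi.smul_apply,
    smul_eq_mul, Finset.sum_apply]
  have ha : amp l = shuf one wshift l := rfl
  rw [ha]
  linear_combination w * hX

/-- The amplitude attached to a subset of insertions, in the connected normalization. -/
noncomputable def conn : List ℕ → PowerSeries ℚ :=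
  shuf wshift fun l => weight l * PowerSeries.C (Zinv l)

theorem weight_shuf (f g : List ℕ → PowerSeries ℚ) (l : List ℕ) :
    shuf (fun l => weight l * f l) (fun l => weight l * g l) l = weight l * shuf f g l := by
  induction l generalizing f g with
  | nil => simp [weight, X]
  | cons d l ih =>
    have h1 : ∀ f : List ℕ → PowerSeries ℚ,
        der d (fun l => weight l * f l) = weight [d] • fun l => weight l * der d f l := by
      intro f
      funext l
      simp only [der, Pi.smul_apply, smul_eq_mul]
      rw [weight_cons, mul_assoc]
    rw [shuf_cons, h1, h1, smul_shuf, shuf_smul, Pi.smul_apply, Pi.smul_apply, ih, ih, shuf_cons,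
      weight_cons d l]
    simp only [smul_eq_mul]
    ring

theorem map_shuf {K K' : Type*} [CommRing K] [CommRing K'] (F : K →+* K') (f g : List ℕ → K)
    (l : List ℕ) : shuf (fun l => F (f l)) (fun l => F (g l)) l = F (shuf f g l) := by
  induction l generalizing f g with
  | nil => simp
  | cons d l ih =>
    have h1 := ih (der d f) g
    have h2 := ih f (der d g)
    rw [shuf_cons, shuf_cons, map_add, ← h1, ← h2]
    rfl

/-- The weight factors out of the shuffle product. At w = 0 the shift disappears, leaving (Z ·
Z⁻¹)(l) = 0. This extra power of w is what makes the degree bound k-1 instead of k. -/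
theorem X_pow_dvd_conn {l : List ℕ} (hl : l ≠ []) : w ^ (X l + 1) ∣ conn l := by
  have h : conn l = weight l * shuf shiftSeries (fun l => PowerSeries.C (Zinv l)) l :=
    weight_shuf _ _ _
  have h0 : PowerSeries.constantCoeff (shuf shiftSeries (fun l => PowerSeries.C (Zinv l)) l)
      = 0 := by
    rw [← map_shuf (PowerSeries.constantCoeff (R := ℚ))]
    have e1 : (fun l => PowerSeries.constantCoeff (shiftSeries l)) = Z := by
      funext l
      simp [shiftSeries, shiftZ_zero]
    have e2 : (fun l => PowerSeries.constantCoeff (PowerSeries.C (Zinv l))) = Zinv := by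
      funext l
      simp
    rw [e1, e2, Z, Zinv, expo_shuf_expo_neg]
    cases l with
    | nil => exact absurd rfl hl
    | cons => rfl
  rw [h, pow_succ, weight]
  exact mul_dvd_mul (Dvd.intro_left _ rfl) (PowerSeries.X_dvd_iff.mpr h0)

theorem conn_nil : conn [] = shiftSeries [] := by
  simp [conn, wshift, weight, X, Zinv]

theorem amp_nil : amp [] = shiftSeries [] := by
  simp [amp, one, wshift, weight, X]

theorem sym_weight : Sym weight := by
  intro l l' hp
  rw [weight, weight, X_perm hp, hp.sum_eq]

theorem sym_conn : Sym conn := by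
  refine Sym.shuf ?_ ?_
  · intro l l' hp
    have : shiftSeries l = shiftSeries l' := by
      ext N
      simp [shiftSeries, sym_shiftZ N _ _ hp]
    rw [wshift, wshift, sym_weight _ _ hp, this]
  · intro l l' hp
    simp only
    rw [sym_weight _ _ hp, sym_Zinv _ _ hp]

end BGW

namespace BGW

/-! ### Inverse factorial expansions -/

/-- `Φ_k(x) = 1 / ((x - 1) ⋯ (x - k))`. -/
noncomputable def Phi (k : ℕ) (x : ℝ) : ℝ := ∏ i ∈ Finset.range k, (x - (i + 1))⁻¹

@[simp] theorem Phi_zero (x : ℝ) : Phi 0 x = 1 := by simp [Phi]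

theorem Phi_succ (k : ℕ) (x : ℝ) : Phi (k + 1) x = Phi k x * (x - (k + 1))⁻¹ := by
  rw [Phi, Finset.prod_range_succ, Phi]

theorem Phi_add (j k : ℕ) (x : ℝ) : Phi (j + k) x = Phi j x * Phi k (x - j) := by
  rw [Phi, Finset.prod_range_add, Phi, Phi]
  congr 1
  refine Finset.prod_congr rfl fun i _ => ?_
  push_cast
  congr 1
  ring

theorem Phi_sub_one (k : ℕ) {x : ℝ} (hx : (k : ℝ) + 1 < x) :
    Phi k (x - 1) = Phi k x + k * Phi (k + 1) x := by
  have hk : (0 : ℝ) ≤ k := Nat.cast_nonneg k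
  have h1 : x - 1 ≠ 0 := by intro h; linarith
  have h2 : x - (k + 1) ≠ 0 := by intro h; linarith
  have e1 : Phi (k + 1) x = (x - 1)⁻¹ * Phi k (x - 1) := by
    rw [add_comm k 1, Phi_add]
    simp [Phi]
  have e2 : Phi k (x - 1) = (x - 1) * Phi (k + 1) x := by
    rw [e1, mul_inv_cancel_left₀ h1]
  have e3 : Phi k x = (x - (k + 1)) * Phi (k + 1) x := by
    rw [Phi_succ]; field_simp
  rw [e2, e3]; ring

theorem tendsto_two_mul_add (x0 : ℕ) :
    Tendsto (fun m : ℕ => 2 * m + x0) atTop atTop :=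
  tendsto_atTop_mono (fun m => by simp only [id]; omega) tendsto_id

theorem inv_sub_isBigO (c : ℝ) :
    (fun x : ℕ => ((x : ℝ) - c)⁻¹) =O[atTop] fun x : ℕ => (x : ℝ)⁻¹ := by
  refine IsBigO.of_bound 2 ?_
  filter_upwards [eventually_gt_atTop 0, eventually_ge_atTop (⌈2 * |c|⌉₊ + 1)] with x h0 h1
  have hx : (0 : ℝ) < x := by exact_mod_cast h0
  have h2 : 2 * |c| ≤ x := (Nat.le_ceil _).trans (by exact_mod_cast (by omega))
  have h3 : c ≤ |c| := le_abs_self c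
  have h4 : (x : ℝ) / 2 ≤ x - c := by linarith
  rw [Real.norm_of_nonneg (inv_nonneg.mpr (by linarith)), Real.norm_of_nonneg (by positivity)]
  calc ((x : ℝ) - c)⁻¹ ≤ ((x : ℝ) / 2)⁻¹ := inv_anti₀ (by positivity) h4
    _ = 2 * (x : ℝ)⁻¹ := by field_simp

theorem Phi_isBigO (k : ℕ) :
    (fun x : ℕ => Phi k x) =O[atTop] fun x : ℕ => ((x : ℝ) ^ k)⁻¹ := by
  induction k with
  | zero => simpa using isBigO_refl (fun _ : ℕ => (1 : ℝ)) atTop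
  | succ k ih =>
    simp only [Phi_succ, pow_succ, mul_inv]
    exact ih.mul (inv_sub_isBigO _)

theorem inv_pow_isBigO {j k : ℕ} (h : j ≤ k) :
    (fun x : ℕ => ((x : ℝ) ^ k)⁻¹) =O[atTop] fun x : ℕ => ((x : ℝ) ^ j)⁻¹ := by
  refine IsBigO.of_bound 1 ?_
  filter_upwards [eventually_ge_atTop 1] with x hx
  have hx' : (1 : ℝ) ≤ x := by exact_mod_cast hx
  have : (0 : ℝ) < x := by linarith
  rw [one_mul, Real.norm_of_nonneg (by positivity), Real.norm_of_nonneg (by positivity)]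
  exact inv_anti₀ (by positivity) (pow_le_pow_right₀ hx' h)

theorem inv_pow_comp_isBigO (x0 k : ℕ) :
    (fun m : ℕ => (((2 * m + x0 : ℕ) : ℝ) ^ k)⁻¹) =O[atTop] fun m : ℕ => ((m : ℝ) ^ k)⁻¹ := by
  refine IsBigO.of_bound 1 ?_
  filter_upwards [eventually_ge_atTop 1] with m hm
  have hm' : (1 : ℝ) ≤ m := by exact_mod_cast hm
  have h0 : (0 : ℝ) ≤ x0 := Nat.cast_nonneg x0
  rw [one_mul, Real.norm_of_nonneg (by positivity), Real.norm_of_nonneg (by positivity)]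
  refine inv_anti₀ (by positivity) (pow_le_pow_left₀ (by positivity) ?_ k)
  push_cast
  linarith

theorem Phi_comp_isBigO (x0 k : ℕ) :
    (fun m : ℕ => Phi k (2 * m + x0)) =O[atTop] fun m : ℕ => ((m : ℝ) ^ k)⁻¹ := by
  have h := ((Phi_isBigO k).comp_tendsto (tendsto_two_mul_add x0)).trans (inv_pow_comp_isBigO x0 k)
  refine h.congr_left fun m => ?_
  simp

/-- `h(m)` has the expansion `∑ g_k Φ_k(2 m + x₀)` as `m → ∞`. -/
def InvFactExp (x0 : ℕ) (h : ℕ → ℝ) (g : PowerSeries ℚ) : Prop :=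
  ∀ L : ℕ, (fun m : ℕ => h m - ∑ k ∈ Finset.range L,
    ((PowerSeries.coeff k g : ℚ) : ℝ) * Phi k (2 * m + x0)) =O[atTop]
      fun m : ℕ => ((m : ℝ) ^ L)⁻¹

/-- It is enough to know the expansion to all sufficiently high orders. -/
theorem InvFactExp.of_high {x0 : ℕ} {h : ℕ → ℝ} {g : PowerSeries ℚ} (j : ℕ)
    (H : ∀ L : ℕ, (fun m : ℕ => h m - ∑ k ∈ Finset.range (L + j),
      ((PowerSeries.coeff k g : ℚ) : ℝ) * Phi k (2 * m + x0)) =O[atTop]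
        fun m : ℕ => ((m : ℝ) ^ L)⁻¹) : InvFactExp x0 h g := by
  intro L
  have h1 : (fun m : ℕ => ∑ i ∈ Finset.range j, ((PowerSeries.coeff (L + i) g : ℚ) : ℝ)
      * Phi (L + i) (2 * m + x0)) =O[atTop] fun m : ℕ => ((m : ℝ) ^ L)⁻¹ := by
    refine IsBigO.fun_sum fun i _ => IsBigO.const_mul_left ?_ _
    exact (Phi_comp_isBigO x0 (L + i)).trans (inv_pow_isBigO (by omega))
  refine ((H L).add h1).congr_left fun m => ?_
  rw [Finset.sum_range_add]
  ring

theorem InvFactExp.add {x0 : ℕ} {h h' : ℕ → ℝ} {g g' : PowerSeries ℚ}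
    (H : InvFactExp x0 h g) (H' : InvFactExp x0 h' g') :
    InvFactExp x0 (fun m => h m + h' m) (g + g') := by
  intro L
  refine ((H L).add (H' L)).congr_left fun m => ?_
  simp only [map_add, Rat.cast_add, add_mul, Finset.sum_add_distrib]
  ring

theorem InvFactExp.const_mul {x0 : ℕ} {h : ℕ → ℝ} {g : PowerSeries ℚ} (c : ℚ)
    (H : InvFactExp x0 h g) :
    InvFactExp x0 (fun m => (c : ℝ) * h m) (PowerSeries.C c * g) := by
  intro L
  refine ((H L).const_mul_left (c : ℝ)).congr_left fun m => ?_
  simp only [PowerSeries.coeff_C_mul, Rat.cast_mul, mul_sub, Finset.mul_sum, mul_assoc]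

theorem InvFactExp.zero (x0 : ℕ) : InvFactExp x0 (fun _ => 0) 0 := by
  intro L
  simpa using isBigO_zero _ _

theorem InvFactExp.sum {ι : Type*} (s : Finset ι) {x0 : ℕ} {h : ι → ℕ → ℝ}
    {g : ι → PowerSeries ℚ} (H : ∀ i ∈ s, InvFactExp x0 (h i) (g i)) :
    InvFactExp x0 (fun m => ∑ i ∈ s, h i m) (∑ i ∈ s, g i) := by
  classical
  induction s using Finset.induction_on with
  | empty => simpa using InvFactExp.zero x0
  | insert a s ha ih =>
    simp only [Finset.sum_insert ha]
    exact (H a (Finset.mem_insert_self a s)).add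
      (ih fun i hi => H i (Finset.mem_insert_of_mem hi))

theorem InvFactExp.congr' {x0 : ℕ} {h h' : ℕ → ℝ} {g : PowerSeries ℚ}
    (H : InvFactExp x0 h g) (e : h =ᶠ[atTop] h') : InvFactExp x0 h' g := by
  intro L
  refine (H L).congr' ?_ EventuallyEq.rfl
  filter_upwards [e] with m hm
  rw [hm]

theorem InvFactExp.shift_arg {x0 : ℕ} {h : ℕ → ℝ} {g : PowerSeries ℚ}
    (H : InvFactExp x0 h g) (d : ℕ) : InvFactExp (x0 + 2 * d) (fun m => h (m + d)) g := by
  intro L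
  have h1 := (H L).comp_tendsto (tendsto_add_atTop_nat d)
  have h2 : (fun m : ℕ => (((m + d : ℕ) : ℝ) ^ L)⁻¹) =O[atTop] fun m : ℕ => ((m : ℝ) ^ L)⁻¹ := by
    refine IsBigO.of_bound 1 ?_
    filter_upwards [eventually_ge_atTop 1] with m hm
    have hm' : (1 : ℝ) ≤ m := by exact_mod_cast hm
    rw [one_mul, Real.norm_of_nonneg (by positivity), Real.norm_of_nonneg (by positivity)]
    refine inv_anti₀ (by positivity) (pow_le_pow_left₀ (by positivity) ?_ L)
    exact_mod_cast Nat.le_add_right m d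
  refine (h1.trans h2).congr_left fun m => ?_
  simp only [Function.comp_apply]
  congr 1
  refine Finset.sum_congr rfl fun k _ => ?_
  congr 2
  push_cast
  ring

/-- Multiplication by `Φ_j`. -/
theorem InvFactExp.Phi_mul {x0 : ℕ} {h : ℕ → ℝ} {g : PowerSeries ℚ}
    (H : InvFactExp x0 h g) (j : ℕ) :
    InvFactExp (x0 + j) (fun m => Phi j (2 * m + (x0 + j : ℕ)) * h m)
      (PowerSeries.X ^ j * g) := by
  refine InvFactExp.of_high j fun L => ?_
  have h1 := (Phi_comp_isBigO (x0 + j) j).mul (H L)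
  refine (h1.congr_left fun m => ?_).trans
    ((isBigO_of_le atTop fun m => le_of_eq ?_).trans (inv_pow_isBigO (show L ≤ j + L by omega)))
  · rw [mul_sub, add_comm L j, Finset.sum_range_add, Finset.mul_sum]
    congr 1
    have h0 : ∑ k ∈ Finset.range j, ((PowerSeries.coeff k (PowerSeries.X ^ j * g) : ℚ) : ℝ)
        * Phi k (2 * m + (x0 + j : ℕ)) = 0 := by
      refine Finset.sum_eq_zero fun k hk => ?_
      rw [Finset.mem_range] at hk
      rw [PowerSeries.coeff_X_pow_mul', if_neg (by omega)]
      simp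
    rw [h0, zero_add]
    refine Finset.sum_congr rfl fun k _ => ?_
    rw [PowerSeries.coeff_X_pow_mul', if_pos (by omega), Nat.add_sub_cancel_left, Phi_add]
    rw [show 2 * (m : ℝ) + ((x0 + j : ℕ) : ℝ) - j = 2 * m + x0 by push_cast; ring]
    ring
  · rw [pow_add, mul_inv]

theorem coeff_add_sq_derivative (g : PowerSeries ℚ) (k : ℕ) :
    PowerSeries.coeff (k + 1) (g + PowerSeries.X ^ 2 * PowerSeries.derivative ℚ g)
      = PowerSeries.coeff (k + 1) g + k * PowerSeries.coeff k g := by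
  rw [map_add, PowerSeries.coeff_X_pow_mul']
  congr 1
  cases k with
  | zero => simp
  | succ k =>
    rw [if_pos (by omega), PowerSeries.coeff_derivative, show k + 1 + 1 - 2 = k by omega]
    push_cast
    ring

/-- Re-expansion with the argument increased by one. -/
theorem InvFactExp.shift_base {x0 : ℕ} {h : ℕ → ℝ} {g : PowerSeries ℚ}
    (H : InvFactExp x0 h g) :
    InvFactExp (x0 + 1) h (g + PowerSeries.X ^ 2 * PowerSeries.derivative ℚ g) := by
  refine InvFactExp.of_high 1 fun L => ?_
  -- Φ_k(x-1) = Φ_k(x) + k Φ_{k+1}(x) turns `g` into g + w² g'. Truncation at `L` leaves one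
  -- boundary term, of order `L`.
  have key : ∀ᶠ m : ℕ in atTop, ∑ k ∈ Finset.range (L + 1),
      ((PowerSeries.coeff k (g + PowerSeries.X ^ 2 * PowerSeries.derivative ℚ g) : ℚ) : ℝ)
        * Phi k (2 * m + (x0 + 1 : ℕ))
      = ∑ k ∈ Finset.range L, ((PowerSeries.coeff k g : ℚ) : ℝ) * Phi k (2 * m + x0)
        + ((PowerSeries.coeff L g : ℚ) : ℝ) * Phi L (2 * m + (x0 + 1 : ℕ)) := by
    filter_upwards [eventually_ge_atTop (L + 1)] with m hm
    have hP : ∀ k ∈ Finset.range L, Phi k (2 * (m : ℝ) + x0)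
        = Phi k (2 * m + (x0 + 1 : ℕ)) + k * Phi (k + 1) (2 * m + (x0 + 1 : ℕ)) := by
      intro k hk
      rw [Finset.mem_range] at hk
      have h1 : (k : ℝ) + 1 < 2 * m + (x0 + 1 : ℕ) := by
        exact_mod_cast (by omega : k + 1 < 2 * m + (x0 + 1))
      rw [← Phi_sub_one k h1]
      congr 1
      push_cast
      ring
    have hS : ∀ L : ℕ, ∑ k ∈ Finset.range L, ((PowerSeries.coeff k g : ℚ) : ℝ)
          * (Phi k (2 * (m : ℝ) + (x0 + 1 : ℕ)) + k * Phi (k + 1) (2 * m + (x0 + 1 : ℕ)))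
        + ((PowerSeries.coeff L g : ℚ) : ℝ) * Phi L (2 * m + (x0 + 1 : ℕ))
        = ∑ k ∈ Finset.range (L + 1),
          ((PowerSeries.coeff k (g + PowerSeries.X ^ 2 * PowerSeries.derivative ℚ g) : ℚ) : ℝ)
            * Phi k (2 * m + (x0 + 1 : ℕ)) := by
      intro L
      induction L with
      | zero => simp [PowerSeries.coeff_X_pow_mul']
      | succ L ih =>
        rw [Finset.sum_range_succ _ (L + 1), ← ih, Finset.sum_range_succ,
          coeff_add_sq_derivative]
        push_cast
        ring
    rw [← hS, Finset.sum_congr rfl fun k hk => by rw [← hP k hk]]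
  have h1 := (Phi_comp_isBigO (x0 + 1) L).const_mul_left ((PowerSeries.coeff L g : ℚ) : ℝ)
  refine ((H L).sub h1).congr' ?_ EventuallyEq.rfl
  filter_upwards [key] with m hm
  rw [hm]
  ring

theorem InvFactExp.Nop {x0 d : ℕ} {f : List ℕ → ℕ → ℝ} {g : List ℕ → PowerSeries ℚ}
    {l : List ℕ} (H : ∀ l', X l' = X l + 2 * d → InvFactExp x0 (f l') (g l')) :
    InvFactExp x0 (BGW.Nop d f l) (BGW.Nop d g l) := by
  induction l generalizing f g with
  | nil => exact InvFactExp.zero x0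
  | cons e l ih =>
    have h1 := (H ((e + d) :: l) (by simp only [X_cons]; ring)).const_mul ((2 * e + 1 : ℕ) : ℚ)
    have h2 := ih (f := der e f) (g := der e g) fun l' hl' =>
      H (e :: l') (by simp only [X_cons, hl']; ring)
    have h3 := h1.add h2
    rw [Nop_cons, Nop_cons, nsmul_eq_mul _ (g _)]
    rw [map_natCast] at h3
    refine h3.congr' (Eventually.of_forall fun m => ?_)
    rw [Pi.add_apply, Pi.smul_apply, nsmul_eq_mul, Rat.cast_natCast]

end BGW

namespace BGW

/-! ### The function `γ` -/

theorem gam_pos {x : ℝ} (hx : -1 < x) : 0 < gam x := by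
  have h1 := Real.Gamma_pos_of_pos (show 0 < x / 2 + 1 by linarith)
  have h2 := Real.Gamma_pos_of_pos (show 0 < (x + 1) / 2 by linarith)
  have h3 := Real.Gamma_pos_of_pos (show 0 < (x + 3) / 2 by linarith)
  have := Real.pi_pos
  unfold gam
  positivity

theorem gam_rec {x : ℝ} (hx : 1 < x) : (x ^ 2 - 1) * gam x = x ^ 2 * gam (x - 2) := by
  have g1 : Real.Gamma (x / 2 + 1) = x / 2 * Real.Gamma (x / 2) :=
    Real.Gamma_add_one (by linarith)
  have g2 : Real.Gamma ((x + 1) / 2) = (x - 1) / 2 * Real.Gamma ((x - 1) / 2) := by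
    rw [← Real.Gamma_add_one (by linarith)]; congr 1; ring
  have g3 : Real.Gamma ((x + 3) / 2) = (x + 1) / 2 * Real.Gamma ((x + 1) / 2) := by
    rw [← Real.Gamma_add_one (by linarith)]; congr 1; ring
  have p1 := (Real.Gamma_pos_of_pos (show 0 < (x - 1) / 2 by linarith)).ne'
  have p2 := (Real.Gamma_pos_of_pos (show 0 < (x + 1) / 2 by linarith)).ne'
  have p3 := Real.pi_pos.ne'
  have p4 : x - 1 ≠ 0 := by linarith
  have p5 : x + 1 ≠ 0 := by linarith
  unfold gam
  rw [show (x - 2) / 2 + 1 = x / 2 by ring, show (x - 2 + 1) / 2 = (x - 1) / 2 by ring,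
    show (x - 2 + 3) / 2 = (x + 1) / 2 by ring, g1, g3]
  rw [g2] at p2 ⊢
  field_simp
  ring

theorem pi_gam_mul {x : ℝ} (hx : 0 < x) :
    (Real.pi * gam x) * (Real.pi * gam (x - 1)) = x / (x + 1) := by
  have g1 : Real.Gamma (x / 2 + 1) = x / 2 * Real.Gamma (x / 2) :=
    Real.Gamma_add_one (by linarith)
  have g3 : Real.Gamma ((x + 3) / 2) = (x + 1) / 2 * Real.Gamma ((x + 1) / 2) := by
    rw [← Real.Gamma_add_one (by linarith)]; congr 1; ring
  have p1 := (Real.Gamma_pos_of_pos (show 0 < x / 2 by linarith)).ne'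
  have p2 := (Real.Gamma_pos_of_pos (show 0 < (x + 1) / 2 by linarith)).ne'
  have p3 := Real.pi_pos.ne'
  have p5 : x + 1 ≠ 0 := by linarith
  unfold gam
  rw [show (x - 1) / 2 + 1 = (x + 1) / 2 by ring, show (x - 1 + 1) / 2 = x / 2 by ring,
    show (x - 1 + 3) / 2 = x / 2 + 1 by ring, g1, g3]
  field_simp

/-- Log-convexity of Γ at the midpoint x/2 + 1 of (x+1)/2 and (x+3)/2. -/
theorem pi_gam_le_one {x : ℝ} (hx : -1 < x) : Real.pi * gam x ≤ 1 := by
  have h2 := Real.Gamma_pos_of_pos (show 0 < (x + 1) / 2 by linarith)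
  have h3 := Real.Gamma_pos_of_pos (show 0 < (x + 3) / 2 by linarith)
  have h1 := Real.Gamma_pos_of_pos (show 0 < x / 2 + 1 by linarith)
  have hc := Real.Gamma_mul_add_mul_le_rpow_Gamma_mul_rpow_Gamma
    (show 0 < (x + 1) / 2 by linarith) (show 0 < (x + 3) / 2 by linarith)
    (show (0 : ℝ) < 1 / 2 by norm_num) (show (0 : ℝ) < 1 / 2 by norm_num) (by norm_num)
  rw [show 1 / 2 * ((x + 1) / 2) + 1 / 2 * ((x + 3) / 2) = x / 2 + 1 by ring,
    ← Real.mul_rpow h2.le h3.le, ← Real.sqrt_eq_rpow] at hc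
  have hsq : Real.Gamma (x / 2 + 1) ^ 2
      ≤ Real.Gamma ((x + 1) / 2) * Real.Gamma ((x + 3) / 2) := by
    rw [← Real.sq_sqrt (mul_pos h2 h3).le]
    exact pow_le_pow_left₀ h1.le hc 2
  have p3 := Real.pi_pos
  unfold gam
  rw [mul_div_assoc', div_le_one (by positivity)]
  nlinarith

/-- The product formula `pi_gam_mul` converts the upper bound at x-1 into a lower bound at x. -/
theorem le_pi_gam {x : ℝ} (hx : 0 < x) : x / (x + 1) ≤ Real.pi * gam x := by
  rw [← pi_gam_mul hx]
  have h1 := pi_gam_le_one (show -1 < x - 1 by linarith)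
  have h2 : 0 < Real.pi * gam x := mul_pos Real.pi_pos (gam_pos (by linarith))
  nlinarith

theorem tendsto_pi_gam : Tendsto (fun x : ℕ => Real.pi * gam x) atTop (nhds 1) := by
  have h1 : Tendsto (fun x : ℕ => (x : ℝ) / (x + 1)) atTop (nhds 1) :=
    tendsto_natCast_div_add_atTop 1
  refine tendsto_of_tendsto_of_tendsto_of_le_of_le' h1 tendsto_const_nhds ?_ ?_
  · filter_upwards [eventually_gt_atTop 0] with x hx
    exact le_pi_gam (by exact_mod_cast hx)
  · filter_upwards with x
    exact pi_gam_le_one (by linarith [(Nat.cast_nonneg x : (0 : ℝ) ≤ x)])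

/-! ### The inverse factorial expansion of πγ. -/

theorem isBigO_of_two_step_diff {f : ℕ → ℝ} (hf : Tendsto f atTop (nhds 0)) {L : ℕ} (hL : 1 ≤ L)
    (h : (fun x : ℕ => f (x + 2) - f x) =O[atTop] fun x : ℕ => ((x : ℝ) ^ (L + 1))⁻¹) :
    f =O[atTop] fun x : ℕ => ((x : ℝ) ^ L)⁻¹ := by
  obtain ⟨c, hc, hb⟩ := h.exists_pos
  rw [IsBigOWith_def, eventually_atTop] at hb
  obtain ⟨N, hN⟩ := hb
  -- A majorant whose two-step decrements dominate those of `f`; telescoping to infinity, where `f`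
  -- vanishes, gives |f| ≤ b. The factor 2 comes from 1/x ≤ 4/(x+2) for x ≥ 1.
  set b : ℕ → ℝ := fun x => 2 * c * ((x : ℝ) ^ L)⁻¹ with hbdef
  have step : ∀ x : ℕ, N + 1 ≤ x → |f (x + 2) - f x| ≤ b x - b (x + 2) := by
    intro x hx
    have h1 := hN x (by omega)
    have hx1 : (1 : ℝ) ≤ x := by exact_mod_cast (by omega : 1 ≤ x)
    have hx0 : (0 : ℝ) < x := by linarith
    rw [Real.norm_eq_abs, Real.norm_of_nonneg (by positivity)] at h1
    refine h1.trans ?_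
    have hq : ((x : ℝ) / (x + 2)) ^ L ≤ (x : ℝ) / (x + 2) := by
      refine pow_le_of_le_one (by positivity) ?_ (by omega)
      rw [div_le_one (by positivity)]; linarith
    have e1 : b x - b (x + 2) = 2 * c * ((x : ℝ) ^ L)⁻¹ * (1 - ((x : ℝ) / (x + 2)) ^ L) := by
      simp only [hbdef]
      push_cast
      rw [div_pow]
      field_simp
    have e2 : (x : ℝ)⁻¹ ≤ 2 * (1 - (x : ℝ) / (x + 2)) := by
      rw [show 2 * (1 - (x : ℝ) / (x + 2)) = 4 / (x + 2) by field_simp; ring,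
        inv_eq_one_div, div_le_div_iff₀ hx0 (by positivity)]
      linarith
    rw [e1, pow_succ, mul_inv]
    have e3 : 0 < c * ((x : ℝ) ^ L)⁻¹ := by positivity
    nlinarith
  have bound : ∀ x : ℕ, N + 1 ≤ x → |f x| ≤ b x := by
    intro x hx
    have hj : ∀ j : ℕ, |f x| ≤ |f (x + 2 * j)| + b x := by
      intro j
      have h2 : |f x| ≤ |f (x + 2 * j)| + b x - b (x + 2 * j) := by
        induction j with
        | zero => simp
        | succ j ih =>
          have h3 := step (x + 2 * j) (by omega)
          have h4 : |f (x + 2 * j)| ≤ |f (x + 2 * j + 2)| + |f (x + 2 * j + 2) - f (x + 2 * j)| := by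
            have := abs_sub_abs_le_abs_sub (f (x + 2 * j)) (f (x + 2 * j + 2))
            rw [abs_sub_comm] at this
            linarith
          rw [show x + 2 * (j + 1) = x + 2 * j + 2 by ring]
          linarith
      have h5 : 0 ≤ b (x + 2 * j) := by
        simp only [hbdef]; positivity
      linarith
    have ht : Tendsto (fun j : ℕ => |f (x + 2 * j)| + b x) atTop (nhds (0 + b x)) := by
      refine Tendsto.add_const _ ?_
      have h6 : Tendsto (fun j : ℕ => x + 2 * j) atTop atTop :=
        tendsto_atTop_mono (fun m => by simp only [id]; omega) tendsto_id
      simpa using (hf.comp h6).abs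
    rw [zero_add] at ht
    exact ge_of_tendsto' ht hj
  refine IsBigO.of_bound (2 * c) ?_
  filter_upwards [eventually_ge_atTop (N + 1)] with x hx
  rw [Real.norm_eq_abs, Real.norm_of_nonneg (by positivity)]
  exact bound x hx

/-- The operator on the left annihilates γ by `gam_rec`. On the Φ_k it acts with exactly the
coefficients of `shiftZ_nil_rec`. -/
theorem Phi_three_term (k : ℕ) {x : ℝ} (hx : (k : ℝ) + 2 < x) :
    (x + 1) * Phi k x - x ^ 2 / (x - 1) * Phi k (x - 2)
      = -(2 * k * Phi k x + (3 * (k : ℝ) ^ 2 + 5 * k + 1) * Phi (k + 1) x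
        + k * (k + 2) ^ 2 * Phi (k + 2) x) := by
  have hk : (0 : ℝ) ≤ k := Nat.cast_nonneg k
  have h1 : x - 1 ≠ 0 := by intro h; linarith
  have h2 : x - (k + 1) ≠ 0 := by intro h; linarith
  have h3 : x - ((k + 1 : ℕ) + 1) ≠ 0 := by push_cast; intro h; linarith
  have e1 : Phi k (x - 2) = Phi k x + 2 * k * Phi (k + 1) x + k * (k + 1) * Phi (k + 2) x := by
    rw [show x - 2 = x - 1 - 1 by ring, Phi_sub_one k (by linarith), Phi_sub_one k (by linarith),
      Phi_sub_one (k + 1) (by push_cast; linarith)]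
    push_cast
    ring
  have e2 : Phi (k + 1) x = (x - ((k + 1 : ℕ) + 1)) * Phi (k + 2) x := by
    rw [Phi_succ (k + 1)]; field_simp
  have e3 : Phi k x = (x - (k + 1)) * ((x - ((k + 1 : ℕ) + 1)) * Phi (k + 2) x) := by
    rw [← e2, Phi_succ k]; field_simp
  rw [e1, e3, e2]
  push_cast
  field_simp
  ring

/-- Truncated inverse factorial series of the shifted function without insertions. -/
noncomputable def truncNil (L : ℕ) (x : ℝ) : ℝ :=
  ∑ k ∈ Finset.range L, (shiftZ k [] : ℝ) * Phi k x

/-- The recurrence cancels all interior terms, so the truncated series solves the equation of γ up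
to two boundary terms. -/
theorem truncNil_residual (n : ℕ) {x : ℝ} (hx : (n : ℝ) + 3 < x) :
    (x + 1) * truncNil (n + 1) x - x ^ 2 / (x - 1) * truncNil (n + 1) (x - 2)
      = 2 * (n + 1) * (shiftZ (n + 1) [] : ℝ) * Phi (n + 1) x
        - n * (n + 2) ^ 2 * (shiftZ n [] : ℝ) * Phi (n + 2) x := by
  induction n with
  | zero =>
    have h := Phi_three_term 0 (x := x) (by push_cast at hx ⊢; linarith)
    have h0 : ((shiftZ 0 [] : ℚ) : ℝ) = 1 := by rw [shiftZ_zero, Z_nil]; norm_num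
    have h1 : ((shiftZ 1 [] : ℚ) : ℝ) = -1 / 2 := by rw [shiftZ_one_nil]; norm_num
    simp only [truncNil, Finset.sum_range_one, h0, h1, zero_add]
    simp only [Nat.cast_zero, zero_add] at h ⊢
    linear_combination h
  | succ n ih =>
    have ih' := ih (by push_cast at hx ⊢; linarith)
    have h := Phi_three_term (n + 1) (x := x) (by push_cast at hx ⊢; linarith)
    have hr : ((2 * ((n : ℚ) + 2) * shiftZ (n + 2) [] + (3 * ((n : ℚ) + 1) ^ 2 + 5 * (n + 1) + 1)
      * shiftZ (n + 1) [] + n * (n + 2) ^ 2 * shiftZ n [] : ℚ) : ℝ) = 0 := by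
      rw [shiftZ_nil_rec]; norm_num
    have es : ∀ y, truncNil (n + 1 + 1) y
        = truncNil (n + 1) y + (shiftZ (n + 1) [] : ℝ) * Phi (n + 1) y := by
      intro y
      rw [truncNil, Finset.sum_range_succ, truncNil]
    rw [es, es]
    push_cast at h hr ⊢
    rw [show n + 1 + 1 = n + 2 by ring] at h ⊢
    linear_combination ih' + (shiftZ (n + 1) [] : ℝ) * h - Phi (n + 2) x * hr

theorem tendsto_truncNil (n : ℕ) :
    Tendsto (fun x : ℕ => truncNil (n + 1) x) atTop (nhds 1) := by
  have h : ∀ k ∈ Finset.range n, Tendsto (fun x : ℕ => (shiftZ (k + 1) [] : ℝ) * Phi (k + 1) x)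
      atTop (nhds 0) := by
    intro k _
    have h1 : Tendsto (fun x : ℕ => ((x : ℝ) ^ (k + 1))⁻¹) atTop (nhds 0) :=
      tendsto_inv_atTop_zero.comp
        ((tendsto_pow_atTop (by omega)).comp tendsto_natCast_atTop_atTop)
    simpa using ((Phi_isBigO (k + 1)).trans_tendsto h1).const_mul (shiftZ (k + 1) [] : ℝ)
  have h2 := (tendsto_finsetSum _ h).add_const (1 : ℝ)
  rw [Finset.sum_const_zero, zero_add] at h2
  refine h2.congr fun x => ?_
  rw [truncNil, Finset.sum_range_succ', Phi_zero, shiftZ_zero, Z_nil]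
  simp

/-- The quotient of the truncation by πγ tends to 1. Since πγ solves the homogeneous equation, the
two-step differences of the quotient are residuals divided by (x+1) πγ(x), one order smaller than
the residual, and they telescope. -/
theorem pi_gam_sub_truncNil_isBigO (L : ℕ) :
    (fun x : ℕ => Real.pi * gam x - truncNil L x) =O[atTop] fun x : ℕ => ((x : ℝ) ^ L)⁻¹ := by
  cases L with
  | zero =>
    simp only [truncNil, Finset.range_zero, Finset.sum_empty, sub_zero, pow_zero, inv_one]
    exact tendsto_pi_gam.isBigO_one ℝ
  | succ n =>
    set u : ℕ → ℝ := fun x => Real.pi * gam x with hu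
    have hupos : ∀ x, 0 < u x := fun x => mul_pos Real.pi_pos
      (gam_pos (by linarith [(Nat.cast_nonneg x : (0 : ℝ) ≤ x)]))
    set f : ℕ → ℝ := fun x => 1 - truncNil (n + 1) x / u x with hf
    have hf0 : Tendsto f atTop (nhds 0) := by
      have := ((tendsto_truncNil n).div tendsto_pi_gam one_ne_zero).const_sub 1
      simpa using this
    have hres : (fun x : ℕ => 2 * (n + 1) * (shiftZ (n + 1) [] : ℝ) * Phi (n + 1) x
        - n * (n + 2) ^ 2 * (shiftZ n [] : ℝ) * Phi (n + 2) x) =O[atTop]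
          fun x : ℕ => ((x : ℝ) ^ (n + 1))⁻¹ :=
      ((Phi_isBigO (n + 1)).const_mul_left _).sub
        (((Phi_isBigO (n + 2)).trans (inv_pow_isBigO (by omega))).const_mul_left _)
    have huinv : (fun x : ℕ => (u x)⁻¹) =O[atTop] fun _ : ℕ => (1 : ℝ) :=
      (tendsto_pi_gam.inv₀ one_ne_zero).isBigO_one ℝ
    have hdiff : (fun x : ℕ => f (x + 2) - f x) =O[atTop]
        fun x : ℕ => ((x : ℝ) ^ (n + 1 + 1))⁻¹ := by
      have h1 := (hres.mul ((inv_sub_isBigO (-1)).mul huinv)).neg_left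
      have h2 := h1.comp_tendsto (tendsto_add_atTop_nat 2)
      have h3 : (fun x : ℕ => (((x + 2 : ℕ) : ℝ) ^ (n + 1))⁻¹ * (((x + 2 : ℕ) : ℝ)⁻¹ * 1))
          =O[atTop] fun x : ℕ => ((x : ℝ) ^ (n + 1 + 1))⁻¹ := by
        refine IsBigO.of_bound 1 ?_
        filter_upwards [eventually_ge_atTop 1] with m hm
        have hm' : (1 : ℝ) ≤ m := by exact_mod_cast hm
        rw [one_mul, mul_one, ← mul_inv, ← pow_succ, Real.norm_of_nonneg (by positivity),
          Real.norm_of_nonneg (by positivity)]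
        refine inv_anti₀ (by positivity) (pow_le_pow_left₀ (by positivity) ?_ _)
        push_cast; linarith
      refine (h2.trans h3).congr' ?_ EventuallyEq.rfl
      filter_upwards [eventually_ge_atTop (n + 3)] with x hx
      have hx' : (n : ℝ) + 3 ≤ x := by exact_mod_cast hx
      have hn : (0 : ℝ) ≤ n := Nat.cast_nonneg n
      have hr := truncNil_residual n (x := ((x + 2 : ℕ) : ℝ)) (by push_cast; linarith)
      have hg := gam_rec (x := ((x + 2 : ℕ) : ℝ)) (by push_cast; linarith)
      simp only [Function.comp_apply, hf]
      rw [← hr]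
      have e0 : ((x + 2 : ℕ) : ℝ) - 2 = x := by push_cast; ring
      rw [e0] at hg ⊢
      have hx2 : ((x + 2 : ℕ) : ℝ) = x + 2 := by push_cast; ring
      have hu2 : u (x + 2) = (x + 2 : ℝ) ^ 2 / ((x + 2 : ℝ) ^ 2 - 1) * u x := by
        have : (x + 2 : ℝ) ^ 2 - 1 ≠ 0 := by nlinarith
        simp only [hu]
        rw [hx2] at hg ⊢
        field_simp
        linear_combination hg
      rw [hu2, hx2]
      have q0 := (hupos x).ne'
      have q1 : (x + 2 : ℝ) ^ 2 - 1 = (x + 1) * (x + 3) := by ring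
      have q2 : (x + 2 : ℝ) - 1 = x + 1 := by ring
      have q3 : (x + 2 : ℝ) - -1 = x + 3 := by ring
      rw [q1, q2, q3]
      have q4 : (x : ℝ) + 1 ≠ 0 := by linarith
      have q5 : (x : ℝ) + 3 ≠ 0 := by linarith
      have q6 : (x : ℝ) + 2 ≠ 0 := by linarith
      field_simp
      ring
    have hfO := isBigO_of_two_step_diff hf0 (by omega) hdiff
    have := (tendsto_pi_gam.isBigO_one ℝ).mul hfO
    simp only [one_mul] at this
    refine this.congr_left fun x => ?_
    have q0 := (hupos x).ne'
    simp only [hf]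
    change u x * _ = u x - _
    field_simp

/-- The expansion of `π γ`. -/
theorem invFactExp_gam (x0 : ℕ) :
    InvFactExp x0 (fun m => Real.pi * gam (2 * m + x0)) (shiftSeries []) := by
  intro L
  have h := ((pi_gam_sub_truncNil_isBigO L).comp_tendsto (tendsto_two_mul_add x0)).trans
    (inv_pow_comp_isBigO x0 L)
  refine h.congr_left fun m => ?_
  simp [truncNil, shiftSeries]

end BGW

namespace BGW

/-! ### Expansions of the normalized numbers -/

theorem X_eq_two_mul_sum_add_length (l : List ℕ) : X l = 2 * l.sum + l.length := by
  induction l with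
  | nil => rfl
  | cons d l ih => rw [X_cons, ih, List.sum_cons, List.length_cons]; ring

theorem X_append_singleton (l : List ℕ) (m : ℕ) : X (l ++ [m]) = X l + 2 * m + 1 := by
  simp [X]; ring

/-- The normalization factor of a correlator with insertions `l` and `m`. -/
noncomputable def normFactor (s x m : ℕ) : ℝ := 2 * 4 ^ (s + m) / ((x + 2 * m)! : ℕ)

/-- Normalized disconnected numbers. -/
noncomputable def nZ (l : List ℕ) (m : ℕ) : ℝ :=
  normFactor l.sum (X l) m * (Z (l ++ [m]) : ℝ)

theorem nZ_cons (d : ℕ) (l : List ℕ) (m : ℕ) :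
    ((X l + 2 * d + 1 + 2 * m : ℕ) : ℝ) * nZ (d :: l) m
      = Nop d nZ l m + (2 * m + 1) * nZ l (m + d) + 2 * pairSum d nZ l m
        + (if d = 0 then 1 / 8 else 0) * nZ l m := by
  set c : ℝ := normFactor (l.sum + d) (X l + 2 * d) m with hc
  have h1 : Nop d nZ l m = c * ((Nop d (rder m Z) l : ℚ) : ℝ) := by
    have e1 := Nop_map (Pi.evalAddMonoidHom (fun _ : ℕ => ℝ) m) d nZ l
    rw [Pi.evalAddMonoidHom_apply] at e1
    have e2 := Nop_map ((AddMonoidHom.mulLeft c).comp (Rat.castHom ℝ).toAddMonoidHom) d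
      (rder m Z) l
    refine e1.symm.trans (Eq.trans ?_ e2)
    refine Nop_congr fun l' hX hl => ?_
    have hs : l'.sum = l.sum + d := by
      have := X_eq_two_mul_sum_add_length l'
      have := X_eq_two_mul_sum_add_length l
      omega
    simp only [Pi.evalAddMonoidHom_apply, nZ, hX, hs]
    rfl
  have h2 : nZ l (m + d) = c * (Z (l ++ [m + d]) : ℝ) := by
    simp only [nZ, hc, normFactor]
    rw [show l.sum + (m + d) = l.sum + d + m by ring,
      show X l + 2 * (m + d) = X l + 2 * d + 2 * m by ring]
  have h3 : pairSum d nZ l m = 1 / 4 * c * ((pairSum d Z (l ++ [m]) : ℚ) : ℝ) := by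
    simp only [pairSum, Finset.sum_apply, Rat.cast_sum, Finset.mul_sum]
    refine Finset.sum_congr rfl fun a ha => ?_
    rw [Finset.mem_range] at ha
    simp only [nZ, hc, normFactor, List.sum_cons, X_cons, List.cons_append]
    rw [show 2 * a + 1 + (2 * (d - 1 - a) + 1 + X l) = X l + 2 * d by omega,
      show l.sum + d + m = a + (d - 1 - a + l.sum) + m + 1 by omega, pow_succ]
    ring
  have h4 : (if d = 0 then (1 / 8 : ℝ) else 0) * nZ l m
      = (if d = 0 then 1 / 8 else 0) * (c * (Z (l ++ [m]) : ℝ)) := by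
    split_ifs with h
    · subst h
      simp [nZ, hc]
    · simp
  have h5 : ((X l + 2 * d + 1 + 2 * m : ℕ) : ℝ) * nZ (d :: l) m
      = c * (Z (d :: (l ++ [m])) : ℝ) := by
    simp only [nZ, hc, normFactor, List.sum_cons, X_cons, List.cons_append]
    rw [show 2 * d + 1 + X l + 2 * m = (X l + 2 * d + 2 * m) + 1 by ring, Nat.factorial_succ,
      show X l + 2 * d + 1 + 2 * m = (X l + 2 * d + 2 * m) + 1 by ring, add_comm d l.sum]
    have hf : ((X l + 2 * d + 2 * m)! : ℝ) ≠ 0 := by positivity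
    have hg : ((X l + 2 * d + 2 * m + 1 : ℕ) : ℝ) ≠ 0 := by positivity
    push_cast at hg ⊢
    field_simp
  rw [h5, Z_cons, Nop_append_singleton, h1, h2, h3, h4]
  have hcast : (((if d = 0 then 1 / 8 else 0 : ℚ)) : ℝ) = if d = 0 then 1 / 8 else 0 := by
    split_ifs <;> norm_num
  simp only [nsmul_eq_mul, rder, Rat.cast_add, Rat.cast_mul, hcast]
  push_cast
  ring

theorem nZ_nil (m : ℕ) : nZ [] m = gam (2 * m + 1) := by
  induction m with
  | zero =>
    have h : Z [0] = 1 / 8 := by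
      rw [Z_cons]; simp [pairSum]
    have g1 : Real.Gamma (1 / 2 + 1) = 1 / 2 * Real.sqrt Real.pi := by
      rw [Real.Gamma_add_one (by norm_num), Real.Gamma_one_half_eq]
    have p := Real.pi_pos
    simp only [nZ, normFactor, gam, X, List.nil_append, h, Nat.cast_zero, mul_zero, zero_add, g1]
    norm_num
    rw [mul_pow, Real.sq_sqrt p.le]
    field_simp
    norm_num
  | succ m ih =>
    have hg := gam_rec (x := 2 * ((m + 1 : ℕ) : ℝ) + 1) 
      (by push_cast; linarith [(Nat.cast_nonneg m : (0 : ℝ) ≤ m)])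
    rw [show 2 * ((m + 1 : ℕ) : ℝ) + 1 - 2 = 2 * m + 1 by push_cast; ring, ← ih] at hg
    have hm : (0 : ℝ) ≤ m := Nat.cast_nonneg m
    have hne : (2 * ((m + 1 : ℕ) : ℝ) + 1) ^ 2 - 1 ≠ 0 := by push_cast; nlinarith
    refine mul_left_cancel₀ hne ?_
    rw [hg]
    have hr : ((8 * ((m : ℚ) + 2) * Z [m + 1] : ℚ) : ℝ)
        = (((2 * m + 1) * (2 * m + 3) ^ 2 * Z [m] : ℚ) : ℝ) := by
      rw [Z_singleton_rec]
    simp only [nZ, normFactor, X, List.nil_append, List.map_nil, List.sum_nil, zero_add]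
    rw [show 2 * (m + 1) = 2 * m + 1 + 1 by ring, Nat.factorial_succ, Nat.factorial_succ]
    have hf : ((2 * m)! : ℝ) ≠ 0 := by positivity
    push_cast at hr ⊢
    rw [pow_succ]
    field_simp
    linear_combination 2 * ((m : ℝ) + 1) * 4 ^ m * hr

/-- Induction on `X`. With x = 2m + X(l) + 2d + 2, the factor 2m+1 in `nZ_cons` is (x-1) -
(X(l)+2d). Dividing by x-1 then gives `amp_cons` term by term. -/
theorem invFactExp_nZ (l : List ℕ) :
    InvFactExp (X l + 1) (fun m => Real.pi * nZ l m) (amp l) := by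
  induction hn : X l using Nat.strong_induction_on generalizing l with
  | _ n IH =>
    subst hn
    cases l with
    | nil =>
      have h := invFactExp_gam 1
      rw [amp_nil]
      refine h.congr' (Eventually.of_forall fun m => ?_)
      simp [nZ_nil]
    | cons d l =>
      have hX : X (d :: l) = X l + 2 * d + 1 := by rw [X_cons]; ring
      have IH' : ∀ l', X l' = X l + 2 * d →
          InvFactExp (X l + 2 * d + 1) (fun m => Real.pi * nZ l' m) (amp l') := by
        intro l' h
        have := IH (X l') (by omega) l' rfl
        rwa [h] at this
      have hl : InvFactExp (X l + 2 * d + 1) (fun m => Real.pi * nZ l (m + d)) (amp l) := by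
        have := (IH (X l) (by omega) l rfl).shift_arg d
        rwa [show X l + 1 + 2 * d = X l + 2 * d + 1 by ring] at this
      have hN : InvFactExp (X l + 2 * d + 1) (fun m => Real.pi * Nop d nZ l m) (Nop d amp l) := by
        have h := InvFactExp.Nop (x0 := X l + 2 * d + 1) (d := d)
          (f := fun l m => Real.pi * nZ l m) (g := amp) (l := l) IH'
        refine h.congr' (Eventually.of_forall fun m => ?_)
        have e1 := Nop_map (AddMonoidHom.mulLeft (fun _ : ℕ => Real.pi)) d nZ l
        exact congrFun e1 m
      have hP : InvFactExp (X l + 2 * d + 1) (fun m => Real.pi * pairSum d nZ l m)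
          (pairSum d amp l) := by
        have h := InvFactExp.sum (Finset.range d) (x0 := X l + 2 * d + 1)
          (h := fun a m => Real.pi * nZ (a :: (d - 1 - a) :: l) m)
          (g := fun a => amp (a :: (d - 1 - a) :: l)) (fun a ha => IH' _ (by
            rw [Finset.mem_range] at ha
            simp only [X_cons]; omega))
        refine h.congr' (Eventually.of_forall fun m => ?_)
        simp only [pairSum, Finset.sum_apply, Finset.mul_sum]
      have hbr := ((hN.add (hP.const_mul 2)).add
        (hl.const_mul (if d = 0 then 1 / 8 else 0))).add
          (hl.const_mul (-((X l : ℚ) + 2 * d)))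
      have htot := hl.shift_base.add (hbr.Phi_mul 1)
      rw [hX]
      have e : amp (d :: l) = amp l + PowerSeries.X ^ 2 * PowerSeries.derivative ℚ (amp l)
          + PowerSeries.X ^ 1 * (Nop d amp l + PowerSeries.C 2 * pairSum d amp l
            + PowerSeries.C (if d = 0 then 1 / 8 else 0) * amp l
            + PowerSeries.C (-((X l : ℚ) + 2 * d)) * amp l) := by
        rw [amp_cons, map_neg, map_add, map_mul, map_natCast, map_natCast,
          show (PowerSeries.C (2 : ℚ)) = 2 from rfl]
        ring
      rw [e]
      refine htot.congr' ?_
      filter_upwards with m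
      have hr := nZ_cons d l m
      have hx : (2 * (m : ℝ) + ((X l + 2 * d + 1 + 1 : ℕ) : ℝ) - (0 + 1))
          = ((X l + 2 * d + 1 + 2 * m : ℕ) : ℝ) := by push_cast; ring
      have hx0 : ((X l + 2 * d + 1 + 2 * m : ℕ) : ℝ) ≠ 0 := by positivity
      have hδ : (if d = 0 then (1 / 8 : ℝ) else 0) * nZ l m
          = (if d = 0 then 1 / 8 else 0) * nZ l (m + d) := by
        split_ifs with h
        · subst h; simp
        · simp
      simp only [Phi, Finset.prod_range_one, Nat.cast_zero, hx]
      rw [hδ] at hr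
      have hcast : (((if d = 0 then 1 / 8 else 0 : ℚ)) : ℝ) = if d = 0 then 1 / 8 else 0 := by
        split_ifs <;> norm_num
      rw [hcast]
      rw [← mul_right_inj' hx0, mul_add, mul_inv_cancel_left₀ hx0]
      push_cast at hr ⊢
      linear_combination (-Real.pi) * hr

/-! ### From disconnected to connected numbers. -/

theorem Phi_eq_factorial_div (j n : ℕ) :
    Phi j ((n + j + 1 : ℕ) : ℝ) = (n ! : ℝ) / ((n + j)! : ℕ) := by
  induction j generalizing n with
  | zero => simp [Nat.factorial_ne_zero]
  | succ j ih =>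
    have h := ih (n + 1)
    rw [show n + 1 + j + 1 = n + (j + 1) + 1 by ring, show n + 1 + j = n + (j + 1) by ring] at h
    rw [Phi_succ, h, Nat.factorial_succ]
    rw [show ((n + (j + 1) + 1 : ℕ) : ℝ) - (j + 1) = n + 1 by push_cast; ring]
    have h1 : (n : ℝ) + 1 ≠ 0 := by positivity
    push_cast
    field_simp

/-- Transfer of expansions through a shuffle product with constants. -/
theorem invFactExp_shuf {x0 s0 : ℕ} {f : ℕ → List ℕ → ℚ} {g : List ℕ → PowerSeries ℚ}
    (q : List ℕ → ℚ) (l : List ℕ)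
    (H : ∀ l, InvFactExp (x0 + X l + 1)
      (fun m => Real.pi * (normFactor (s0 + l.sum) (x0 + X l) m * (f m l : ℝ))) (g l)) :
    InvFactExp (x0 + X l + 1)
      (fun m => Real.pi * (normFactor (s0 + l.sum) (x0 + X l) m * ((shuf (f m) q l : ℚ) : ℝ)))
      (shuf g (fun l => weight l * PowerSeries.C (q l)) l) := by
  -- `x0` and `s0` record what the entries already absorbed by `f` contribute to `X` and to the sum.
  induction l generalizing x0 s0 f g q with
  | nil =>
    have h := (H []).const_mul (q [])
    have e : shuf g (fun l => weight l * PowerSeries.C (q l)) [] = PowerSeries.C (q []) * g [] := by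
      simp [weight, X]; ring
    rw [e]
    refine h.congr' (Eventually.of_forall fun m => ?_)
    simp only [shuf_nil]
    push_cast
    ring
  | cons d l ih =>
    have hX : x0 + X (d :: l) = x0 + (2 * d + 1) + X l := by rw [X_cons]; ring
    have hS : s0 + (d :: l).sum = s0 + d + l.sum := by rw [List.sum_cons]; ring
    have h1 := ih (x0 := x0 + (2 * d + 1)) (s0 := s0 + d) (f := fun m => der d (f m))
      (g := der d g) q (fun l => by
        have h := H (d :: l)
        rw [X_cons, List.sum_cons, ← add_assoc x0, ← add_assoc s0] at h
        exact h)
    -- An entry `d` handed to the constant factor `q` still counts in the normalization. The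
    -- quotient of factorials is Φ_{2d+1}, so the expansion is multiplied by 4^d w^(2d+1), the
    -- weight of `[d]`.
    have h2 := ((ih (x0 := x0) (s0 := s0) (f := f) (g := g) (der d q) H).Phi_mul
      (2 * d + 1)).const_mul (4 ^ d)
    have hd : der d (fun l => weight l * PowerSeries.C (q l))
        = weight [d] • fun l => weight l * PowerSeries.C (der d q l) := by
      funext l
      simp only [der, Pi.smul_apply, smul_eq_mul]
      rw [weight_cons, mul_assoc]
    have e : shuf g (fun l => weight l * PowerSeries.C (q l)) (d :: l)
        = shuf (der d g) (fun l => weight l * PowerSeries.C (q l)) l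
          + PowerSeries.C (4 ^ d) * (PowerSeries.X ^ (2 * d + 1)
            * shuf g (fun l => weight l * PowerSeries.C (der d q l)) l) := by
      rw [shuf_cons, hd, shuf_smul, Pi.smul_apply, smul_eq_mul]
      simp [weight, X]
      ring
    rw [e, hX, hS]
    rw [show x0 + X l + 1 + (2 * d + 1) = x0 + (2 * d + 1) + X l + 1 by ring] at h2
    refine (h1.add h2).congr' (Eventually.of_forall fun m => ?_)
    simp only [shuf_cons]
    have hP := Phi_eq_factorial_div (2 * d + 1) (x0 + X l + 2 * m)
    rw [show ((x0 + X l + 2 * m + (2 * d + 1) + 1 : ℕ) : ℝ)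
      = 2 * (m : ℝ) + ((x0 + (2 * d + 1) + X l + 1 : ℕ) : ℝ) by push_cast; ring] at hP
    rw [hP]
    simp only [normFactor]
    rw [show x0 + X l + 2 * m + (2 * d + 1) = x0 + (2 * d + 1) + X l + 2 * m by ring]
    have hf1 : ((x0 + X l + 2 * m)! : ℝ) ≠ 0 := by positivity
    have hf2 : ((x0 + (2 * d + 1) + X l + 2 * m)! : ℝ) ≠ 0 := by positivity
    push_cast
    field_simp
    ring

theorem C_append_singleton (l : List ℕ) (m : ℕ) :
    (C (l ++ [m]) : ℝ) = normFactor l.sum (X l) m * (B (l ++ [m]) : ℝ) := by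
  have hp : (((l ++ [m]).map fun d => (2 * d + 1)‼).prod : ℚ) ≠ 0 := by
    have : ((l ++ [m]).map fun d => (2 * d + 1)‼).prod ≠ 0 := by
      rw [Ne, List.prod_eq_zero_iff]
      simp only [List.mem_map, not_exists, not_and]
      intro a _ h
      exact absurd h (Nat.doubleFactorial_pos _).ne'
    exact_mod_cast this
  have h1 : C (l ++ [m]) = 2 * 4 ^ (l.sum + m) / ((X l + 2 * m)! : ℕ) * B (l ++ [m]) := by
    rw [C, bgw, genus, X_append_singleton, Nat.add_sub_cancel,
      show 2 * ((l ++ [m]).sum + 1) - 1 = 2 * (l.sum + m) + 1 by simp; omega, pow_succ, pow_mul]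
    field_simp
    norm_num
    ring
  rw [h1, normFactor]
  push_cast
  ring

/-- Multiplying by `Zinv` on the numbers corresponds to multiplying `amp` by the weighted `Zinv`;
associativity regroups the product as `one` times `conn`. -/
theorem invFactExp_C (l : List ℕ) :
    InvFactExp (X l + 1) (fun m => Real.pi * (C (l ++ [m]) : ℝ)) (shuf one conn l) := by
  have h := invFactExp_shuf (x0 := 0) (s0 := 0) (f := fun m => rder m Z) (g := amp) Zinv l
    (fun l => by
      simp only [zero_add]
      exact invFactExp_nZ l)
  simp only [zero_add] at h
  rw [amp, shuf_assoc] at h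
  refine h.congr' (Eventually.of_forall fun m => ?_)
  simp only
  rw [← rder_B, C_append_singleton]
  rfl

end BGW

namespace BGW

/-! ### Expansions in powers of a small quantity -/

/-- `h ~ ∑ a_k t ^ k`. -/
def PowExp (t h : ℕ → ℝ) (a : PowerSeries ℚ) : Prop :=
  ∀ L : ℕ, (fun m => h m - ∑ k ∈ Finset.range L, ((PowerSeries.coeff k a : ℚ) : ℝ) * t m ^ k)
    =O[atTop] fun m => t m ^ L

section PowExp

variable {t : ℕ → ℝ}

theorem PowExp.congr' {h h' : ℕ → ℝ} {a : PowerSeries ℚ} (H : PowExp t h a)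
    (e : h =ᶠ[atTop] h') : PowExp t h' a := by
  intro L
  refine (H L).congr' ?_ EventuallyEq.rfl
  filter_upwards [e] with m hm
  rw [hm]

theorem PowExp.isBigO_one {h : ℕ → ℝ} {a : PowerSeries ℚ} (H : PowExp t h a) :
    h =O[atTop] fun _ => (1 : ℝ) := by
  simpa using H 0

theorem sum_isBigO_one (ht : Tendsto t atTop (nhds 0)) (L : ℕ) (a : PowerSeries ℚ) :
    (fun m => ∑ k ∈ Finset.range L, ((PowerSeries.coeff k a : ℚ) : ℝ) * t m ^ k)
      =O[atTop] fun _ => (1 : ℝ) := by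
  refine IsBigO.fun_sum fun k _ => IsBigO.const_mul_left ?_ _
  exact (ht.pow k).isBigO_one ℝ

theorem aeval_isBigO (ht : Tendsto t atTop (nhds 0)) {p : Polynomial ℚ} {L : ℕ}
    (hp : ∀ k < L, p.coeff k = 0) :
    (fun m => Polynomial.aeval (t m) p) =O[atTop] fun m => t m ^ L := by
  obtain ⟨q, rfl⟩ := Polynomial.X_pow_dvd_iff.mpr hp
  have h1 : Tendsto (fun m => Polynomial.aeval (t m) q) atTop (nhds (Polynomial.aeval 0 q)) :=
    ((Polynomial.continuous_aeval q).tendsto 0).comp ht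
  simpa using (isBigO_refl (fun m => t m ^ L) atTop).mul (h1.isBigO_one ℝ)

theorem aeval_trunc (L : ℕ) (a : PowerSeries ℚ) (x : ℝ) :
    Polynomial.aeval x (PowerSeries.trunc L a)
      = ∑ k ∈ Finset.range L, ((PowerSeries.coeff k a : ℚ) : ℝ) * x ^ k := by
  rw [Polynomial.aeval_def, PowerSeries.eval₂_trunc_eq_sum_range]
  rfl

theorem powExp_aeval (ht : Tendsto t atTop (nhds 0)) (p : Polynomial ℚ) :
    PowExp t (fun m => Polynomial.aeval (t m) p) (p : PowerSeries ℚ) := by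
  intro L
  have h := aeval_isBigO ht (p := p - PowerSeries.trunc L (p : PowerSeries ℚ)) (L := L) (by
    intro k hk
    rw [Polynomial.coeff_sub, PowerSeries.coeff_trunc, if_pos hk, Polynomial.coeff_coe, sub_self])
  refine h.congr_left fun m => ?_
  rw [map_sub, aeval_trunc]

theorem PowExp.mul (ht : Tendsto t atTop (nhds 0)) {h h' : ℕ → ℝ} {a a' : PowerSeries ℚ}
    (H : PowExp t h a) (H' : PowExp t h' a') : PowExp t (fun m => h m * h' m) (a * a') := by
  intro L
  have h1 := (H L).mul H'.isBigO_one
  have h2 := (sum_isBigO_one ht L a).mul (H' L)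
  have h3 := aeval_isBigO ht (L := L)
    (p := PowerSeries.trunc L a * PowerSeries.trunc L a' - PowerSeries.trunc L (a * a')) (by
      intro k hk
      rw [Polynomial.coeff_sub, PowerSeries.coeff_trunc, if_pos hk,
        PowerSeries.coeff_mul_eq_coeff_trunc_mul_trunc a a' hk, ← Polynomial.coe_mul,
        Polynomial.coeff_coe, sub_self])
  simp only [mul_one, one_mul] at h1 h2
  refine ((h1.add h2).add h3).congr_left fun m => ?_
  simp only [map_sub, map_mul, aeval_trunc]
  ring

/-- The product of `h` with the truncation of a⁻¹ is 1 + O(t^L), and h⁻¹ is bounded because `h` has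
a nonzero limit. -/
theorem PowExp.inv (ht : Tendsto t atTop (nhds 0)) {h : ℕ → ℝ} {a : PowerSeries ℚ}
    (H : PowExp t h a) (ha : PowerSeries.constantCoeff a ≠ 0) :
    PowExp t (fun m => (h m)⁻¹) a⁻¹ := by
  intro L
  have hc : ((PowerSeries.constantCoeff a : ℚ) : ℝ) ≠ 0 := by exact_mod_cast ha
  have hlim : Tendsto h atTop (nhds ((PowerSeries.constantCoeff a : ℚ) : ℝ)) := by
    have h1 := H 1
    simp only [Finset.sum_range_one, pow_zero, mul_one, pow_one,
      PowerSeries.coeff_zero_eq_constantCoeff] at h1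
    have h2 := (h1.trans_tendsto ht).add_const ((PowerSeries.constantCoeff a : ℚ) : ℝ)
    simpa using h2
  have hinv : (fun m => (h m)⁻¹) =O[atTop] fun _ => (1 : ℝ) := (hlim.inv₀ hc).isBigO_one ℝ
  have h2 := PowExp.mul ht H (powExp_aeval ht (PowerSeries.trunc L a⁻¹)) L
  have h3 : (fun m => ∑ k ∈ Finset.range L, ((PowerSeries.coeff k
      (a * (PowerSeries.trunc L a⁻¹ : PowerSeries ℚ)) : ℚ) : ℝ) * t m ^ k - 1) =O[atTop]
        fun m => t m ^ L := by
    cases L with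
    | zero => simpa using isBigO_refl (fun _ : ℕ => (1 : ℝ)) atTop
    | succ L =>
      refine (isBigO_zero _ _).congr_left fun m => ?_
      have : ∀ k ∈ Finset.range (L + 1), ((PowerSeries.coeff k
          (a * (PowerSeries.trunc (L + 1) a⁻¹ : PowerSeries ℚ)) : ℚ) : ℝ) * t m ^ k
          = ((PowerSeries.coeff k (1 : PowerSeries ℚ) : ℚ) : ℝ) * t m ^ k := by
        intro k hk
        rw [Finset.mem_range] at hk
        rw [← PowerSeries.mul_inv_cancel a ha, PowerSeries.coeff_mul_eq_coeff_trunc_mul_trunc a _ hk,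
          PowerSeries.trunc_trunc, ← PowerSeries.coeff_mul_eq_coeff_trunc_mul_trunc a _ hk]
      rw [Finset.sum_congr rfl this, Finset.sum_range_succ']
      simp [PowerSeries.coeff_one]
  have h4 := (hinv.mul (h2.add h3)).neg_left
  simp only [one_mul] at h4
  refine h4.congr' ?_ EventuallyEq.rfl
  filter_upwards [hlim.eventually_ne hc] with m hm
  rw [aeval_trunc]
  field_simp
  ring

end PowExp

/-! ### From inverse factorial to power expansions -/

/-- The power series of `Φ_k` in `1 / x`. -/
noncomputable def PhiSeries (k : ℕ) : PowerSeries ℚ :=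
  ∏ i ∈ Finset.range k,
    (PowerSeries.X * ((1 - Polynomial.C ((i : ℚ) + 1) * Polynomial.X : Polynomial ℚ)
      : PowerSeries ℚ)⁻¹)

theorem X_pow_dvd_PhiSeries (k : ℕ) : (PowerSeries.X : PowerSeries ℚ) ^ k ∣ PhiSeries k := by
  rw [PhiSeries, Finset.prod_mul_distrib, Finset.prod_const, Finset.card_range]
  exact Dvd.intro _ rfl

theorem tendsto_inv_two_mul_add (x0 : ℕ) :
    Tendsto (fun m : ℕ => (2 * (m : ℝ) + x0)⁻¹) atTop (nhds 0) := by
  have h := tendsto_inv_atTop_zero.comp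
    ((tendsto_natCast_atTop_atTop (R := ℝ)).comp (tendsto_two_mul_add x0))
  refine h.congr fun m => ?_
  simp

theorem powExp_Phi (x0 k : ℕ) :
    PowExp (fun m : ℕ => (2 * (m : ℝ) + x0)⁻¹) (fun m => Phi k (2 * m + x0)) (PhiSeries k) := by
  have ht := tendsto_inv_two_mul_add x0
  induction k with
  | zero =>
    have h := powExp_aeval ht 1
    simpa [PhiSeries] using h
  | succ k ih =>
    have h1 := powExp_aeval ht Polynomial.X
    have h2 := (powExp_aeval ht (1 - Polynomial.C ((k : ℚ) + 1) * Polynomial.X)).inv ht (by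
      rw [← PowerSeries.coeff_zero_eq_constantCoeff, Polynomial.coeff_coe]
      simp)
    have h3 := PowExp.mul ht ih (PowExp.mul ht h1 h2)
    rw [PhiSeries, Finset.prod_range_succ, ← PhiSeries]
    rw [Polynomial.coe_X] at h3
    refine h3.congr' ?_
    filter_upwards [eventually_gt_atTop 0] with m hm
    have hm' : (0 : ℝ) < m := by exact_mod_cast hm
    have hx : (2 * (m : ℝ) + x0) ≠ 0 := by positivity
    rw [Phi_succ]
    congr 1
    simp only [map_sub, map_mul, map_one, Polynomial.aeval_X, Polynomial.aeval_C]
    rw [← mul_inv]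
    congr 1
    simp
    field_simp

/-- Conversion of coefficients from inverse factorials to inverse powers. -/
noncomputable def toPow : PowerSeries ℚ →+ PowerSeries ℚ where
  toFun g := PowerSeries.mk fun k => ∑ j ∈ Finset.range (k + 1),
    PowerSeries.coeff j g * PowerSeries.coeff k (PhiSeries j)
  map_zero' := by
    ext k
    simp
  map_add' g g' := by
    ext k
    simp [add_mul, Finset.sum_add_distrib]

theorem coeff_toPow (g : PowerSeries ℚ) {k n : ℕ} (h : k < n) :
    PowerSeries.coeff k (toPow g) = ∑ j ∈ Finset.range n,
      PowerSeries.coeff j g * PowerSeries.coeff k (PhiSeries j) := by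
  have h1 : PowerSeries.coeff k (toPow g) = ∑ j ∈ Finset.range (k + 1),
      PowerSeries.coeff j g * PowerSeries.coeff k (PhiSeries j) := by
    simp [toPow]
  rw [h1]
  refine Finset.sum_subset (Finset.range_subset_range.mpr h) fun j _ hj => ?_
  rw [Finset.mem_range] at hj
  rw [PowerSeries.X_pow_dvd_iff.mp (X_pow_dvd_PhiSeries j) k (by omega), mul_zero]

theorem X_pow_dvd_toPow {g : PowerSeries ℚ} {n : ℕ} (h : (PowerSeries.X : PowerSeries ℚ) ^ n ∣ g) :
    (PowerSeries.X : PowerSeries ℚ) ^ n ∣ toPow g := by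
  rw [PowerSeries.X_pow_dvd_iff] at h ⊢
  intro k hk
  rw [coeff_toPow g (Nat.lt_succ_self k)]
  refine Finset.sum_eq_zero fun j hj => ?_
  rw [Finset.mem_range] at hj
  rw [h j (by omega), zero_mul]

theorem constantCoeff_toPow (g : PowerSeries ℚ) :
    PowerSeries.constantCoeff (toPow g) = PowerSeries.constantCoeff g := by
  rw [← PowerSeries.coeff_zero_eq_constantCoeff, coeff_toPow g (Nat.lt_succ_self 0)]
  simp [PhiSeries]

theorem InvFactExp.powExp {x0 : ℕ} {h : ℕ → ℝ} {g : PowerSeries ℚ} (H : InvFactExp x0 h g) :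
    PowExp (fun m : ℕ => (2 * (m : ℝ) + x0)⁻¹) h (toPow g) := by
  intro L
  have h0 : (fun m : ℕ => ((m : ℝ) ^ L)⁻¹) =O[atTop]
      fun m : ℕ => (2 * (m : ℝ) + x0)⁻¹ ^ L := by
    refine IsBigO.of_bound ((2 + x0 : ℝ) ^ L) ?_
    filter_upwards [eventually_ge_atTop 1] with m hm
    have hm' : (1 : ℝ) ≤ m := by exact_mod_cast hm
    have hx : (0 : ℝ) ≤ x0 := Nat.cast_nonneg x0
    rw [Real.norm_of_nonneg (by positivity), Real.norm_of_nonneg (by positivity), inv_pow,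
      ← div_eq_mul_inv, le_div_iff₀ (by positivity), inv_mul_le_iff₀ (by positivity), ← mul_pow]
    refine pow_le_pow_left₀ (by positivity) ?_ L
    nlinarith
  have h1 : (fun m : ℕ => ∑ j ∈ Finset.range L, ((PowerSeries.coeff j g : ℚ) : ℝ)
      * (Phi j (2 * m + x0) - ∑ k ∈ Finset.range L,
        ((PowerSeries.coeff k (PhiSeries j) : ℚ) : ℝ) * (2 * (m : ℝ) + x0)⁻¹ ^ k)) =O[atTop]
      fun m : ℕ => (2 * (m : ℝ) + x0)⁻¹ ^ L :=
    IsBigO.fun_sum fun j _ => IsBigO.const_mul_left (powExp_Phi x0 j L) _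
  refine (((H L).trans h0).add h1).congr_left fun m => ?_
  have h2 : ∑ k ∈ Finset.range L, ((PowerSeries.coeff k (toPow g) : ℚ) : ℝ)
        * (2 * (m : ℝ) + x0)⁻¹ ^ k
      = ∑ j ∈ Finset.range L, ((PowerSeries.coeff j g : ℚ) : ℝ)
        * ∑ k ∈ Finset.range L, ((PowerSeries.coeff k (PhiSeries j) : ℚ) : ℝ)
          * (2 * (m : ℝ) + x0)⁻¹ ^ k := by
    simp only [Finset.mul_sum]
    rw [Finset.sum_comm]
    refine Finset.sum_congr rfl fun k hk => ?_
    rw [Finset.mem_range] at hk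
    rw [coeff_toPow g hk]
    push_cast
    rw [Finset.sum_mul]
    refine Finset.sum_congr rfl fun j _ => ?_
    ring
  rw [h2]
  simp only [mul_sub, Finset.sum_sub_distrib]
  ring

/-! ### Sums over subsets of insertions -/

/-- Values of the sum of `f` over all sublists, counted by positions. -/
def subsumAux {M : Type*} [AddCommMonoid M] : List ℕ → (List ℕ → M) → M
  | [], f => f []
  | d :: l, f => subsumAux l f + subsumAux l (der d f)

/-- The sum of `f` over all sublists, counted by positions. -/
def subsum {M : Type*} [AddCommMonoid M] (f : List ℕ → M) (l : List ℕ) : M := subsumAux l f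

theorem subsum_cons {M : Type*} [AddCommMonoid M] (f : List ℕ → M) (d : ℕ) (l : List ℕ) :
    subsum f (d :: l) = subsum f l + subsum (der d f) l := rfl

theorem shuf_one (f : List ℕ → PowerSeries ℚ) (l : List ℕ) : shuf one f l = subsum f l := by
  induction l generalizing f with
  | nil => simp [one, subsum, subsumAux]
  | cons d l ih => rw [shuf_cons, der_one, ih, ih, subsum_cons]

theorem map_subsum {M M' : Type*} [AddCommMonoid M] [AddCommMonoid M'] (F : M →+ M')
    (f : List ℕ → M) (l : List ℕ) : F (subsum f l) = subsum (fun l => F (f l)) l := by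
  induction l generalizing f with
  | nil => rfl
  | cons d l ih => rw [subsum_cons, map_add, ih, ih, subsum_cons]; rfl

/-- The expansion attached to a set of insertions, relative to `γ`. -/
noncomputable def relConn (l : List ℕ) : PowerSeries ℚ :=
  toPow (conn l) * (toPow (shiftSeries []))⁻¹

theorem constantCoeff_toPow_shiftSeries_nil :
    PowerSeries.constantCoeff (toPow (shiftSeries [])) = 1 := by
  rw [constantCoeff_toPow]
  simp [shiftSeries, shiftZ_zero]

theorem relConn_nil : relConn [] = 1 := by
  rw [relConn, conn_nil, PowerSeries.mul_inv_cancel]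
  rw [constantCoeff_toPow_shiftSeries_nil]
  exact one_ne_zero

theorem sym_relConn : Sym relConn := by
  intro l l' hp
  rw [relConn, relConn, sym_conn _ _ hp]

theorem coeff_relConn_eq_zero {l : List ℕ} (hl : l ≠ []) {k : ℕ} (hk : k ≤ X l) :
    PowerSeries.coeff k (relConn l) = 0 := by
  have h : (PowerSeries.X : PowerSeries ℚ) ^ (X l + 1) ∣ relConn l :=
    (X_pow_dvd_toPow (X_pow_dvd_conn hl)).mul_right _
  exact PowerSeries.X_pow_dvd_iff.mp h k (by omega)

/-- The expansions of πC and πγ are taken in the same variable X(l, m), so they may be divided; the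
quotient distributes over the sum over sublists. -/
theorem powExp_Chat (l : List ℕ) :
    PowExp (fun m : ℕ => (X (l ++ [m]) : ℝ)⁻¹) (fun m => Chat (l ++ [m])) (subsum relConn l) := by
  have ht := tendsto_inv_two_mul_add (X l + 1)
  have h1 := (invFactExp_C l).powExp
  have h2 := (invFactExp_gam (X l + 1)).powExp.inv ht (by
    rw [constantCoeff_toPow_shiftSeries_nil]; exact one_ne_zero)
  have h3 := PowExp.mul ht h1 h2
  have e : toPow (shuf one conn l) * (toPow (shiftSeries []))⁻¹ = subsum relConn l := by
    rw [shuf_one, map_subsum]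
    exact map_subsum (AddMonoidHom.mulRight (toPow (shiftSeries []))⁻¹) _ l
  rw [e] at h3
  have hX : ∀ m : ℕ, (X (l ++ [m]) : ℝ) = 2 * m + (X l + 1 : ℕ) := by
    intro m
    rw [X_append_singleton]; push_cast; ring
  simp only [hX]
  refine h3.congr' (Eventually.of_forall fun m => ?_)
  simp only [Chat, hX]
  have hp := Real.pi_pos.ne'
  rw [← div_eq_mul_inv, mul_div_mul_left _ _ hp]

end BGW

namespace BGW

/-! ### Sums over sublists as polynomials in the multiplicities. -/

theorem weightedTotalDegree_add_le {σ R : Type*} [CommSemiring R] (u : σ → ℕ) {N : ℕ}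
    {p q : MvPolynomial σ R} (hp : MvPolynomial.weightedTotalDegree u p ≤ N)
    (hq : MvPolynomial.weightedTotalDegree u q ≤ N) :
    MvPolynomial.weightedTotalDegree u (p + q) ≤ N := by
  classical
  refine Finset.sup_le fun s hs => ?_
  rcases Finset.mem_union.mp (MvPolynomial.support_add hs) with h | h
  · exact (MvPolynomial.le_weightedTotalDegree u h).trans hp
  · exact (MvPolynomial.le_weightedTotalDegree u h).trans hq

theorem weightedTotalDegree_mul_le {σ R : Type*} [CommSemiring R] (u : σ → ℕ) {N N' : ℕ}
    {p q : MvPolynomial σ R} (hp : MvPolynomial.weightedTotalDegree u p ≤ N)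
    (hq : MvPolynomial.weightedTotalDegree u q ≤ N') :
    MvPolynomial.weightedTotalDegree u (p * q) ≤ N + N' := by
  classical
  refine Finset.sup_le fun s hs => ?_
  obtain ⟨a, ha, b, hb, rfl⟩ := Finset.mem_add.mp (MvPolynomial.support_mul p q hs)
  rw [map_add]
  exact add_le_add ((MvPolynomial.le_weightedTotalDegree u ha).trans hp)
    ((MvPolynomial.le_weightedTotalDegree u hb).trans hq)

theorem weightedTotalDegree_C_le {σ R : Type*} [CommSemiring R] (u : σ → ℕ) (r : R) (N : ℕ) :
    MvPolynomial.weightedTotalDegree u (MvPolynomial.C r) ≤ N := by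
  classical
  refine Finset.sup_le fun s hs => ?_
  have hs0 : s = 0 := by
    by_contra h
    rw [MvPolynomial.mem_support_iff, MvPolynomial.coeff_C, if_neg (Ne.symm h)] at hs
    exact hs rfl
  simp [hs0]

theorem weightedTotalDegree_X_le {σ R : Type*} [CommSemiring R] (u : σ → ℕ) (i : σ) :
    MvPolynomial.weightedTotalDegree u (MvPolynomial.X i : MvPolynomial σ R) ≤ u i := by
  classical
  refine Finset.sup_le fun s hs => ?_
  have hsi : s = Finsupp.single i 1 := by
    by_contra h
    rw [MvPolynomial.mem_support_iff, MvPolynomial.coeff_X, if_neg (Ne.symm h)] at hs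
    exact hs rfl
  simp [hsi, Finsupp.weight_single]

theorem weightedTotalDegree_sum_le {σ R ι : Type*} [CommSemiring R] (u : σ → ℕ) {N : ℕ}
    (S : Finset ι) (p : ι → MvPolynomial σ R)
    (hp : ∀ i ∈ S, MvPolynomial.weightedTotalDegree u (p i) ≤ N) :
    MvPolynomial.weightedTotalDegree u (∑ i ∈ S, p i) ≤ N := by
  classical
  induction S using Finset.induction_on with
  | empty => simp [MvPolynomial.weightedTotalDegree]
  | insert i S hi ih =>
    rw [Finset.sum_insert hi]
    exact weightedTotalDegree_add_le u (hp i (by simp))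
      (ih fun j hj => hp j (Finset.mem_insert_of_mem hj))

/-- The polynomial `binom(p_b, j)`. -/
noncomputable def binomPoly (b : ℕ+) : ℕ → MvPolynomial ℕ+ ℚ
  | 0 => 1
  | j + 1 => binomPoly b j * (MvPolynomial.C (((j : ℚ) + 1)⁻¹) *
      (MvPolynomial.X b + MvPolynomial.C (-(j : ℚ))))

theorem weightedTotalDegree_binomPoly_le (u : ℕ+ → ℕ) (b : ℕ+) (j : ℕ) :
    MvPolynomial.weightedTotalDegree u (binomPoly b j) ≤ j * u b := by
  induction j with
  | zero =>
    rw [binomPoly, ← MvPolynomial.C_1]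
    exact weightedTotalDegree_C_le u 1 _
  | succ j ih =>
    have h := weightedTotalDegree_mul_le u (weightedTotalDegree_C_le u (((j : ℚ) + 1)⁻¹) 0)
      (weightedTotalDegree_add_le u (weightedTotalDegree_X_le u b)
        (weightedTotalDegree_C_le u (-(j : ℚ)) (u b)))
    refine (weightedTotalDegree_mul_le u ih h).trans (le_of_eq ?_)
    ring

theorem eval_binomPoly (g : ℕ+ → ℚ) (b : ℕ+) {n : ℕ} (hg : g b = n) (j : ℕ) :
    MvPolynomial.eval g (binomPoly b j) = (n.choose j : ℚ) := by
  induction j with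
  | zero => simp [binomPoly]
  | succ j ih =>
    have hj : ((j : ℚ) + 1) ≠ 0 := by positivity
    have h : (n.choose (j + 1) : ℚ) * (j + 1) = n.choose j * (n - j) := by
      rcases le_or_gt j n with hjn | hjn
      · have := Nat.choose_succ_right_eq n j
        rw [← Nat.cast_sub hjn]
        exact_mod_cast this
      · rw [Nat.choose_eq_zero_of_lt hjn, Nat.choose_eq_zero_of_lt (hjn.trans j.lt_succ_self)]
        simp
    rw [binomPoly, map_mul, map_mul, map_add, MvPolynomial.eval_C, MvPolynomial.eval_C,
      MvPolynomial.eval_X, hg, ih, ← mul_right_cancel_iff_of_pos (by positivity : (0 : ℚ) < j + 1),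
      h]
    field_simp
    ring

theorem Sym.der_iterate {M : Type*} {f : List ℕ → M} (h : Sym f) (b j : ℕ) :
    Sym ((BGW.der b)^[j] f) := by
  induction j with
  | zero => exact h
  | succ j ih => rw [Function.iterate_succ_apply']; exact ih.der b

theorem Sym.der_iterate_comm {M : Type*} {f : List ℕ → M} (h : Sym f) (b e j : ℕ) :
    (BGW.der b)^[j] (BGW.der e f) = BGW.der e ((BGW.der b)^[j] f) := by
  induction j with
  | zero => rfl
  | succ j ih =>
    rw [Function.iterate_succ_apply', ih, (h.der_iterate b j).der_comm,
      ← Function.iterate_succ_apply' (BGW.der b)]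

theorem der_iterate_apply {M : Type*} (f : List ℕ → M) (b j : ℕ) (l : List ℕ) :
    (der b)^[j] f l = f (List.replicate j b ++ l) := by
  induction j generalizing l with
  | zero => rfl
  | succ j ih =>
    rw [Function.iterate_succ_apply', der, ih, List.replicate_succ']
    simp

/-- Pascal's rule; `s J = 0` removes the boundary term. -/
theorem sum_range_choose_succ (c J : ℕ) (s : ℕ → ℚ) (hs : s J = 0) :
    ∑ j ∈ Finset.range J, ((c + 1).choose j : ℚ) * s j
      = ∑ j ∈ Finset.range J, (c.choose j : ℚ) * s j
        + ∑ j ∈ Finset.range J, (c.choose j : ℚ) * s (j + 1) := by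
  have key : ∀ n : ℕ, ∑ j ∈ Finset.range J, (n.choose j : ℚ) * s j
      = ∑ j ∈ Finset.range J, (n.choose (j + 1) : ℚ) * s (j + 1) + s 0 := by
    intro n
    have h := Finset.sum_range_succ (fun j => (n.choose j : ℚ) * s j) J
    rw [Finset.sum_range_succ', hs] at h
    simpa using h.symm
  rw [key, key, add_right_comm, ← Finset.sum_add_distrib]
  congr 1
  refine Finset.sum_congr rfl fun j _ => ?_
  rw [Nat.choose_succ_succ]
  push_cast
  ring

/-- Collecting the entries equal to `b` in a sum over sublists. -/
theorem subsum_eq_sum_choose (b J : ℕ) (f : List ℕ → ℚ) (hf : Sym f)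
    (hJ : ∀ l, (der b)^[J] f l = 0) (l : List ℕ) :
    subsum f l = ∑ j ∈ Finset.range J,
      ((l.count b).choose j : ℚ) * subsum ((der b)^[j] f) (l.filter (· ≠ b)) := by
  induction l generalizing f with
  | nil =>
    rcases J with _ | J
    · exact hJ []
    · rw [Finset.sum_range_succ']
      simp
  | cons e l ih =>
    have hJ' : ∀ l, (der b)^[J] (der e f) l = 0 := by
      intro l
      rw [hf.der_iterate_comm]
      exact hJ (e :: l)
    rw [subsum_cons, ih f hf hJ, ih (der e f) (hf.der e) hJ']
    by_cases h : e = b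
    · subst h
      have hs : subsum ((der e)^[J] f) (l.filter (· ≠ e)) = 0 := by
        have hz : (der e)^[J] f = fun l => (0 : ℚ →+ ℚ) (f l) := by
          funext l
          exact hJ l
        rw [hz, ← map_subsum]
        rfl
      have := sum_range_choose_succ (l.count e) J
        (fun j => subsum ((der e)^[j] f) (l.filter (· ≠ e))) hs
      simpa using this.symm
    · rw [List.count_cons_of_ne h, ← Finset.sum_add_distrib]
      refine Finset.sum_congr rfl fun j _ => ?_
      rw [List.filter_cons_of_pos (by simpa using h), subsum_cons, hf.der_iterate_comm]
      ring

theorem X_replicate_append (j b : ℕ) (l : List ℕ) :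
    X (List.replicate j b ++ l) = j * (2 * b + 1) + X l := by
  simp [X]

/-- A nonempty sublist already has X ≥ 2b+1 > N. -/
theorem subsum_eq_apply_nil {b N : ℕ} (hb : N < 2 * b + 1) {f : List ℕ → ℚ}
    (hN : ∀ l, N < X l → f l = 0) {l : List ℕ} (hl : ∀ d ∈ l, b ≤ d) : subsum f l = f [] := by
  induction l with
  | nil => rfl
  | cons d l ih =>
    have hd := hl d (by simp)
    have hz : der d f = fun l => (0 : ℚ →+ ℚ) (f l) := by
      funext l
      refine hN (d :: l) ?_
      rw [X_cons]
      omega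
    rw [subsum_cons, ih fun e he => hl e (List.mem_cons_of_mem _ he), hz, ← map_subsum]
    simp

/-- A sum over sublists is a polynomial in the multiplicities, of weighted degree at most `N`,
if the summand is supported on `X ≤ N`. -/
theorem exists_polynomial_subsum (f : List ℕ → ℚ) (hf : Sym f) (N : ℕ)
    (hN : ∀ l, N < X l → f l = 0) (b : ℕ+) :
    ∃ p : MvPolynomial ℕ+ ℚ,
      MvPolynomial.weightedTotalDegree (fun d : ℕ+ => 2 * (d : ℕ) + 1) p ≤ N ∧
      ∀ (l : List ℕ) (g : ℕ+ → ℚ), (∀ d ∈ l, (b : ℕ) ≤ d) → (∀ r, b ≤ r → g r = mult l r) →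
        MvPolynomial.eval g p = subsum f l := by
  induction hn : N + 1 - b using Nat.strong_induction_on generalizing f N b with
  | _ n ih =>
  by_cases hb : N < 2 * (b : ℕ) + 1
  · refine ⟨MvPolynomial.C (f []), weightedTotalDegree_C_le _ _ _, fun l g hl _ => ?_⟩
    rw [MvPolynomial.eval_C, subsum_eq_apply_nil hb hN hl]
  set x := 2 * (b : ℕ) + 1 with hx
  -- Taking out `j` copies of `b` spends j(2b+1) of the degree budget `N`, exactly the weighted
  -- degree of `binomPoly b j`.
  have hsub : ∀ j l, N - j * x < X l → (der b)^[j] f l = 0 := by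
    intro j l hl
    rw [der_iterate_apply]
    refine hN _ ?_
    rw [X_replicate_append, ← hx]
    omega
  have hstep := fun j => ih (N - j * x + 1 - (b + 1 : ℕ+)) (by
    have : N - j * x ≤ N := Nat.sub_le _ _
    rw [PNat.add_coe, PNat.one_coe]
    omega) ((der b)^[j] f) (hf.der_iterate b j) (N - j * x) (hsub j) (b + 1) rfl
  choose p hpdeg hpeval using hstep
  refine ⟨∑ j ∈ Finset.range (N / x + 1), binomPoly b j * p j,
    weightedTotalDegree_sum_le _ _ _ fun j hj => ?_, fun l g hl hg => ?_⟩
  · refine (weightedTotalDegree_mul_le _ (weightedTotalDegree_binomPoly_le _ b j)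
      (hpdeg j)).trans (le_of_eq ?_)
    have h1 : j ≤ N / x := Nat.lt_succ_iff.mp (Finset.mem_range.mp hj)
    have h2 : j * x ≤ N := (Nat.mul_le_mul_right x h1).trans (Nat.div_mul_le_self N x)
    exact Nat.add_sub_of_le h2
  · have hJ : ∀ l, (der b)^[N / x + 1] f l = 0 := by
      intro l
      rw [der_iterate_apply]
      refine hN _ ?_
      rw [X_replicate_append, ← hx]
      have : N < (N / x + 1) * x := by
        rw [mul_comm]
        exact Nat.lt_mul_div_succ N (by omega)
      omega
    rw [subsum_eq_sum_choose b (N / x + 1) f hf hJ l, map_sum]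
    refine Finset.sum_congr rfl fun j _ => ?_
    rw [map_mul, eval_binomPoly g b (hg b le_rfl)]
    congr 1
    -- The same `g` serves for the list with the entries `b` removed, because only its values above
    -- `b` are constrained there.
    refine hpeval j _ g (fun d hd => ?_) fun r hr => ?_
    · rw [List.mem_filter] at hd
      have h1 := hl d hd.1
      have h2 : d ≠ b := by simpa using hd.2
      rw [PNat.add_coe, PNat.one_coe]
      omega
    · have hr' : b < r := PNat.add_one_le_iff.mp hr
      rw [hg r hr'.le, mult, mult, List.count_filter]
      have : (r : ℕ) ≠ b := fun h => hr'.ne (PNat.coe_injective h.symm)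
      simpa using this

theorem sym_coeff_relConn (k : ℕ) : Sym fun l => PowerSeries.coeff k (relConn l) :=
  fun l l' hp => congrArg (PowerSeries.coeff k) (sym_relConn l l' hp)

theorem coeff_subsum_relConn (k : ℕ) (l : List ℕ) :
    PowerSeries.coeff k (subsum relConn l)
      = subsum (fun l => PowerSeries.coeff k (relConn l)) l :=
  map_subsum (PowerSeries.coeff k).toAddMonoidHom relConn l

theorem coeff_relConn_eq_zero_of_lt {k : ℕ} {l : List ℕ} (h : k - 1 < X l) :
    PowerSeries.coeff k (relConn l) = 0 := by
  refine coeff_relConn_eq_zero ?_ (by omega)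
  rintro rfl
  simp [X] at h

theorem exists_polynomial_coeff (k : ℕ) :
    ∃ p : MvPolynomial ℕ+ ℚ,
      MvPolynomial.weightedTotalDegree (fun d : ℕ+ => 2 * (d : ℕ) + 1) p ≤ k - 1 ∧
      ∀ l : List ℕ, (∀ d ∈ l, 1 ≤ d) →
        MvPolynomial.eval (mult l) p = PowerSeries.coeff k (subsum relConn l) := by
  obtain ⟨p, hp, hp'⟩ := exists_polynomial_subsum _ (sym_coeff_relConn k) (k - 1)
    (fun l hl => coeff_relConn_eq_zero_of_lt hl) 1
  refine ⟨p, hp, fun l hl => ?_⟩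
  rw [coeff_subsum_relConn]
  exact hp' l _ hl fun _ _ => rfl

theorem coeff_zero_subsum_relConn (l : List ℕ) :
    PowerSeries.coeff 0 (subsum relConn l) = 1 := by
  rw [coeff_subsum_relConn, subsum_eq_apply_nil (b := 0) (N := 0) (by omega)
    (fun l hl => coeff_relConn_eq_zero_of_lt (by simpa using hl)) (by simp), relConn_nil]
  simp

end BGW

theorem theorem1p2 :
    ∃ c : ℕ → MvPolynomial ℕ+ ℚ,
      c 0 = 1 ∧
      (∀ k, 1 ≤ k → MvPolynomial.eval (fun _ => (0 : ℚ)) (c k) = 0) ∧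
      (∀ k, 1 ≤ k →
        MvPolynomial.weightedTotalDegree (fun d : ℕ+ => 2 * (d : ℕ) + 1) (c k) ≤ k - 1) ∧
      ∀ d' : List ℕ, (∀ d ∈ d', 1 ≤ d) → ∀ L : ℕ,
        (fun m : ℕ => BGW.Chat (d' ++ [m])
            - ∑ k ∈ Finset.range L,
                ((MvPolynomial.eval (BGW.mult d') (c k) : ℚ) : ℝ) / (BGW.X (d' ++ [m]) : ℝ) ^ k)
          =O[atTop] fun m : ℕ => 1 / (BGW.X (d' ++ [m]) : ℝ) ^ L := by
  choose p hdeg heval using BGW.exists_polynomial_coeff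
  -- `p 0` is known only through its values at multiplicities, and they all equal 1; putting the
  -- constant 1 in its place makes the equality one of polynomials.
  refine ⟨fun k => if k = 0 then 1 else p k, by simp, fun k hk => ?_, fun k hk => ?_,
    fun l hl L => ?_⟩
  · have hk0 : k ≠ 0 := by omega
    -- All p_b = 0 is the case of the empty tuple, whose expansion is the series 1.
    have h := heval k [] (by simp)
    have hm : BGW.mult [] = fun _ => (0 : ℚ) := by
      funext r
      simp [BGW.mult]
    have hnil : BGW.subsum BGW.relConn [] = 1 := BGW.relConn_nil
    rw [hm, hnil, PowerSeries.coeff_one, if_neg hk0] at h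
    simpa only [if_neg hk0] using h
  · have hk0 : k ≠ 0 := by omega
    simpa only [if_neg hk0] using hdeg k
  · have hc : ∀ k, MvPolynomial.eval (BGW.mult l) (if k = 0 then 1 else p k)
        = PowerSeries.coeff k (BGW.subsum BGW.relConn l) := by
      intro k
      by_cases hk : k = 0
      · rw [if_pos hk, hk, BGW.coeff_zero_subsum_relConn, map_one]
      · rw [if_neg hk, heval k l hl]
    have h := BGW.powExp_Chat l L
    simpa only [hc, inv_pow, div_eq_mul_inv, one_mul] using h
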